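/- **Setting.** Let $n\ge 2$, $k=n-1$, and let $R(T)=\mathbb{Z}[e^{\pm a_1},\dots,e^{\pm a_n}]/(e^{a_1+\cdots+a_n}-1)$. Put $b_i=1-e^{-a_i}$, with indices taken modulo $n$, and $\Omega(b_i|y)=\prod_{j\ge1}(1-b_iy_j)^{-1}$ for infinitely many variables $y=(y_1,y_2,\dots)$. Permutations of the $a_i$ act on (symmetric) power series in $y$ through the coefficients; $\omega$ denotes $b_i\mapsto b_{i+1}$. *$K$-$k$-Schur functions.* For $i\in\mathbb{Z}/n$ let $T_i=(1-e^{a_i-a_{i+1}})^{-1}(s_i-1)$ and $D_i=T_i+1$, where for $i\ne0$ $s_i$ exchanges $a_i,a_{i+1}$, and $s_0(f)=\frac{\Omega(b_1|y)}{\Omega(b_n|y)}s_\theta(f)$ with $s_\theta$ exchanging $a_1,a_n$. For a $k$-bounded partition $\lambda$ let $s_{i_1}\cdots s_{i_\ell}$ be the reduced word obtained by reading the residues $(\text{column}-\text{row})\bmod n$ of the boxes of $\lambda$, rows from bottom to top, each row from right to left. Put $g^{(k)}_\lambda(y|b)=T_{i_1}\cdots T_{i_\ell}(1)$ and $\tilde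 g^{(k)}_\lambda(y|b)=D_{i_1}\cdots D_{i_\ell}(1)$ (so $\tilde g^{(k)}_\varnothing=1$); $f(y|\omega^m b)$ is $f(y|b)$ with $b_i$ replaced by $b_{i+m}$. *Centralizer family.* Let $A$ be the $n\times n$ matrix with diagonal $e^{-a_1},\dots,e^{-a_n}$, all superdiagonal entries $-1$ and zeros elsewhere, and $P$ the lower unitriangular matrix with entries $e_{i-j}(e^{-a_1},\dots,e^{-a_{i-1}})$, $j\le i$, where $e_m$ denotes the elementary symmetric polynomial. Let $\mathscr{O}(\tilde{\mathscr Z})$ be the $R(T)$-algebra generated by the entries of an upper triangular matrix $Z=(z_{ij})$ and by the $z_{ii}^{-1}$, subject to $AZ=ZA$. Let $\tau_i,\sigma_i$ be the $i$-th leading principal minors of $ZAP$ and $ZP$ ($\tau_0=\sigma_0=1$), let $\sigma$ be the $R(T)$-algebra automorphism $\sigma(Z)=ZA^{-1}$ (so $\sigma(\tau_i)=\sigma_i$), and identify elements of $\mathscr{O}(\tilde{\mathscr Z})$ with symmetric functions by $z_{ij}=e^{a_i+\cdots+a_{j-1}}\,\Omega(b_i|y)\,g^{(k)}_{(j-i)}(y|\omega^ib)$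 for $i\le j$; in particular $z_{ii}=\Omega(b_i|y)$. *Quantum side.* For $0\le m\le i\le n$ let $F^{(i)}_m(z,Q)=\sum_{J\subseteq\{1,\dots,i\},\,|J|=m}\ \prod_{j\in J,\,j+1\notin J}(1-Q_j)\prod_{j\in J}z_j$ with $Q_n=0$. Let $\mathscr{O}(\mathscr Y)$ be the quotient of $R(T)[z_1,\dots,z_n,Q_1,\dots,Q_{n-1}]$ by the ideal generated by $F^{(n)}_i-e_i(e^{-a_1},\dots,e^{-a_n})$, $1\le i\le n$, and $\mathscr{O}(\mathscr Y^\circ)=\mathscr{O}(\mathscr Y)[Q_1^{-1},\dots,Q_{n-1}^{-1}]$. With $\eta_i=1-e^{a_{n-i+1}}$ put $$\psi_i=\sum_{j=0}^{i}(-1)^j(1-\eta_{n-i})^jF^{(i)}_j(z,Q)\quad(1\le i\le n-1),\qquad \mathfrak{G}^Q_{w_\circ}=\prod_{i=1}^{n-1}\psi_i .$$ **Statement.** There is a unique $R(T)$-algebra homomorphism $\Phi_n:\mathscr{O}(\mathscr Y^\circ)\to\mathscr{O}(\tilde{\mathscr Z})[\tau_i^{-1},\sigma_i^{-1}\mid 1\le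 i\le n]$ with $$z_i\mapsto\frac{\tau_i\sigma_{i-1}}{\sigma_i\tau_{i-1}}\ (1\le i\le n),\qquad Q_i\mapsto\frac{\tau_{i-1}\tau_{i+1}}{\tau_i^2}\ (1\le i\le n-1),$$ and $\tilde\Phi_n=\sigma\circ\Phi_n$, with values in symmetric functions through the identification above, satisfies for all $1\le i\le n-1$ $$\tilde\Phi_n(\psi_i)=\frac{\prod_{l=1}^{i}\Omega(b_{i+l+1}|y)}{\sigma_i}\cdot\tilde g^{(k)}_{(n-i-1)^i}(y|\omega^{2i+1}b),$$ where $(n-i-1)^i$ is the rectangular partition with $i$ rows of length $n-i-1$. Consequently $$\tilde\Phi_n(\mathfrak{G}^Q_{w_\circ})=\frac{\prod_{i=1}^{n-1}\prod_{l=1}^{i}\Omega(b_{i+l+1}|y)}{\sigma_1\sigma_2\cdots\sigma_{n-1}}\cdot\prod_{i=1}^{n-2}\tilde g^{(k)}_{(n-i-1)^i}(y|\omega^{2i+1}b).$$ -/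

import Mathlib

noncomputable section

namespace KPeterson

/-! ### The representation ring of the maximal torus of `SL_n` -/

/-- The weight lattice of `SL_n`: `ℤ a_1 ⊕ ⋯ ⊕ ℤ a_n` modulo `a_1 + ⋯ + a_n = 0`.
Indices live in `ℤ/n`, so that `a_0 = a_n`. -/
abbrev Weight (n : ℕ) : Type :=
  (ZMod n → ℤ) ⧸ AddSubgroup.zmultiples (1 : ZMod n → ℤ)

/-- The weight `a_i`. -/
def wt (n : ℕ) (i : ZMod n) : Weight n :=
  QuotientAddGroup.mk (Pi.single i 1)

/-- `R(T) = ℤ[e^{±a_i}] / (e^{a_1 + ⋯ + a_n} - 1)`, as the group ring of the weight lattice. -/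
def RT (n : ℕ) : Type := AddMonoidAlgebra ℤ (Weight n)

instance (n : ℕ) : CommRing (RT n) := inferInstanceAs (CommRing (AddMonoidAlgebra ℤ (Weight n)))

/-- The differences of coordinates separate the points of the weight lattice. -/
def weightDiff (n : ℕ) : Weight n →+ (ZMod n × ZMod n → ℤ) :=
  QuotientAddGroup.lift _
    { toFun := fun v p => v p.1 - v p.2
      map_zero' := by ext p; simp
      map_add' := fun v w => by ext p; simp; ring }
    (by
      rintro _ ⟨k, rfl⟩
      ext p
      simp)

theorem weightDiff_mk (n : ℕ) (v : ZMod n → ℤ) (p : ZMod n × ZMod n) :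
    weightDiff n (QuotientAddGroup.mk v) p = v p.1 - v p.2 := rfl

theorem weightDiff_injective (n : ℕ) : Function.Injective (weightDiff n) := by
  rw [injective_iff_map_eq_zero]
  intro x
  induction x using QuotientAddGroup.induction_on with
  | H v =>
    intro h
    rw [QuotientAddGroup.eq_zero_iff]
    refine ⟨v 0, ?_⟩
    ext i
    have := congrFun h (i, 0)
    rw [weightDiff_mk] at this
    simp at this ⊢
    linarith

instance (n : ℕ) : UniqueSums (Weight n) :=
  UniqueSums.of_injective_addHom (weightDiff n).toAddHom (weightDiff_injective n) inferInstance

instance (n : ℕ) : IsDomain (RT n) := inferInstanceAs (IsDomain (AddMonoidAlgebra ℤ (Weight n)))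

/-- The element `e^μ` of `R(T)`. -/
def expW {n : ℕ} (μ : Weight n) : RT n :=
  (AddMonoidAlgebra.single μ 1 : AddMonoidAlgebra ℤ (Weight n))

/-- The fraction field of `R(T)`. It contains the localization of `R(T)` at the `1 - e^α`. -/
abbrev KT (n : ℕ) : Type := FractionRing (RT n)

/-- `e^μ` in the fraction field of `R(T)`. -/
def expK {n : ℕ} (μ : Weight n) : KT n := algebraMap (RT n) (KT n) (expW μ)

/-! ### Permutations of the equivariant parameters -/

/-- A permutation `s` acts on weights by `a_i ↦ a_{s(i)}`. -/
def permW {n : ℕ} (s : Equiv.Perm (ZMod n)) : Weight n ≃+ Weight n :=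
  QuotientAddGroup.congr _ _ (AddEquiv.arrowCongr s (AddEquiv.refl ℤ)) (by
    rw [AddMonoidHom.map_zmultiples]
    rfl)

/-- A permutation acts on `R(T)` by `e^{a_i} ↦ e^{a_{s(i)}}`. -/
def permR {n : ℕ} (s : Equiv.Perm (ZMod n)) : RT n ≃+* RT n :=
  (AddMonoidAlgebra.domCongr ℤ ℤ (permW s) :
    AddMonoidAlgebra ℤ (Weight n) ≃ₐ[ℤ] AddMonoidAlgebra ℤ (Weight n)).toRingEquiv

theorem permR_expW {n : ℕ} (s : Equiv.Perm (ZMod n)) (μ : Weight n) :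
    permR s (expW μ) = expW (permW s μ) :=
  AddMonoidAlgebra.domCongr_single (R := ℤ) (permW s) μ (1 : ℤ)

/-- The induced action of a permutation on the fraction field of `R(T)`. -/
def permK {n : ℕ} (s : Equiv.Perm (ZMod n)) : KT n ≃+* KT n :=
  IsFractionRing.ringEquivOfRingEquiv (permR s)

theorem permW_wt {n : ℕ} (s : Equiv.Perm (ZMod n)) (i : ZMod n) :
    permW s (wt n i) = wt n (s i) := by
  change QuotientAddGroup.mk _ = QuotientAddGroup.mk _
  congr 1
  ext j
  simp [AddEquiv.arrowCongr, Pi.single_apply, Equiv.symm_apply_eq]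

theorem permK_expK {n : ℕ} (s : Equiv.Perm (ZMod n)) (μ : Weight n) :
    permK s (expK μ) = expK (permW s μ) := by
  rw [permK, expK, IsFractionRing.ringEquivOfRingEquiv_algebraMap, permR_expW]
  rfl

theorem expW_add {n : ℕ} (μ ν : Weight n) : expW (μ + ν) = expW μ * expW ν := by
  have := AddMonoidAlgebra.single_mul_single (R := ℤ) μ ν 1 1
  rw [one_mul] at this
  exact this.symm

theorem expW_zero {n : ℕ} : expW (0 : Weight n) = 1 := rfl

theorem expK_add {n : ℕ} (μ ν : Weight n) : expK (μ + ν) = expK μ * expK ν := by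
  simp [expK, expW_add]

theorem expK_zero {n : ℕ} : expK (0 : Weight n) = 1 := by simp [expK, expW_zero]

theorem expK_injective {n : ℕ} : Function.Injective (expK : Weight n → KT n) := by
  intro μ ν h
  have := IsFractionRing.injective (RT n) (KT n) h
  exact AddMonoidAlgebra.single_left_injective one_ne_zero this

theorem expK_neg_wt_injective {n : ℕ} :
    Function.Injective (fun i : ZMod n => expK (-wt n i)) := by
  intro i j h
  by_contra hij
  have h1 : wt n i = wt n j := neg_injective (expK_injective h)
  have h2 := congrFun (congrArg (weightDiff n) h1) (i, j)
  simp only [wt, weightDiff_mk, Pi.single_eq_same, Pi.single_eq_of_ne hij,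
    Pi.single_eq_of_ne (Ne.symm hij)] at h2
  norm_num at h2

/-! ### Symmetric functions and Demazure operators -/

/-- Formal power series in `y_1, y_2, …` over the fraction field of `R(T)`.
The symmetric power series with coefficients in `R(T)` form a subring of this ring. -/
abbrev Lam (n : ℕ) : Type := MvPowerSeries ℕ (KT n)

/-- The action of a permutation on power series, through the coefficients. -/
def permL {n : ℕ} (s : Equiv.Perm (ZMod n)) : Lam n →+* Lam n :=
  MvPowerSeries.map (permK s : KT n →+* KT n)

/-- `f(y | b) ↦ f(y | ω^m b)`, where `ω` sends `b_i` to `b_{i+1}`. -/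
def shift {n : ℕ} (m : ℕ) : Lam n →+* Lam n :=
  permL (Equiv.addRight (m : ZMod n))

/-- `b_i = 1 - e^{-a_i}`. -/
def bK {n : ℕ} (i : ZMod n) : KT n := 1 - expK (-wt n i)

/-- `Ω(b_i | y) = ∏_j (1 - b_i y_j)⁻¹`. Expanding every factor as a geometric series,
the coefficient of a monomial of total degree `d` is `b_i ^ d`. -/
def Om {n : ℕ} (i : ZMod n) : Lam n := fun d => bK i ^ d.degree

/-- The action of the simple reflection `s_i`, `i ∈ ℤ/n`, of the affine Weyl group:
for `i ≠ 0` it exchanges `a_i` and `a_{i+1}`, and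
`s_0 f = Ω(b_1|y) Ω(b_n|y)⁻¹ s_θ(f)`, where `s_θ` exchanges `a_1` and `a_n = a_0`. -/
def sAct {n : ℕ} (i : ZMod n) (f : Lam n) : Lam n :=
  if i = 0 then Om 1 * (Om 0)⁻¹ * permL (Equiv.swap 0 1) f
  else permL (Equiv.swap i (i + 1)) f

/-- `T_i = (1 - e^{α_i})⁻¹ (s_i - 1)`, where `α_i = a_i - a_{i+1}`
(so that `α_0 = a_n - a_1 = -θ`). -/
def opT {n : ℕ} (i : ZMod n) (f : Lam n) : Lam n :=
  (1 - expK (wt n i - wt n (i + 1)))⁻¹ • (sAct i f - f)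

/-- `D_i = T_i + 1`. -/
def opD {n : ℕ} (i : ZMod n) (f : Lam n) : Lam n := opT i f + f

/-- The standard reduced word of the affine Grassmannian element `x_λ` attached to a
`k`-bounded partition `λ = (λ_1, λ_2, …)`, `k = n - 1`: the `n`-residues `column - row` of the
boxes of `λ`, the rows being read from bottom to top and every row from right to left. -/
def residueWord (n : ℕ) (l : List ℕ) : List (ZMod n) :=
  (l.zipIdx.flatMap fun p => (List.range p.1).map fun c => (c : ZMod n) - (p.2 : ZMod n)).reverse

/-- The `K`-theoretic double `k`-Schur function `g_λ^{(k)}(y|b) = T_{x_λ}(1)`. -/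
def gOpen (n : ℕ) (l : List ℕ) : Lam n := (residueWord n l).foldr opT 1

/-- The closed `K`-theoretic double `k`-Schur function `g̃_λ^{(k)}(y|b) = D_{x_λ}(1)`. -/
def gClosed (n : ℕ) (l : List ℕ) : Lam n := (residueWord n l).foldr opD 1

/-! ### Divided differences of `Ω`, used to show that the map `β` below is well defined -/

theorem permK_bK {n : ℕ} (s : Equiv.Perm (ZMod n)) (i : ZMod n) :
    permK s (bK i) = bK (s i) := by
  simp [bK, permK_expK, permW_wt]

theorem permL_smul {n : ℕ} (s : Equiv.Perm (ZMod n)) (c : KT n) (f : Lam n) :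
    permL s (c • f) = permK s c • permL s f := by
  ext d
  simp [permL]

theorem permL_Om {n : ℕ} (s : Equiv.Perm (ZMod n)) (i : ZMod n) :
    permL s (Om i) = Om (s i) := by
  ext d
  change permK s (bK i ^ d.degree) = bK (s i) ^ d.degree
  rw [map_pow, permK_bK]

theorem constantCoeff_Om {n : ℕ} (i : ZMod n) :
    MvPowerSeries.constantCoeff (Om i) = 1 := by
  change bK i ^ (0 : ℕ →₀ ℕ).degree = 1
  simp

theorem Om_mul_inv {n : ℕ} (i : ZMod n) : (Om i : Lam n) * (Om i)⁻¹ = 1 :=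
  MvPowerSeries.mul_inv_cancel _ (by rw [constantCoeff_Om]; exact one_ne_zero)

theorem permL_Om_inv {n : ℕ} (s : Equiv.Perm (ZMod n)) (i : ZMod n) :
    permL s (Om i)⁻¹ = (Om (s i))⁻¹ := by
  have h := congrArg (permL s) (Om_mul_inv i)
  rw [map_mul, map_one, permL_Om] at h
  calc permL s (Om i)⁻¹ = (Om (s i) * (Om (s i))⁻¹) * permL s (Om i)⁻¹ := by
        rw [Om_mul_inv, one_mul]
    _ = (Om (s i))⁻¹ * (Om (s i) * permL s (Om i)⁻¹) := by ring
    _ = _ := by rw [h, mul_one]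

theorem bK_injective {n : ℕ} : Function.Injective (bK : ZMod n → KT n) := by
  intro i j h
  exact expK_neg_wt_injective (by simpa [bK] using h)

/-- The divided difference of `b ↦ Ω(b | y)` at the points `b_k`, `k ∈ S`. -/
def divDiff {n : ℕ} (S : Finset (ZMod n)) : Lam n :=
  ∑ k ∈ S, (∏ m ∈ S.erase k, (bK k - bK m))⁻¹ • Om k

theorem permL_divDiff {n : ℕ} (s : Equiv.Perm (ZMod n)) (S : Finset (ZMod n)) :
    permL s (divDiff S) = divDiff (S.map s.toEmbedding) := by
  simp only [divDiff, map_sum, Finset.sum_map, permL_smul, permL_Om, map_inv₀, map_prod,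
    map_sub, permK_bK, Equiv.coe_toEmbedding]
  refine Finset.sum_congr rfl fun k _ => ?_
  congr 2
  have : (S.map s.toEmbedding).erase (s k) = (S.erase k).map s.toEmbedding := by
    rw [Finset.map_erase]; rfl
  rw [this, Finset.prod_map]
  rfl

theorem divDiff_sub {n : ℕ} (A : Finset (ZMod n)) {u v : ZMod n} (huv : u ≠ v)
    (hu : u ∉ A) (hv : v ∉ A) :
    divDiff (insert u A) - divDiff (insert v A) =
      (bK u - bK v) • divDiff (insert u (insert v A)) := by
  have hu' : u ∉ insert v A := by simp [huv, hu]
  have hne : bK u - bK v ≠ 0 := sub_ne_zero.2 fun h => huv (bK_injective h)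
  have hne' : bK v - bK u ≠ 0 := sub_ne_zero.2 fun h => huv (bK_injective h).symm
  have e1 : (insert u (insert v A)).erase u = insert v A := Finset.erase_insert hu'
  have e2 : (insert u (insert v A)).erase v = insert u A := by
    rw [Finset.insert_comm, Finset.erase_insert (by simp [huv.symm, hv])]
  simp only [divDiff]
  rw [Finset.sum_insert hu, Finset.sum_insert hv, Finset.sum_insert hu', Finset.sum_insert hv,
    e1, e2, Finset.erase_insert hu, Finset.erase_insert hv, Finset.prod_insert hv,
    Finset.prod_insert hu, smul_add, smul_add, smul_smul, smul_smul, Finset.smul_sum]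
  have h1 : (bK u - bK v) * ((bK u - bK v) * ∏ x ∈ A, (bK u - bK x))⁻¹
      = (∏ x ∈ A, (bK u - bK x))⁻¹ := by
    rw [mul_inv, ← mul_assoc, mul_inv_cancel₀ hne, one_mul]
  have h2 : (bK u - bK v) * ((bK v - bK u) * ∏ x ∈ A, (bK v - bK x))⁻¹
      = - (∏ x ∈ A, (bK v - bK x))⁻¹ := by
    rw [mul_inv, ← mul_assoc, ← neg_sub (bK v) (bK u), neg_mul, mul_inv_cancel₀ hne']
    ring
  rw [h1, h2, neg_smul]
  have h3 : ∑ x ∈ A, (∏ m ∈ (insert u A).erase x, (bK x - bK m))⁻¹ • Om x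
      - ∑ x ∈ A, (∏ m ∈ (insert v A).erase x, (bK x - bK m))⁻¹ • Om x
      = ∑ x ∈ A, (bK u - bK v) • ((∏ m ∈ (insert u (insert v A)).erase x, (bK x - bK m))⁻¹ •
          (Om x : Lam n)) := by
    rw [← Finset.sum_sub_distrib]
    refine Finset.sum_congr rfl fun k hk => ?_
    have hku : u ≠ k := fun h => hu (h ▸ hk)
    have hkv : v ≠ k := fun h => hv (h ▸ hk)
    have a1 : bK k - bK u ≠ 0 := sub_ne_zero.2 fun h => hku (bK_injective h).symm
    have a2 : bK k - bK v ≠ 0 := sub_ne_zero.2 fun h => hkv (bK_injective h).symm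
    have hue : u ∉ A.erase k := fun h => hu (Finset.mem_of_mem_erase h)
    have hve : v ∉ A.erase k := fun h => hv (Finset.mem_of_mem_erase h)
    rw [Finset.erase_insert_of_ne hku, Finset.erase_insert_of_ne hkv,
      Finset.erase_insert_of_ne hku, Finset.erase_insert_of_ne hkv,
      Finset.prod_insert hue, Finset.prod_insert hve,
      Finset.prod_insert (show u ∉ insert v (A.erase k) by
        rw [Finset.mem_insert]; exact fun h => h.elim huv hue),
      Finset.prod_insert hve, smul_smul, ← sub_smul]
    congr 1
    simp only [mul_inv]
    field_simp
    ring
  rw [← h3]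
  abel

/-- The points `i, i + 1, …, i + l` of `ℤ/n`. -/
def seg {n : ℕ} (i : ZMod n) (l : ℕ) : Finset (ZMod n) :=
  (Finset.range (l + 1)).image fun t : ℕ => i + (t : ZMod n)

theorem natCast_ne {n s t : ℕ} (h : s < t) (ht : t < n) : (s : ZMod n) ≠ t := by
  intro e
  rw [ZMod.natCast_eq_natCast_iff'] at e
  rw [Nat.mod_eq_of_lt (h.trans ht), Nat.mod_eq_of_lt ht] at e
  omega

theorem gOpen_succ (n l : ℕ) : gOpen n [l + 1] = opT (l : ZMod n) (gOpen n [l]) := by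
  simp [gOpen, residueWord, List.range_succ]

theorem gOpen_zero (n : ℕ) : gOpen n [0] = 1 := by
  simp [gOpen, residueWord]


theorem seg_succ {n : ℕ} (i : ZMod n) (l : ℕ) :
    seg i (l + 1) = insert (i + ((l + 1 : ℕ) : ZMod n)) (seg i l) := by
  rw [seg, Finset.range_add_one, Finset.image_insert, seg]

theorem seg_zero {n : ℕ} (i : ZMod n) : seg i 0 = insert i ∅ := by
  simp [seg]

theorem divDiff_singleton {n : ℕ} (i : ZMod n) : divDiff (insert i ∅) = Om i := by
  simp [divDiff]

theorem bK_succ_sub {n : ℕ} {i j : ZMod n} (h : i ≠ j) :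
    (1 - expK (wt n i - wt n j))⁻¹ * (bK j - bK i) = expK (-wt n i) := by
  have e : bK j - bK i = expK (-wt n i) * (1 - expK (wt n i - wt n j)) := by
    rw [mul_sub, mul_one, ← expK_add, bK, bK]
    have : -wt n i + (wt n i - wt n j) = -wt n j := by abel
    rw [this]; ring
  have hne : bK j - bK i ≠ 0 := sub_ne_zero.2 fun h' => h (bK_injective h').symm
  have hne' : (1 - expK (wt n i - wt n j)) ≠ 0 := by
    intro h'
    rw [h', mul_zero] at e
    exact hne e
  rw [e]
  field_simp

theorem gOpen_row (n l : ℕ) (hl : l < n) :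
    gOpen n [l] = expK (-∑ t ∈ Finset.range l, wt n (t : ZMod n)) •
      ((Om 0)⁻¹ * divDiff (seg 0 l)) := by
  induction l with
  | zero =>
    rw [gOpen_zero, seg_zero, divDiff_singleton, mul_comm, Om_mul_inv]
    simp [expK_zero]
  | succ l ih =>
    have hcast : ((l + 1 : ℕ) : ZMod n) = (l : ZMod n) + 1 := by push_cast; ring
    have hne : (l : ZMod n) ≠ (l : ZMod n) + 1 := by
      rw [← hcast]; exact natCast_ne (Nat.lt_succ_self l) hl
    rw [gOpen_succ, opT]
    have key : sAct (l : ZMod n) (gOpen n [l]) - gOpen n [l] =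
        expK (-∑ t ∈ Finset.range l, wt n (t : ZMod n)) • ((Om 0)⁻¹ *
          ((bK ((l : ZMod n) + 1) - bK (l : ZMod n)) • divDiff (seg 0 (l + 1)))) := by
      rcases Nat.eq_zero_or_pos l with rfl | hpos
      · rw [gOpen_zero, seg_succ, seg_zero, sAct, if_pos (by simp)]
        simp only [zero_add, Nat.cast_one, Nat.cast_zero, Finset.range_zero, Finset.sum_empty,
          neg_zero, expK_zero, one_smul, map_one, mul_one]
        have h01 : (1 : ZMod n) ≠ 0 := by
          have := natCast_ne (n := n) Nat.zero_lt_one hl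
          simpa using this.symm
        rw [← divDiff_sub ∅ h01 (by simp) (by simp), divDiff_singleton, divDiff_singleton,
          mul_sub, mul_comm (Om 0)⁻¹ (Om 0), Om_mul_inv, mul_comm]
      · obtain ⟨m, rfl⟩ : ∃ m, l = m + 1 := ⟨l - 1, by omega⟩
        have h0 : ((m + 1 : ℕ) : ZMod n) ≠ 0 := by
          have := natCast_ne (n := n) (Nat.succ_pos m) (by omega)
          simpa using this.symm
        have hfix : ∀ t : ℕ, t < m + 1 →
            Equiv.swap ((m + 1 : ℕ) : ZMod n) (((m + 1 : ℕ) : ZMod n) + 1) (t : ZMod n) = t := by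
          intro t ht
          refine Equiv.swap_apply_of_ne_of_ne (natCast_ne ht (by omega)) ?_
          rw [← hcast]
          exact natCast_ne (by omega) hl
        have hfix0 : Equiv.swap ((m + 1 : ℕ) : ZMod n) (((m + 1 : ℕ) : ZMod n) + 1) 0 = 0 := by
          simpa using hfix 0 (by omega)
        have hc : permK (Equiv.swap ((m + 1 : ℕ) : ZMod n) (((m + 1 : ℕ) : ZMod n) + 1))
            (expK (-∑ t ∈ Finset.range (m + 1), wt n (t : ZMod n))) =
            expK (-∑ t ∈ Finset.range (m + 1), wt n (t : ZMod n)) := by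
          rw [permK_expK, map_neg, map_sum]
          congr 2
          refine Finset.sum_congr rfl fun t ht => ?_
          rw [permW_wt, hfix t (Finset.mem_range.1 ht)]
        have hnot : ∀ t : ℕ, m < t → t < n → (t : ZMod n) ∉ seg (0 : ZMod n) m := by
          intro t ht htn hmem
          simp only [seg, Finset.mem_image, Finset.mem_range, zero_add] at hmem
          obtain ⟨r, hr, hrt⟩ := hmem
          exact natCast_ne (by omega) htn hrt
        have hseg : (seg (0 : ZMod n) m).map
            (Equiv.swap ((m + 1 : ℕ) : ZMod n) (((m + 1 : ℕ) : ZMod n) + 1)).toEmbedding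
            = seg 0 m := by
          ext x
          simp only [Finset.mem_map_equiv, Equiv.symm_swap]
          constructor
          · intro hx
            simp only [seg, Finset.mem_image, Finset.mem_range, zero_add] at hx ⊢
            obtain ⟨r, hr, hrt⟩ := hx
            refine ⟨r, hr, ?_⟩
            have := congrArg (Equiv.swap ((m + 1 : ℕ) : ZMod n) (((m + 1 : ℕ) : ZMod n) + 1)) hrt
            rwa [hfix r hr, Equiv.swap_apply_self] at this
          · intro hx
            simp only [seg, Finset.mem_image, Finset.mem_range, zero_add] at hx ⊢
            obtain ⟨r, hr, rfl⟩ := hx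
            exact ⟨r, hr, (hfix r hr).symm⟩
        rw [ih (by omega), sAct, if_neg h0, permL_smul, hc, map_mul, permL_Om_inv, hfix0,
          permL_divDiff, seg_succ 0 m, Finset.map_insert, hseg, seg_succ 0 (m + 1), seg_succ 0 m,
          ← smul_sub, ← mul_sub]
        simp only [zero_add, Equiv.coe_toEmbedding, Equiv.swap_apply_left]
        rw [hcast]
        have := divDiff_sub (seg (0 : ZMod n) m) hne.symm
          (by rw [← hcast]; exact hnot _ (by omega) hl) (hnot _ (by omega) (by omega))
        rw [this]
    rw [key, smul_comm, mul_smul_comm, smul_smul (1 - _)⁻¹, bK_succ_sub hne, smul_smul, ← expK_add,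
      Finset.sum_range_succ]
    congr 2
    abel

/-! ### The centralizer family -/

/-- The index `i + 1 ∈ ℤ/n` of the `i`-th row, rows being numbered from `0`. -/
def ix {n : ℕ} (i : Fin n) : ZMod n := ((i.val + 1 : ℕ) : ZMod n)

/-- The matrix `A`: diagonal `e^{-a_1}, …, e^{-a_n}`, superdiagonal `-1`. -/
def matA (n : ℕ) : Matrix (Fin n) (Fin n) (RT n) :=
  Matrix.of fun i j =>
    if i = j then expW (-wt n (ix i)) else if i.val + 1 = j.val then -1 else 0

/-- `e_k(e^{-a_1}, …, e^{-a_m})`. -/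
def elemSym (n m k : ℕ) : RT n :=
  ((Multiset.range m).map fun t => expW (-wt n ((t + 1 : ℕ) : ZMod n))).esymm k

/-- The lower unitriangular matrix `P`, with entries `e_{i-j}(e^{-a_1}, …, e^{-a_{i-1}})`,
`1 ≤ j ≤ i ≤ n`. -/
def matP (n : ℕ) : Matrix (Fin n) (Fin n) (RT n) :=
  Matrix.of fun i j => if j ≤ i then elemSym n i.val (i.val - j.val) else 0

/-- The `i`-th leading principal minor of an `n × n` matrix. -/
def leadingMinor {n : ℕ} {R : Type*} [CommRing R] (M : Matrix (Fin n) (Fin n) R) (i : ℕ) : R :=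
  (M.submatrix (Subtype.val : {r : Fin n // r.val < i} → Fin n) Subtype.val).det

/-- Polynomial ring in the entries `z_{ij}` (`Sum.inl (i, j)`) of an `n × n` matrix and in
additional variables `Sum.inr i`, which become the inverses of the `z_{ii}`. -/
abbrev PolyZ (n : ℕ) : Type := MvPolynomial (Fin n × Fin n ⊕ Fin n) (RT n)

/-- The generic matrix. -/
def genZ (n : ℕ) : Matrix (Fin n) (Fin n) (PolyZ n) :=
  Matrix.of fun i j => MvPolynomial.X (Sum.inl (i, j))

/-- The matrix `A` over the polynomial ring. -/
def polyA (n : ℕ) : Matrix (Fin n) (Fin n) (PolyZ n) :=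
  (matA n).map (algebraMap (RT n) (PolyZ n))

/-- The equations of the centralizer family: `Z` is upper triangular, `[A, Z] = 0`,
and the diagonal entries are invertible. -/
def relZ (n : ℕ) : Set (PolyZ n) :=
  {f | (∃ i j : Fin n, j < i ∧ f = genZ n i j) ∨
    (∃ i j : Fin n, f = (polyA n * genZ n - genZ n * polyA n) i j) ∨
    (∃ i : Fin n, f = genZ n i i * MvPolynomial.X (Sum.inr i) - 1)}

/-- The coordinate ring `𝒪(𝒵̃)` of the centralizer family. -/
def OZ (n : ℕ) : Type := PolyZ n ⧸ Ideal.span (relZ n)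

instance (n : ℕ) : CommRing (OZ n) :=
  inferInstanceAs (CommRing (PolyZ n ⧸ Ideal.span (relZ n)))

instance (n : ℕ) : Algebra (RT n) (OZ n) :=
  inferInstanceAs (Algebra (RT n) (PolyZ n ⧸ Ideal.span (relZ n)))

/-- The quotient map onto `𝒪(𝒵̃)`. -/
def mkZ (n : ℕ) : PolyZ n →ₐ[RT n] OZ n := Ideal.Quotient.mkₐ (RT n) (Ideal.span (relZ n))

/-- The matrix `Z = (z_{ij})` of coordinate functions. -/
def matZ (n : ℕ) : Matrix (Fin n) (Fin n) (OZ n) :=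
  (genZ n).map (mkZ n)

/-- `z_{ii}⁻¹`. -/
def zInv {n : ℕ} (i : Fin n) : OZ n := mkZ n (MvPolynomial.X (Sum.inr i))

/-- An algebra homomorphism out of `𝒪(𝒵̃)`, given by an upper triangular matrix with invertible
diagonal that commutes with `A`. -/
def liftOZ {n : ℕ} {S : Type*} [CommRing S] [Algebra (RT n) S]
    (M : Matrix (Fin n) (Fin n) S) (w : Fin n → S)
    (h1 : ∀ i j : Fin n, j < i → M i j = 0)
    (h2 : (matA n).map (algebraMap (RT n) S) * M = M * (matA n).map (algebraMap (RT n) S))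
    (h3 : ∀ i, M i i * w i = 1) : OZ n →ₐ[RT n] S :=
  Ideal.Quotient.liftₐ (Ideal.span (relZ n))
    (MvPolynomial.aeval (Sum.elim (fun p : Fin n × Fin n => M p.1 p.2) w)) (by
      intro f hf
      refine Submodule.span_induction (p := fun f _ => MvPolynomial.aeval
        (Sum.elim (fun p : Fin n × Fin n => M p.1 p.2) w) f = 0) ?_ (map_zero _)
        (fun x y _ _ hx hy => by rw [map_add, hx, hy, add_zero])
        (fun a x _ hx => by rw [smul_eq_mul, map_mul, hx, mul_zero]) hf
      rintro g (⟨i, j, hij, rfl⟩ | ⟨i, j, rfl⟩ | ⟨i, rfl⟩)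
      · simp [genZ, h1 i j hij]
      · have := congrFun (congrFun h2 i) j
        simp only [Matrix.mul_apply, Matrix.map_apply] at this
        rw [Matrix.sub_apply, map_sub, Matrix.mul_apply, Matrix.mul_apply, map_sum, map_sum]
        simp only [map_mul, polyA, genZ, Matrix.map_apply, Matrix.of_apply, AlgHom.commutes,
          MvPolynomial.aeval_X, Sum.elim_inl]
        rw [this, sub_self]
      · simp [genZ, h3 i])

theorem liftOZ_mkZ {n : ℕ} {S : Type*} [CommRing S] [Algebra (RT n) S]
    (M : Matrix (Fin n) (Fin n) S) (w : Fin n → S) (h1) (h2) (h3) (f : PolyZ n) :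
    liftOZ M w h1 h2 h3 (mkZ n f) =
      MvPolynomial.aeval (Sum.elim (fun p : Fin n × Fin n => M p.1 p.2) w) f := rfl

theorem liftOZ_matZ {n : ℕ} {S : Type*} [CommRing S] [Algebra (RT n) S]
    (M : Matrix (Fin n) (Fin n) S) (w : Fin n → S) (h1) (h2) (h3) :
    (matZ n).map (liftOZ M w h1 h2 h3) = M := by
  ext i j
  rw [Matrix.map_apply, matZ, Matrix.map_apply, liftOZ_mkZ]
  simp [genZ]

theorem mk_relZ {n : ℕ} {f : PolyZ n} (h : f ∈ relZ n) : mkZ n f = 0 :=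
  Ideal.Quotient.eq_zero_iff_mem.2 (Ideal.subset_span h)

theorem matZ_lower {n : ℕ} {i j : Fin n} (h : j < i) : matZ n i j = 0 :=
  mk_relZ (Or.inl ⟨i, j, h, rfl⟩)

theorem matZ_diag {n : ℕ} (i : Fin n) : matZ n i i * zInv i = 1 := by
  have := mk_relZ (n := n) (Or.inr (Or.inr ⟨i, rfl⟩))
  rw [map_sub, map_mul, map_one, sub_eq_zero] at this
  exact this

/-- The matrix `A` over `𝒪(𝒵̃)`. -/
def matAZ (n : ℕ) : Matrix (Fin n) (Fin n) (OZ n) := (matA n).map (algebraMap (RT n) (OZ n))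

/-- The matrix `P` over `𝒪(𝒵̃)`. -/
def matPZ (n : ℕ) : Matrix (Fin n) (Fin n) (OZ n) := (matP n).map (algebraMap (RT n) (OZ n))

theorem matZ_comm (n : ℕ) : matAZ n * matZ n = matZ n * matAZ n := by
  ext i j
  have := mk_relZ (n := n) (Or.inr (Or.inl ⟨i, j, rfl⟩))
  rw [Matrix.sub_apply, map_sub, sub_eq_zero, Matrix.mul_apply, Matrix.mul_apply, map_sum,
    map_sum] at this
  simp only [map_mul, polyA, Matrix.map_apply, AlgHom.commutes] at this
  rw [Matrix.mul_apply, Matrix.mul_apply]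
  exact this

/-- The function `τ_i = det (Z A P)^{[1,i]}_{[1,i]}`. -/
def tau (n i : ℕ) : OZ n := leadingMinor (matZ n * matAZ n * matPZ n) i

/-- The function `σ_i = det (Z P)^{[1,i]}_{[1,i]}`. -/
def sig (n i : ℕ) : OZ n := leadingMinor (matZ n * matPZ n) i

/-! ### The automorphism `σ` -/

theorem matA_upper (n : ℕ) : (matA n).BlockTriangular id := by
  intro i j h
  have h' : j.val < i.val := h
  have : i ≠ j := by rintro rfl; exact lt_irrefl _ h'
  simp only [matA, Matrix.of_apply, if_neg this]
  rw [if_neg (by omega)]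

theorem matAZ_upper (n : ℕ) : (matAZ n).BlockTriangular id := by
  intro i j h
  simp [matAZ, matA_upper n h]

theorem expW_mul_neg {n : ℕ} (μ : Weight n) : expW μ * expW (-μ) = 1 := by
  rw [← expW_add, add_neg_cancel, expW_zero]

theorem isUnit_det_matA (n : ℕ) : IsUnit (matA n).det := by
  rw [Matrix.det_of_isUpperTriangular (matA_upper n)]
  refine IsUnit.prod_univ_iff.2 fun i => ?_
  simp only [matA, Matrix.of_apply, if_true]
  exact IsUnit.of_mul_eq_one _ (by rw [mul_comm]; exact expW_mul_neg _)

theorem isUnit_det_matAZ (n : ℕ) : IsUnit (matAZ n).det := by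
  have := (isUnit_det_matA n).map (algebraMap (RT n) (OZ n))
  rwa [RingHom.map_det] at this

theorem matZA_upper (n : ℕ) : (matZ n * (matAZ n)⁻¹).BlockTriangular id := by
  have hZ : (matZ n).BlockTriangular id := fun i j h => matZ_lower h
  have := Matrix.invertibleOfIsUnitDet _ (isUnit_det_matAZ n)
  exact hZ.mul (Matrix.blockTriangular_inv_of_blockTriangular (matAZ_upper n))

/-- The `R(T)`-algebra endomorphism `σ` of `𝒪(𝒵̃)` given by `σ(Z) = Z A⁻¹`. -/
def sigmaHom (n : ℕ) : OZ n →ₐ[RT n] OZ n :=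
  liftOZ (matZ n * (matAZ n)⁻¹)
    (fun i => zInv i * algebraMap (RT n) (OZ n) (expW (-wt n (ix i))))
    (fun i j h => matZA_upper n h)
    (by
      change matAZ n * _ = _ * matAZ n
      rw [← Matrix.mul_assoc, matZ_comm, Matrix.mul_assoc, Matrix.mul_assoc,
        Matrix.mul_nonsing_inv _ (isUnit_det_matAZ n),
        Matrix.nonsing_inv_mul _ (isUnit_det_matAZ n)])
    (by
      intro i
      have h : (matZ n * (matAZ n)⁻¹ * matAZ n) i i = matZ n i i := by
        rw [Matrix.mul_assoc, Matrix.nonsing_inv_mul _ (isUnit_det_matAZ n), Matrix.mul_one]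
      rw [Matrix.mul_apply, Finset.sum_eq_single i] at h
      · have hA : matAZ n i i = algebraMap (RT n) (OZ n) (expW (-wt n (ix i))) := by
          simp [matAZ, matA]
        rw [hA] at h
        calc _ = ((matZ n * (matAZ n)⁻¹) i i * algebraMap (RT n) (OZ n) (expW (-wt n (ix i))))
              * zInv i := by ring
          _ = 1 := by rw [h, matZ_diag]
      · intro j _ hj
        rcases lt_or_gt_of_ne hj with hlt | hlt
        · rw [matZA_upper n hlt, zero_mul]
        · rw [matAZ_upper n hlt, mul_zero]
      · simp)

theorem sigmaHom_matZ (n : ℕ) : (matZ n).map (sigmaHom n) = matZ n * (matAZ n)⁻¹ :=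
  liftOZ_matZ _ _ _ _ _

/-! ### The map `β` to symmetric functions -/

/-- The image of `z_{ij}` (here `i`, `j` are numbered from `0`):
`e^{a_i + ⋯ + a_{j-1}} Ω(b_i|y) g_{ρ_{j-i}}(y | ω^i b)` for `i ≤ j`, where `ρ_l = s_{l-1} ⋯ s_1 s_0`
corresponds to the one-row partition `(l)`. -/
def betaZ (n : ℕ) : Matrix (Fin n) (Fin n) (Lam n) :=
  Matrix.of fun i j =>
    if i ≤ j then
      expK (∑ t ∈ Finset.Ico i.val j.val, wt n ((t + 1 : ℕ) : ZMod n)) •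
        (Om (ix i) * shift (i.val + 1) (gOpen n [j.val - i.val]))
    else 0

theorem permL_seg {n : ℕ} (m : ℕ) (l : ℕ) :
    (seg (0 : ZMod n) l).map (Equiv.addRight (m : ZMod n)).toEmbedding = seg (m : ZMod n) l := by
  rw [seg, seg, Finset.map_eq_image, Finset.image_image]
  refine Finset.image_congr fun t _ => ?_
  simp [add_comm]

theorem betaZ_eq {n : ℕ} {i j : Fin n} (h : i ≤ j) :
    betaZ n i j = divDiff (seg (ix i) (j.val - i.val)) := by
  have hval : i.val ≤ j.val := h
  rw [betaZ, Matrix.of_apply, if_pos h, gOpen_row _ _ (by omega), shift, permL_smul, map_mul,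
    permL_Om_inv, permL_divDiff, permL_seg, permK_expK, mul_smul_comm, smul_smul, ← expK_add]
  have h0 : (Equiv.addRight ((i.val + 1 : ℕ) : ZMod n)) 0 = ix i := by
    simp [ix]
  rw [h0, ← mul_assoc, Om_mul_inv, one_mul]
  have : ∑ t ∈ Finset.Ico i.val j.val, wt n ((t + 1 : ℕ) : ZMod n) +
      permW (Equiv.addRight ((i.val + 1 : ℕ) : ZMod n))
        (-∑ t ∈ Finset.range (j.val - i.val), wt n (t : ZMod n)) = 0 := by
    rw [map_neg, map_sum, Finset.sum_Ico_eq_sum_range, ← sub_eq_add_neg, sub_eq_zero]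
    refine Finset.sum_congr rfl fun t _ => ?_
    rw [permW_wt]
    congr 1
    simp only [Equiv.coe_addRight]
    push_cast
    ring
  rw [this, expK_zero, one_smul]
  rfl


/-- Interior points `i + 1, …, i + l` of the segment `i, …, i + l + 1`. -/
def segInt {n : ℕ} (i : ZMod n) (l : ℕ) : Finset (ZMod n) :=
  (Finset.Ico 1 (l + 1)).image fun t : ℕ => i + (t : ZMod n)

theorem seg_left {n : ℕ} (i : ZMod n) (l : ℕ) : seg i l = insert i (segInt i l) := by
  have : Finset.range (l + 1) = insert 0 (Finset.Ico 1 (l + 1)) := by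
    ext x; simp only [Finset.mem_range, Finset.mem_insert, Finset.mem_Ico]; omega
  rw [seg, this, Finset.image_insert, segInt]
  simp

theorem seg_right {n : ℕ} (i : ZMod n) (l : ℕ) :
    seg (i + 1) l = insert (i + ((l + 1 : ℕ) : ZMod n)) (segInt i l) := by
  have : insert (l + 1) (Finset.Ico 1 (l + 1)) = (Finset.range (l + 1)).image (· + 1) := by
    ext x
    simp only [Finset.mem_range, Finset.mem_insert, Finset.mem_Ico, Finset.mem_image]
    constructor
    · intro h
      exact ⟨x - 1, by omega, by omega⟩
    · rintro ⟨a, ha, rfl⟩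
      omega
  rw [segInt, ← Finset.image_insert (fun t : ℕ => i + (t : ZMod n)), this, Finset.image_image, seg]
  refine Finset.image_congr fun t _ => ?_
  simp only [Function.comp]
  push_cast
  ring

theorem betaZ_rel {n : ℕ} {i j : Fin n} (h : i < j) :
    (bK (ix i) - bK (ix j)) • betaZ n i j =
      betaZ n i ⟨j.val - 1, by omega⟩ - betaZ n ⟨i.val + 1, by omega⟩ j := by
  have hv : i.val < j.val := h
  obtain ⟨l, hl⟩ : ∃ l, j.val = i.val + l + 1 := ⟨j.val - i.val - 1, by omega⟩
  have hix : ix j = ix i + ((l + 1 : ℕ) : ZMod n) := by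
    rw [ix, ix, hl]; push_cast; ring
  have hix' : ix (⟨i.val + 1, by omega⟩ : Fin n) = ix i + 1 := by
    simp only [ix]; push_cast; ring
  have hne : ix i ≠ ix j := by
    rw [hix]
    intro e
    exact natCast_ne (n := n) (Nat.succ_pos l) (by omega) (by symm; simpa using e)
  rw [betaZ_eq h.le, betaZ_eq (show i ≤ (⟨j.val - 1, by omega⟩ : Fin n) from
      Fin.mk_le_mk.2 (by omega)), betaZ_eq (show (⟨i.val + 1, by omega⟩ : Fin n) ≤ j from
      Fin.mk_le_mk.2 (by omega)), hix']
  have e1 : j.val - i.val = l + 1 := by omega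
  have e2 : j.val - 1 - i.val = l := by omega
  have e3 : j.val - (i.val + 1) = l := by omega
  simp only [e1, e2, e3]
  rw [seg_succ, seg_left, seg_right, Finset.insert_comm, ← hix]
  refine (divDiff_sub (segInt (ix i) l) hne ?_ ?_).symm
  · intro hm
    simp only [segInt, Finset.mem_image, Finset.mem_Ico] at hm
    obtain ⟨t, ht, hte⟩ := hm
    exact natCast_ne (n := n) (show 0 < t by omega) (by omega) (by symm; simpa using hte)
  · intro hm
    rw [hix] at hm
    simp only [segInt, Finset.mem_image, Finset.mem_Ico] at hm
    obtain ⟨t, ht, hte⟩ := hm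
    exact natCast_ne (n := n) (show t < l + 1 by omega) (by omega) (add_left_cancel hte)

theorem sum_matA_left {n : ℕ} {S : Type*} [CommRing S] [Algebra (RT n) S] (f : Fin n → S)
    (i : Fin n) :
    ∑ k, algebraMap (RT n) S (matA n i k) * f k =
      algebraMap (RT n) S (expW (-wt n (ix i))) * f i -
        (if h : i.val + 1 < n then f ⟨i.val + 1, h⟩ else 0) := by
  have hs : ∀ k, algebraMap (RT n) S (matA n i k) * f k =
      (if k = i then algebraMap (RT n) S (expW (-wt n (ix i))) * f i else 0) -
        (if i.val + 1 = k.val then f k else 0) := by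
    intro k
    by_cases hk : k = i
    · subst hk
      simp [matA]
    · have hk' : i ≠ k := fun e => hk e.symm
      by_cases h : i.val + 1 = k.val <;> simp [matA, hk, hk', h]
  rw [Finset.sum_congr rfl fun k _ => hs k, Finset.sum_sub_distrib, Finset.sum_ite_eq' _ i]
  simp only [Finset.mem_univ, if_true]
  congr 1
  split_ifs with h
  · rw [Finset.sum_eq_single ⟨i.val + 1, h⟩]
    · simp
    · intro b _ hb
      rw [if_neg]
      intro e
      exact hb (Fin.ext e.symm)
    · simp
  · refine Finset.sum_eq_zero fun b _ => if_neg ?_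
    have := b.2
    omega

theorem sum_matA_right {n : ℕ} {S : Type*} [CommRing S] [Algebra (RT n) S] (f : Fin n → S)
    (j : Fin n) :
    ∑ k, f k * algebraMap (RT n) S (matA n k j) =
      f j * algebraMap (RT n) S (expW (-wt n (ix j))) -
        (if 0 < j.val then f ⟨j.val - 1, by omega⟩ else 0) := by
  have hs : ∀ k, f k * algebraMap (RT n) S (matA n k j) =
      (if k = j then f j * algebraMap (RT n) S (expW (-wt n (ix j))) else 0) -
        (if k.val + 1 = j.val then f k else 0) := by
    intro k
    by_cases hk : k = j
    · subst hk
      simp [matA]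
    · by_cases h : k.val + 1 = j.val <;> simp [matA, hk, h]
  rw [Finset.sum_congr rfl fun k _ => hs k, Finset.sum_sub_distrib, Finset.sum_ite_eq' _ j]
  simp only [Finset.mem_univ, if_true]
  congr 1
  split_ifs with h
  · rw [Finset.sum_eq_single ⟨j.val - 1, by omega⟩]
    · rw [if_pos]
      simp only
      omega
    · intro b _ hb
      rw [if_neg]
      intro e
      exact hb (Fin.ext (by simp only; omega))
    · simp
  · exact Finset.sum_eq_zero fun b _ => if_neg (by omega)

theorem betaZ_lower {n : ℕ} {i j : Fin n} (h : j < i) : betaZ n i j = 0 := by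
  rw [betaZ, Matrix.of_apply, if_neg (not_le.2 h)]

theorem algebraMap_Lam {n : ℕ} (c : RT n) (f : Lam n) :
    algebraMap (RT n) (Lam n) c * f = algebraMap (RT n) (KT n) c • f := by
  rw [← Algebra.smul_def, algebraMap_smul]

theorem betaZ_comm (n : ℕ) :
    (matA n).map (algebraMap (RT n) (Lam n)) * betaZ n =
      betaZ n * (matA n).map (algebraMap (RT n) (Lam n)) := by
  ext1 i j
  simp only [Matrix.mul_apply, Matrix.map_apply]
  rw [sum_matA_left (fun k => betaZ n k j), sum_matA_right (fun k => betaZ n i k)]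
  rcases lt_trichotomy i j with h | h | h
  · have hv : i.val < j.val := h
    have hr := betaZ_rel h
    rw [dif_pos (by omega), if_pos (by omega), mul_comm (betaZ n i j), algebraMap_Lam,
      algebraMap_Lam]
    have hb : bK (ix i) - bK (ix j) = expK (-wt n (ix j)) - expK (-wt n (ix i)) := by
      simp [bK]
    rw [hb, sub_smul] at hr
    change expK (-wt n (ix i)) • betaZ n i j - _ = expK (-wt n (ix j)) • betaZ n i j - _
    linear_combination -hr
  · subst h
    have e1 : (if h : i.val + 1 < n then betaZ n ⟨i.val + 1, h⟩ i else 0) = 0 := by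
      split_ifs with h
      · exact betaZ_lower (Fin.mk_lt_mk.2 (Nat.lt_succ_self _))
      · rfl
    have e2 : (if 0 < i.val then betaZ n i ⟨i.val - 1, by omega⟩ else 0) = 0 := by
      split_ifs with h
      · exact betaZ_lower (Fin.mk_lt_mk.2 (by omega))
      · rfl
    rw [e1, e2, mul_comm]
  · have hv : j.val < i.val := h
    have e1 : (if h : i.val + 1 < n then betaZ n ⟨i.val + 1, h⟩ j else 0) = 0 := by
      split_ifs with h
      · exact betaZ_lower (Fin.mk_lt_mk.2 (by omega))
      · rfl
    have e2 : (if 0 < j.val then betaZ n i ⟨j.val - 1, by omega⟩ else 0) = 0 := by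
      split_ifs with h
      · exact betaZ_lower (Fin.mk_lt_mk.2 (by omega))
      · rfl
    rw [e1, e2, betaZ_lower h]
    simp

theorem betaZ_diag {n : ℕ} (i : Fin n) : betaZ n i i = Om (ix i) := by
  rw [betaZ_eq le_rfl, Nat.sub_self, seg_zero, divDiff_singleton]

/-- The `R(T)`-algebra homomorphism `β` from `𝒪(𝒵̃)` to symmetric functions. -/
def beta (n : ℕ) : OZ n →ₐ[RT n] Lam n :=
  liftOZ (betaZ n) (fun i => (Om (ix i))⁻¹)
    (fun i j h => by rw [betaZ, Matrix.of_apply, if_neg (not_le.2 h)])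
    (betaZ_comm n)
    (fun i => by rw [betaZ_diag, Om_mul_inv])

theorem beta_matZ (n : ℕ) : (matZ n).map (beta n) = betaZ n := liftOZ_matZ _ _ _ _ _

/-! ### The `τ`-functions are invertible after applying `β ∘ σ` -/

theorem map_leadingMinor {n : ℕ} {R S : Type*} [CommRing R] [CommRing S] (f : R →+* S)
    (M : Matrix (Fin n) (Fin n) R) (i : ℕ) :
    f (leadingMinor M i) = leadingMinor (M.map f) i := by
  rw [leadingMinor, RingHom.map_det]
  rfl


theorem map_matAZ {n : ℕ} {S : Type*} [CommRing S] [Algebra (RT n) S] (f : OZ n →ₐ[RT n] S) :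
    (matAZ n).map f = (matA n).map (algebraMap (RT n) S) := by
  ext i j
  simp [matAZ]

theorem map_matPZ {n : ℕ} {S : Type*} [CommRing S] [Algebra (RT n) S] (f : OZ n →ₐ[RT n] S) :
    (matPZ n).map f = (matP n).map (algebraMap (RT n) S) := by
  ext i j
  simp [matPZ]

theorem sigmaHom_tau (n i : ℕ) : sigmaHom n (tau n i) = sig n i := by
  have h := map_leadingMinor (sigmaHom n : OZ n →+* OZ n) (matZ n * matAZ n * matPZ n) i
  rw [Matrix.map_mul, Matrix.map_mul] at h
  change sigmaHom n (tau n i) = leadingMinor ((matZ n).map (sigmaHom n) *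
    (matAZ n).map (sigmaHom n) * (matPZ n).map (sigmaHom n)) i at h
  rw [sigmaHom_matZ, map_matAZ, map_matPZ] at h
  change sigmaHom n (tau n i) = leadingMinor (matZ n * (matAZ n)⁻¹ * matAZ n * matPZ n) i at h
  rwa [Matrix.mul_assoc (matZ n), Matrix.nonsing_inv_mul _ (isUnit_det_matAZ n),
    Matrix.mul_one] at h

/-- The value at `y = 0`. -/
def evalZero (n : ℕ) : OZ n →ₐ[RT n] KT n :=
  { (MvPowerSeries.constantCoeff (R := KT n) (σ := ℕ)).comp (beta n : OZ n →+* Lam n) with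
    commutes' := by
      intro c
      change MvPowerSeries.constantCoeff (beta n (algebraMap (RT n) (OZ n) c)) = _
      rw [AlgHom.commutes]
      rfl }

theorem isUnit_beta_iff {n : ℕ} (x : OZ n) : IsUnit (beta n x) ↔ evalZero n x ≠ 0 := by
  rw [MvPowerSeries.isUnit_iff_constantCoeff, isUnit_iff_ne_zero]
  rfl

theorem constantCoeff_permL {n : ℕ} (s : Equiv.Perm (ZMod n)) (f : Lam n) :
    MvPowerSeries.constantCoeff (permL s f) = permK s (MvPowerSeries.constantCoeff f) := by
  simp [permL]

theorem constantCoeff_opT {n : ℕ} (i : ZMod n) (f : Lam n) (c : ℤ)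
    (h : MvPowerSeries.constantCoeff f = c) : MvPowerSeries.constantCoeff (opT i f) = 0 := by
  have hs : MvPowerSeries.constantCoeff (sAct i f) = c := by
    rw [sAct]
    split_ifs
    · rw [map_mul, map_mul, constantCoeff_permL, h, constantCoeff_Om,
        MvPowerSeries.constantCoeff_inv, constantCoeff_Om]
      simp
    · rw [constantCoeff_permL, h]
      simp
  rw [opT, MvPowerSeries.constantCoeff_smul, map_sub, hs, h]
  simp

theorem constantCoeff_gOpen (n l : ℕ) :
    MvPowerSeries.constantCoeff (gOpen n [l]) = if l = 0 then 1 else 0 := by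
  induction l with
  | zero => simp [gOpen_zero]
  | succ l ih =>
    rw [gOpen_succ, constantCoeff_opT _ _ (if l = 0 then 1 else 0)]
    · simp
    · rw [ih]; split_ifs <;> simp

theorem evalZero_matZ (n : ℕ) : (matZ n).map (evalZero n) = 1 := by
  ext i j
  change MvPowerSeries.constantCoeff ((matZ n).map (beta n) i j) = _
  rw [beta_matZ]
  rcases lt_trichotomy i j with h | h | h
  · have hv : i.val < j.val := h
    rw [betaZ, Matrix.of_apply, if_pos h.le, MvPowerSeries.constantCoeff_smul, map_mul, shift,
      constantCoeff_permL, constantCoeff_gOpen, if_neg (by omega), Matrix.one_apply_ne h.ne]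
    simp
  · subst h
    rw [betaZ_diag, constantCoeff_Om, Matrix.one_apply_eq]
  · rw [betaZ_lower h, map_zero, Matrix.one_apply_ne h.ne']

/-- The matrix `A` over the fraction field. -/
def matAK (n : ℕ) : Matrix (Fin n) (Fin n) (KT n) := (matA n).map (algebraMap (RT n) (KT n))

/-- The matrix `P` over the fraction field. -/
def matPK (n : ℕ) : Matrix (Fin n) (Fin n) (KT n) := (matP n).map (algebraMap (RT n) (KT n))

theorem elemSym_zero (n m : ℕ) : elemSym n m 0 = 1 := by
  simp [elemSym, Multiset.esymm]

theorem elemSym_succ (n m k : ℕ) : elemSym n (m + 1) (k + 1) =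
    elemSym n m (k + 1) + expW (-wt n ((m + 1 : ℕ) : ZMod n)) * elemSym n m k := by
  simp only [elemSym, Multiset.esymm, Multiset.range_succ, Multiset.map_cons,
    Multiset.powersetCard_cons, Multiset.map_add, Multiset.sum_add, Multiset.map_map,
    Function.comp_def, Multiset.prod_cons, Multiset.sum_map_mul_left]

/-- The augmentation `e^μ ↦ 1`. -/
def augm (n : ℕ) : RT n →+* ℤ :=
  ((AddMonoidAlgebra.lift ℤ ℤ (Weight n) 1 : AddMonoidAlgebra ℤ (Weight n) →ₐ[ℤ] ℤ) :
    AddMonoidAlgebra ℤ (Weight n) →+* ℤ)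

theorem augm_expW {n : ℕ} (μ : Weight n) : augm n (expW μ) = 1 := by
  change AddMonoidAlgebra.lift ℤ ℤ (Weight n) 1 (AddMonoidAlgebra.single μ 1) = 1
  rw [AddMonoidAlgebra.lift_single]
  simp

theorem augm_elemSym (n m k : ℕ) : augm n (elemSym n m k) = m.choose k := by
  induction m generalizing k with
  | zero =>
    cases k with
    | zero => simp [elemSym_zero]
    | succ k => simp [elemSym, Multiset.esymm, Multiset.powersetCard_zero_right]
  | succ m ih =>
    cases k with
    | zero => simp [elemSym_zero]
    | succ k =>
      rw [elemSym_succ, map_add, map_mul, augm_expW, ih, ih, Nat.choose_succ_succ]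
      push_cast
      ring

theorem elemSym_ne_zero {n m k : ℕ} (h : k ≤ m) : elemSym n m k ≠ 0 := by
  intro e
  have := augm_elemSym n m k
  rw [e, map_zero] at this
  have hp := Nat.choose_pos h
  omega

theorem matP_lower {n : ℕ} {i j : Fin n} (h : i < j) : matPK n i j = 0 := by
  simp [matPK, matP, not_le.2 h]

theorem matP_diag {n : ℕ} (i : Fin n) : matPK n i i = 1 := by
  simp [matPK, matP, elemSym_zero]

theorem leadingMinor_matPK (n i : ℕ) : leadingMinor (matPK n) i = 1 := by
  rw [leadingMinor, Matrix.det_of_isLowerTriangular]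
  · simp [matP_diag]
  · intro a b h
    exact matP_lower h

theorem isUnit_beta_sig (n i : ℕ) : IsUnit (beta n (sig n i)) := by
  rw [isUnit_beta_iff]
  have h := map_leadingMinor (evalZero n : OZ n →+* KT n) (matZ n * matPZ n) i
  rw [Matrix.map_mul] at h
  change evalZero n (sig n i) = leadingMinor ((matZ n).map (evalZero n) *
    (matPZ n).map (evalZero n)) i at h
  rw [evalZero_matZ, map_matPZ, Matrix.one_mul] at h
  rw [h]
  change leadingMinor (matPK n) i ≠ 0
  rw [leadingMinor_matPK]
  exact one_ne_zero

theorem leadingMinor_invA_P (n i : ℕ) : leadingMinor ((matAK n)⁻¹ * matPK n) i ≠ 0 := by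
  intro hdet
  obtain ⟨v, hv, hv0⟩ := Matrix.exists_mulVec_eq_zero_iff.2 hdet
  apply hv
  let V : Fin n → KT n := fun r => if h : r.val < i then v ⟨r, h⟩ else 0
  have hVv : ∀ r : {r : Fin n // r.val < i}, V r.1 = v r := fun r => dif_pos r.2
  have hVout : ∀ r : Fin n, ¬ r.val < i → V r = 0 := fun r h => dif_neg h
  suffices hV : ∀ r, V r = 0 by
    funext r
    rw [← hVv r, hV]
    rfl
  let W : Fin n → KT n := ((matAK n)⁻¹ * matPK n).mulVec V
  have hW : ∀ r : Fin n, r.val < i → W r = 0 := by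
    intro r hr
    have h := congrFun hv0 ⟨r, hr⟩
    simp only [Matrix.mulVec, dotProduct, Matrix.submatrix_apply, Pi.zero_apply] at h
    change ∑ c, ((matAK n)⁻¹ * matPK n) r c * V c = 0
    rw [← h, ← Finset.sum_subset (Finset.subset_univ
      (Finset.univ.filter fun c : Fin n => c.val < i))]
    · rw [← Finset.sum_subtype_eq_sum_filter]
      refine Finset.sum_congr (by ext; simp) fun c _ => ?_
      rw [hVv]
    · intro c _ hc
      rw [hVout c (by simpa using hc), mul_zero]
  have hAW : (matAK n).mulVec W = (matPK n).mulVec V := by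
    have hA : IsUnit (matAK n).det := by
      have := (isUnit_det_matA n).map (algebraMap (RT n) (KT n))
      rwa [RingHom.map_det] at this
    change (matAK n).mulVec (((matAK n)⁻¹ * matPK n).mulVec V) = _
    rw [Matrix.mulVec_mulVec, ← Matrix.mul_assoc, Matrix.mul_nonsing_inv _ hA, Matrix.one_mul]
  let We : ℕ → KT n := fun r => if h : r < n then W ⟨r, h⟩ else 0
  have hrow : ∀ r : Fin n, expK (-wt n (ix r)) * W r - We (r.val + 1) =
      ∑ c, matPK n r c * V c := by
    intro r
    have h := congrFun hAW r
    have h' := sum_matA_left W r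
    rw [← expK] at h'
    exact h'.symm.trans h
  have hV1 : ∀ r : ℕ, ∀ h : r < n, r + 1 < i → V ⟨r, h⟩ = 0 := by
    intro r
    induction r using Nat.strong_induction_on with
    | _ r ih =>
      intro h hr
      have hrow' := hrow ⟨r, h⟩
      have hWe : We (r + 1) = 0 := by
        simp only [We]
        split_ifs with h1
        · exact hW _ hr
        · rfl
      rw [hW ⟨r, h⟩ (by simp only; omega), hWe, Finset.sum_eq_single ⟨r, h⟩, matP_diag] at hrow'
      · simpa using hrow'.symm
      · intro c _ hc
        rcases lt_or_gt_of_ne hc with hlt | hlt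
        · have hlt' : c.val < r := hlt
          rw [ih c.val hlt' c.2 (by omega), mul_zero]
        · rw [matP_lower hlt, zero_mul]
      · simp
  rcases Nat.eq_zero_or_pos i with rfl | hi
  · exact fun r => hVout r (by omega)
  obtain ⟨p, rfl⟩ : ∃ p, i = p + 1 := ⟨i - 1, by omega⟩
  by_cases hp : p < n
  · have hVne : ∀ r : Fin n, r ≠ ⟨p, hp⟩ → V r = 0 := by
      intro r hr
      have hne : r.val ≠ p := fun e => hr (Fin.ext e)
      by_cases h : r.val < p
      · exact hV1 r.val r.2 (by omega)
      · exact hVout r (by omega)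
    have hrow2 : ∀ r : Fin n, expK (-wt n (ix r)) * W r - We (r.val + 1) =
        matPK n r ⟨p, hp⟩ * V ⟨p, hp⟩ := by
      intro r
      rw [hrow, Finset.sum_eq_single ⟨p, hp⟩]
      · intro c _ hc
        rw [hVne c hc, mul_zero]
      · simp
    have hrec : ∀ t : ℕ, p + 1 + t ≤ n → We (p + 1 + t) =
        -(algebraMap (RT n) (KT n) (elemSym n (p + 1 + t) t) * V ⟨p, hp⟩) := by
      intro t
      induction t with
      | zero =>
        intro _
        have h := hrow2 ⟨p, hp⟩
        rw [hW ⟨p, hp⟩ (Nat.lt_succ_self p), matP_diag] at h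
        rw [elemSym_zero, map_one]
        linear_combination -h
      | succ t ih =>
        intro ht
        have hlt : p + 1 + t < n := by omega
        have h := hrow2 ⟨p + 1 + t, hlt⟩
        have hWr : W ⟨p + 1 + t, hlt⟩ = We (p + 1 + t) := by
          simp only [We]; rw [dif_pos hlt]
        have hP : matPK n ⟨p + 1 + t, hlt⟩ ⟨p, hp⟩ =
            algebraMap (RT n) (KT n) (elemSym n (p + 1 + t) (t + 1)) := by
          simp only [matPK, matP, Matrix.map_apply, Matrix.of_apply]
          rw [if_pos (Fin.mk_le_mk.2 (by omega)), show p + 1 + t - p = t + 1 by omega]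
        rw [hWr, ih (by omega), hP] at h
        change We (p + 1 + t + 1) = -(algebraMap (RT n) (KT n)
          (elemSym n (p + 1 + t + 1) (t + 1)) * _)
        rw [elemSym_succ, map_add, map_mul]
        change expK (-wt n ((p + 1 + t + 1 : ℕ) : ZMod n)) * _ - We (p + 1 + t + 1) = _ at h
        rw [expK] at h
        linear_combination -h
    have hfin := hrec (n - (p + 1)) (by omega)
    have hz : We (p + 1 + (n - (p + 1))) = 0 := dif_neg (by omega)
    rw [hz] at hfin
    have hne : algebraMap (RT n) (KT n) (elemSym n (p + 1 + (n - (p + 1))) (n - (p + 1))) ≠ 0 := by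
      rw [Ne, FaithfulSMul.algebraMap_eq_zero_iff]
      exact elemSym_ne_zero (by omega)
    have hVp : V ⟨p, hp⟩ = 0 := by
      rcases mul_eq_zero.1 (neg_eq_zero.1 hfin.symm) with h | h
      · exact absurd h hne
      · exact h
    intro r
    by_cases h : r = ⟨p, hp⟩
    · rw [h, hVp]
    · exact hVne r h
  · intro r
    have := r.2
    exact hV1 r.val r.2 (by omega)

theorem isUnit_beta_sigma_sig (n i : ℕ) : IsUnit (beta n (sigmaHom n (sig n i))) := by
  rw [isUnit_beta_iff]
  have h := map_leadingMinor ((evalZero n).comp (sigmaHom n) : OZ n →+* KT n)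
    (matZ n * matPZ n) i
  rw [Matrix.map_mul] at h
  change evalZero n (sigmaHom n (sig n i)) =
    leadingMinor (((matZ n).map (sigmaHom n)).map (evalZero n) *
    (matPZ n).map ((evalZero n).comp (sigmaHom n))) i at h
  rw [map_matPZ, sigmaHom_matZ] at h
  have hinv : (matZ n * (matAZ n)⁻¹).map (evalZero n) = (matAK n)⁻¹ := by
    have e : (matZ n * (matAZ n)⁻¹ * matAZ n).map (evalZero n) = 1 := by
      rw [Matrix.mul_assoc, Matrix.nonsing_inv_mul _ (isUnit_det_matAZ n), Matrix.mul_one,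
        evalZero_matZ]
    have e' : (matZ n * (matAZ n)⁻¹).map (evalZero n) * matAK n = 1 := by
      rw [← e, matAK, ← map_matAZ (evalZero n)]
      exact (Matrix.map_mul (f := (evalZero n : OZ n →+* KT n))).symm
    exact (Matrix.inv_eq_left_inv e').symm
  rw [h, hinv]
  exact leadingMinor_invA_P n i

/-! ### The `K`-Peterson maps: target -/

/-- The multiplicative set generated by the `τ_i` and `σ_i`. Here `τ_0 = σ_0 = 1`, and for `i > n`
the elements `tau n i`, `sig n i` coincide with `τ_n`, `σ_n`. -/
def tauSet (n : ℕ) : Submonoid (OZ n) :=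
  Submonoid.closure (Set.range (tau n) ∪ Set.range (sig n))

theorem tau_mem (n i : ℕ) : tau n i ∈ tauSet n :=
  Submonoid.subset_closure (Or.inl ⟨i, rfl⟩)

theorem sig_mem (n i : ℕ) : sig n i ∈ tauSet n :=
  Submonoid.subset_closure (Or.inr ⟨i, rfl⟩)

/-- `𝒪(𝒵̃°) = 𝒪(𝒵̃)[τ_i⁻¹, σ_i⁻¹]`. -/
abbrev OZo (n : ℕ) : Type := Localization (tauSet n)

/-- The automorphism `σ`, followed by the identification `β` with symmetric functions. -/
def betaSigma (n : ℕ) : OZ n →ₐ[RT n] Lam n := (beta n).comp (sigmaHom n)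

theorem isUnit_betaSigma (n : ℕ) (x : tauSet n) : IsUnit (betaSigma n x) := by
  have hle : tauSet n ≤ (IsUnit.submonoid (Lam n)).comap (betaSigma n : OZ n →* Lam n) := by
    rw [tauSet, Submonoid.closure_le]
    rintro _ (⟨i, rfl⟩ | ⟨i, rfl⟩)
    · change IsUnit (beta n (sigmaHom n (tau n i)))
      rw [sigmaHom_tau]
      exact isUnit_beta_sig n i
    · exact isUnit_beta_sigma_sig n i
  exact hle x.2

/-- `σ` on `𝒪(𝒵̃)[τ_i⁻¹, σ_i⁻¹]`, with values in symmetric functions (through `β`). -/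
def betaSigmaLoc (n : ℕ) : OZo n →+* Lam n :=
  IsLocalization.lift (M := tauSet n) (g := (betaSigma n : OZ n →+* Lam n))
    (fun y => isUnit_betaSigma n y)

/-! ### The relativistic Toda side -/

/-- The polynomial ring `R(T)[z_1, …, z_n, Q_1, …, Q_{n-1}]`. -/
abbrev PolyY (n : ℕ) : Type := MvPolynomial (Fin n ⊕ Fin (n - 1)) (RT n)

/-- The variable `z_j`, `1 ≤ j ≤ n`. -/
def polyz (n j : ℕ) : PolyY n :=
  if h : 1 ≤ j ∧ j ≤ n then MvPolynomial.X (Sum.inl ⟨j - 1, by omega⟩) else 0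

/-- The variable `Q_j`, `1 ≤ j ≤ n - 1`; by convention `Q_n = 0`. -/
def polyQ (n j : ℕ) : PolyY n :=
  if h : 1 ≤ j ∧ j ≤ n - 1 then MvPolynomial.X (Sum.inr ⟨j - 1, by omega⟩) else 0

/-- `F_m^{(i)} = ∑_{J ⊆ [i], |J| = m} ∏_{j ∈ J, j + 1 ∉ J} (1 - Q_j) ∏_{j ∈ J} z_j`. -/
def polyF (n i m : ℕ) : PolyY n :=
  ∑ J ∈ (Finset.Icc 1 i).powersetCard m,
    (∏ j ∈ J.filter (fun j => j + 1 ∉ J), (1 - polyQ n j)) * ∏ j ∈ J, polyz n j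

/-- The ideal generated by `F_i(z, Q) - e_i(e^{-a_1}, …, e^{-a_n})`, `1 ≤ i ≤ n`. -/
def idealY (n : ℕ) : Ideal (PolyY n) :=
  Ideal.span {f | ∃ i, 1 ≤ i ∧ i ≤ n ∧ f = polyF n n i - MvPolynomial.C (elemSym n n i)}

/-- `𝒪(𝒴) = QK_T^{pol}(SL_n/B)`. -/
def OY (n : ℕ) : Type := PolyY n ⧸ idealY n

instance (n : ℕ) : CommRing (OY n) := inferInstanceAs (CommRing (PolyY n ⧸ idealY n))

instance (n : ℕ) : Algebra (RT n) (OY n) :=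
  inferInstanceAs (Algebra (RT n) (PolyY n ⧸ idealY n))

/-- The quotient map onto `𝒪(𝒴)`. -/
def mkY (n : ℕ) : PolyY n →ₐ[RT n] OY n := Ideal.Quotient.mkₐ (RT n) (idealY n)

/-- `𝒪(𝒴°) = 𝒪(𝒴)[Q_1⁻¹, …, Q_{n-1}⁻¹]`. -/
abbrev OYo (n : ℕ) : Type :=
  Localization (Submonoid.closure {q : OY n | ∃ j, 1 ≤ j ∧ j ≤ n - 1 ∧ q = mkY n (polyQ n j)})

/-- The class in `𝒪(𝒴°)` of a polynomial in `R(T)[z, Q]`. -/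
def clsY {n : ℕ} (f : PolyY n) : OYo n := algebraMap (OY n) (OYo n) (mkY n f)

/-- `η_i = 1 - e^{a_{n-i+1}}`, `1 ≤ i ≤ n`. -/
def eta (n i : ℕ) : RT n := 1 - expW (wt n ((n - i + 1 : ℕ) : ZMod n))

/-- `ψ_i = ∑_{j=0}^{i} (-1)^j (1 - η_{n-i})^j F_j^{(i)}(z, Q)`. -/
def psi (n i : ℕ) : PolyY n :=
  ∑ j ∈ Finset.range (i + 1),
    (-1) ^ j * MvPolynomial.C ((1 - eta n (n - i)) ^ j) * polyF n i j

/-- The quantum double Grothendieck polynomial of the longest element,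
`𝔊^Q_{w_∘} = ψ_1 ψ_2 ⋯ ψ_{n-1}`. -/
def grothLongest (n : ℕ) : PolyY n := ∏ i ∈ Finset.Icc 1 (n - 1), psi n i

/-! ### The `K`-Peterson maps -/

/-- The element `x / y` of `𝒪(𝒵̃°)`, for `y` in the multiplicative set generated by the
`τ_i` and `σ_i`. -/
def fracZ {n : ℕ} (x y : OZ n) (hy : y ∈ tauSet n) : OZo n := Localization.mk x ⟨y, hy⟩

/-- `Φ` is the `R(T)`-algebra homomorphism `Φ_n`: it sends
`z_i` to `τ_i σ_{i-1} / (σ_i τ_{i-1})` for `1 ≤ i ≤ n` and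
`Q_i` to `τ_{i-1} τ_{i+1} / τ_i²` for `1 ≤ i ≤ n - 1`. -/
def IsPhi {n : ℕ} (Φ : OYo n →ₐ[RT n] OZo n) : Prop :=
  (∀ i, 1 ≤ i → i ≤ n → Φ (clsY (polyz n i)) =
    fracZ (tau n i * sig n (i - 1)) (sig n i * tau n (i - 1))
      (mul_mem (sig_mem n i) (tau_mem n (i - 1)))) ∧
  (∀ i, 1 ≤ i → i ≤ n - 1 → Φ (clsY (polyQ n i)) =
    fracZ (tau n (i - 1) * tau n (i + 1)) (tau n i ^ 2) (pow_mem (tau_mem n i) 2))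

/-- `Φ̃ = σ ∘ Φ`, with values in symmetric functions. -/
def PhiTilde {n : ℕ} (Φ : OYo n →ₐ[RT n] OZo n) (f : OYo n) : Lam n := betaSigmaLoc n (Φ f)

end KPeterson

end

open KPeterson

noncomputable section

namespace KPeterson

/-! ### The Desnanot–Jacobi identity -/

section DesnanotJacobi

open Matrix

variable {R : Type*} [CommRing R] {m : ℕ}

/-! Everything is turned into determinants. Put x_k = -e^{-a_k}.

Quantum side. The matrix L of first rows of the powers of -A is the inverse of P. Hence, for every W
commuting with A, the leading minors of W P are Toeplitz determinants det(c_{a-b}) of the sequence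
c_m = ((-A)^m A⁻¹ W)_{1n} (`leadingMinor_mul_matPS`). Multiplying W by A shifts the sequence up to a
sign, and multiplying it by 1 + tA replaces c_m by c_m - t c_{m+1}. So σ_i and τ_i are, up to sign,
Toeplitz determinants of a sequence and its shift, and the Desnanot–Jacobi identity for Toeplitz
matrices bordered by a geometric progression gives relations of the same shape as the recursion for
F^{(i)}(t) = ∑ t^m F_m^{(i)}. The outcome (`toda_eq_toep`, `todaF_minors`) is that, after the
substitution, F^{(i)}(t) τ_i is the i-th leading minor of Z A (1 + tA) P for i < n, while F^{(n)}(t)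
= det(1 + tA) because Q_n = 0. The second fact, read coefficientwise in t, says that the defining
relations of 𝒪(𝒴) hold, so Φ exists; it is unique because the z_i and Q_i generate.

Since ψ_i is F^{(i)} at t = -e^{a_{i+1}}, and σ turns Z A into Z and τ_i into σ_i, the product
Φ̃(ψ_i) σ_i is the i-th leading minor of Z (1 - e^{a_{i+1}} A) P. In symmetric functions Z and A
have common eigenvectors, with eigenvalues Ω(b_k) and -x_k. The minor thereby becomes a bialternant
(`leadingMinor_eq_bialt`): the determinant with rows ω_k x_k^j for j < i and x_k^j for j ≥ i, over
the Vandermonde determinant, where ω_k = (1 - x_k/x_{i+1}) Ω(b_k). The factor vanishes at k = i+1,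
and that point drops out (`bialt_insert`): what is left is the bialternant of the Ω(b_k) on the n-1
points k = i+2, …, i+n.

Demazure side. Multiplication by ∏ Ω(b_{i+l+1}) untwists s_0 into a plain exchange of parameters, so
every D_j in the word of the rectangle becomes an isobaric divided difference (`mul_shift_opD`). The
operators of one row of boxes compose to a Lagrange-type sum over a distinguished point
(`rowOp_eq_sum`), and this sum is a Laplace expansion of a bialternant: each row of boxes adds one
row carrying Ω (`rowOp_bialt`). After i rows the same bialternant appears. -/

theorem det_mul_det_interior_aux (M : Matrix (Fin (m + 2)) (Fin (m + 2)) R) :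
    M.det * (M.det * (M.submatrix (Fin.succ ∘ Fin.castSucc) (Fin.succ ∘ Fin.castSucc)).det) =
      M.det * ((M.submatrix Fin.succ Fin.succ).det * (M.submatrix Fin.castSucc Fin.castSucc).det -
        (M.submatrix Fin.succ Fin.castSucc).det * (M.submatrix Fin.castSucc Fin.succ).det) := by
  have hl : (Fin.last (m + 1)) ≠ 0 := (Fin.last_pos).ne'
  let u : Fin 2 → Fin (m + 2) := fun k => if k = 0 then 0 else Fin.last (m + 1)
  have hu0 : u 0 = 0 := rfl
  have hu1 : u 1 = Fin.last (m + 1) := rfl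
  -- `1 + U * W` is the identity with its first and last columns replaced by those of the adjugate.
  -- Being a rank-two perturbation, it has determinant equal to a 2×2 determinant of adjugate
  -- entries, that is, of minors.
  let U : Matrix (Fin (m + 2)) (Fin 2) R := of fun i k => M.adjugate i (u k) - if i = u k then 1 else 0
  let W : Matrix (Fin 2) (Fin (m + 2)) R := of fun k j => if j = u k then 1 else 0
  have hN : (1 + U * W).det = M.adjugate 0 0 * M.adjugate (Fin.last _) (Fin.last _) -
      M.adjugate 0 (Fin.last _) * M.adjugate (Fin.last _) 0 := by
    rw [det_one_add_mul_comm, det_fin_two]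
    simp only [U, W, Matrix.add_apply, Matrix.mul_apply, of_apply, ite_mul, one_mul, zero_mul,
      Finset.sum_ite_eq', Finset.mem_univ, if_true]
    simp [hl, hl.symm, hu0, hu1]
  have hNa : ∀ i j, (1 + U * W : Matrix (Fin (m + 2)) (Fin (m + 2)) R) i j = if j = 0 then M.adjugate i 0 else
      if j = Fin.last _ then M.adjugate i (Fin.last _) else if i = j then 1 else 0 := by
    intro i j
    simp only [U, W, Matrix.add_apply, Matrix.mul_apply, Fin.sum_univ_two, Matrix.of_apply,
      Matrix.one_apply]
    by_cases h0 : j = 0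
    · subst h0
      rcases eq_or_ne i 0 with rfl | hi
      · simp [hl.symm, hu0, hu1]
      · simp [hl.symm, hi, hu0, hu1]
    · by_cases h1 : j = Fin.last _
      · subst h1; simp [hl, hu0, hu1]
      · simp [h0, h1, hu0, hu1]
  -- Multiplying by `M` turns the adjugate columns into `M.det` times basis vectors and keeps the
  -- inner columns of `M`; the determinant is then `M.det ^ 2` times the interior minor.
  let B : Matrix (Fin (m + 2)) (Fin (m + 2)) R := of fun i j =>
    if j = 0 then (if i = 0 then M.det else 0) else
      if j = Fin.last _ then (if i = Fin.last _ then M.det else 0) else M i j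
  have hB : M * (1 + U * W) = B := by
    ext i j
    rw [Matrix.mul_apply]
    simp only [hNa, B, of_apply]
    by_cases h0 : j = 0
    · simp only [h0, if_true]
      have := congrFun (congrFun (Matrix.mul_adjugate M) i) 0
      rw [Matrix.mul_apply] at this
      rw [this]
      simp [Matrix.one_apply]
    · by_cases h1 : j = Fin.last _
      · simp only [h1, if_true, if_neg hl]
        have := congrFun (congrFun (Matrix.mul_adjugate M) i) (Fin.last _)
        rw [Matrix.mul_apply] at this
        rw [this]
        simp [Matrix.one_apply]
      · simp [h0, h1]
  have hBd : B.det = M.det * (M.det *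
      (M.submatrix (Fin.succ ∘ Fin.castSucc) (Fin.succ ∘ Fin.castSucc)).det) := by
    rw [det_succ_column_zero, Finset.sum_eq_single 0]
    · rw [det_succ_column _ (Fin.last m), Finset.sum_eq_single (Fin.last m)]
      · simp only [B, submatrix_apply, of_apply]
        simp only [Fin.val_zero, pow_zero, if_true, one_mul, Fin.succAbove_zero, Fin.succ_last,
          if_neg hl, Fin.succAbove_last]
        rw [← two_mul, pow_mul]
        simp only [even_two, Even.neg_pow, one_pow, one_mul]
        congr 3
        ext i j
        have h1 : (Fin.castSucc j).succ ≠ Fin.last (m + 1) := by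
          intro h
          have := congrArg Fin.val h
          simp at this
          have := j.2
          omega
        simp [h1, Fin.succ_ne_zero]
      · intro i _ hi
        have : i.succ ≠ Fin.last (m + 1) := by
          intro h
          rw [← Fin.succ_last] at h
          exact hi (Fin.succ_injective _ h)
        simp [B, hl, this]
      · simp
    · intro i _ hi
      simp [B, hi]
    · simp
  rw [← hBd, ← hB, det_mul, hN]
  simp only [adjugate_fin_succ_eq_det_submatrix, Fin.succAbove_zero, Fin.succAbove_last]
  have e : ((-1 : R) ^ (m + 1)) * (-1) ^ (m + 1) = 1 := by
    rw [← pow_add, ← two_mul, pow_mul]; simp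
  have e2 : ((-1 : R) ^ (m + 1 + (m + 1))) = 1 := by rw [pow_add, e]
  simp only [Fin.val_zero, Fin.val_last, zero_add, add_zero, pow_zero, one_mul, e2]
  congr 1
  linear_combination (-(M.submatrix Fin.castSucc Fin.succ).det *
    (M.submatrix Fin.succ Fin.castSucc).det) * e

/-- The superfluous factor `M.det` is cancelled for the generic matrix over ℤ, whose determinant is
a nonzero polynomial; the identity is then specialized. -/
theorem det_mul_det_interior (M : Matrix (Fin (m + 2)) (Fin (m + 2)) R) :
    M.det * (M.submatrix (Fin.succ ∘ Fin.castSucc) (Fin.succ ∘ Fin.castSucc)).det =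
      (M.submatrix Fin.succ Fin.succ).det * (M.submatrix Fin.castSucc Fin.castSucc).det -
        (M.submatrix Fin.succ Fin.castSucc).det * (M.submatrix Fin.castSucc Fin.succ).det := by
  have h := mul_left_cancel₀ (det_mvPolynomialX_ne_zero (Fin (m + 2)) ℤ)
    (det_mul_det_interior_aux (mvPolynomialX (Fin (m + 2)) (Fin (m + 2)) ℤ))
  have h' := congrArg (MvPolynomial.aeval (fun p : Fin (m + 2) × Fin (m + 2) => M p.1 p.2)) h
  have hX := mvPolynomialX_mapMatrix_aeval ℤ M
  simp only [map_mul, map_sub, AlgHom.map_det, AlgHom.mapMatrix_apply] at h' hX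
  simp only [← submatrix_map, hX] at h'
  exact h'

end DesnanotJacobi

/-! ### Toeplitz determinants -/

section Toeplitz

open Matrix

variable {R : Type*} [CommRing R]

/-- The Toeplitz determinant `det (h_{a-b})`, `0 ≤ a, b < i`. -/
def toep (h : ℤ → R) (i : ℕ) : R := (of fun a b : Fin i => h ((a : ℤ) - (b : ℤ))).det

theorem toep_zero (h : ℤ → R) : toep h 0 = 1 := det_fin_zero

theorem toep_smul (c : R) (h : ℤ → R) (i : ℕ) : toep (fun m => c * h m) i = c ^ i * toep h i := by
  have : (of fun a b : Fin i => c * h ((a : ℤ) - (b : ℤ))) =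
      c • (of fun a b : Fin i => h ((a : ℤ) - (b : ℤ))) := by ext; simp
  rw [toep, this, det_smul, Fintype.card_fin, toep]

/-- `i` rows of a Toeplitz matrix with `i + 1` columns. -/
def toepRows (h : ℤ → R) (i : ℕ) (a : Fin i) (b : Fin (i + 1)) : R := h ((a : ℤ) - (b : ℤ) + 1)

/-- Adding s times each column to the next one clears the geometric row except for its first entry,
and turns the Toeplitz entries into those of h m + s h (m + 1). -/
theorem det_border_first (h : ℤ → R) (s c : R) (i : ℕ) :
    (of (Fin.cons (fun b : Fin (i + 1) => c * (-s) ^ (b : ℕ)) (toepRows h i))).det =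
      c * toep (fun m => h m + s * h (m + 1)) i := by
  let B : Matrix (Fin (i + 1)) (Fin (i + 1)) R :=
    of (Fin.cons (Fin.cons c 0)
      (fun a => Fin.cons (toepRows h i a 0) fun b : Fin i => h (a - b) + s * h (a - b + 1)))
  have h1 : (of (Fin.cons (fun b : Fin (i + 1) => c * (-s) ^ (b : ℕ)) (toepRows h i))).det =
      B.det := by
    refine det_eq_of_forall_col_eq_smul_add_pred (fun _ => -s) ?_ ?_
    · intro a
      refine Fin.cases ?_ (fun a => ?_) a <;> simp [B]
    · intro a j
      refine Fin.cases ?_ (fun a => ?_) a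
      · simp only [of_apply, Fin.cons_zero, Fin.val_succ, Fin.cons_succ, B, Pi.zero_apply,
          Fin.val_castSucc]
        ring
      · simp only [B, of_apply, Fin.cons_succ, toepRows, Fin.val_succ, Fin.val_castSucc]
        have : (a : ℤ) - ((j : ℕ) + 1 : ℕ) + 1 = a - j := by push_cast; ring
        rw [this]; ring
  rw [h1, det_succ_row_zero, Finset.sum_eq_single 0]
  · simp only [B, of_apply, Fin.cons_zero, Fin.val_zero, pow_zero, one_mul, Fin.succAbove_zero]
    rw [toep]
    congr 1
  · intro j _ hj
    obtain ⟨j, rfl⟩ := Fin.exists_succ_eq.2 hj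
    simp [B]
  · simp

theorem det_border_last (h : ℤ → R) (s c : R) (i : ℕ) :
    (of (Fin.snoc (α := fun _ => Fin (i + 1) → R) (toepRows h i)
      (fun b : Fin (i + 1) => c * (-s) ^ (b : ℕ)))).det =
      (-1) ^ i * (c * toep (fun m => h m + s * h (m + 1)) i) := by
  rw [← det_border_first, Fin.snoc_eq_cons_rotate]
  have := det_permute (finRotate (i + 1)) (of (Fin.cons (α := fun _ => Fin (i + 1) → R)
    (fun b : Fin (i + 1) => c * (-s) ^ (b : ℕ)) (toepRows h i)))
  rw [sign_finRotate] at this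
  refine Eq.trans ?_ (this.trans (by simp))
  rfl

/-- Desnanot–Jacobi for a Toeplitz matrix: deleting one row and the column at the opposite end
shifts the sequence by one step up or down. -/
theorem toep_sq (h : ℤ → R) (i : ℕ) :
    toep (fun m => h (m + 1)) (i + 1) ^ 2 =
      toep (fun m => h (m + 1)) i * toep (fun m => h (m + 1)) (i + 2) +
        toep (fun m => h (m + 1 + 1)) (i + 1) * toep h (i + 1) := by
  have e := det_mul_det_interior (of fun a b : Fin (i + 2) => h ((a : ℤ) - (b : ℤ) + 1))
  have e1 : ((of fun a b : Fin (i + 2) => h ((a : ℤ) - (b : ℤ) + 1)).submatrix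
      (Fin.succ ∘ Fin.castSucc) (Fin.succ ∘ Fin.castSucc)).det = toep (fun m => h (m + 1)) i := by
    rw [toep]; congr 1; ext a b; simp
  have e2 : ((of fun a b : Fin (i + 2) => h ((a : ℤ) - (b : ℤ) + 1)).submatrix
      Fin.succ Fin.succ).det = toep (fun m => h (m + 1)) (i + 1) := by
    rw [toep]; congr 1; ext a b; simp
  have e3 : ((of fun a b : Fin (i + 2) => h ((a : ℤ) - (b : ℤ) + 1)).submatrix
      Fin.castSucc Fin.castSucc).det = toep (fun m => h (m + 1)) (i + 1) := by
    rw [toep]; congr 1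
  have e4 : ((of fun a b : Fin (i + 2) => h ((a : ℤ) - (b : ℤ) + 1)).submatrix
      Fin.succ Fin.castSucc).det = toep (fun m => h (m + 1 + 1)) (i + 1) := by
    rw [toep]; congr 1; ext a b
    simp only [submatrix_apply, of_apply, Fin.val_succ, Fin.val_castSucc]
    congr 1; push_cast; ring
  have e5 : ((of fun a b : Fin (i + 2) => h ((a : ℤ) - (b : ℤ) + 1)).submatrix
      Fin.castSucc Fin.succ).det = toep h (i + 1) := by
    rw [toep]; congr 1; ext a b
    simp only [submatrix_apply, of_apply, Fin.val_succ, Fin.val_castSucc]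
    congr 1; push_cast; ring
  rw [e1, e2, e3, e4, e5] at e
  have e6 : (of fun a b : Fin (i + 2) => h ((a : ℤ) - (b : ℤ) + 1)).det =
    toep (fun m => h (m + 1)) (i + 2) := rfl
  rw [e6] at e
  linear_combination -e

/-- Desnanot–Jacobi for a Toeplitz matrix with the row of powers of -s at the bottom. This is the
determinantal form of the recursion `todaK_succ`. -/
theorem toep_border_last (h : ℤ → R) (s : R) (i : ℕ) :
    toep (fun m => h m + s * h (m + 1)) (i + 1) * toep (fun m => h (m + 1)) i =
      toep (fun m => h (m + 1) + s * h (m + 1 + 1)) i * toep h (i + 1) +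
        s * toep (fun m => h (m + 1)) (i + 1) * toep (fun m => h m + s * h (m + 1)) i := by
  set N : Matrix (Fin (i + 2)) (Fin (i + 2)) R :=
    of (Fin.snoc (α := fun _ => Fin (i + 2) → R) (toepRows h (i + 1))
      (fun b : Fin (i + 2) => 1 * (-s) ^ (b : ℕ))) with hN
  have e := det_mul_det_interior N
  have e0 : N.det = (-1) ^ (i + 1) * toep (fun m => h m + s * h (m + 1)) (i + 1) := by
    rw [hN, det_border_last h s 1 (i + 1), one_mul]
  have e1 : (N.submatrix (Fin.succ ∘ Fin.castSucc) (Fin.succ ∘ Fin.castSucc)).det =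
      toep (fun m => h (m + 1)) i := by
    rw [toep]; congr 1; ext a b
    simp only [hN, submatrix_apply, of_apply, Function.comp, Fin.succ_castSucc, Fin.snoc_castSucc,
      toepRows]
    simp
  have e2 : (N.submatrix Fin.succ Fin.succ).det =
      (-1) ^ i * ((-s) * toep (fun m => h m + s * h (m + 1)) i) := by
    rw [← det_border_last]; congr 1; ext a b
    refine Fin.lastCases ?_ (fun a => ?_) a
    · simp only [hN, submatrix_apply, of_apply, Fin.succ_last, Fin.snoc_last, Fin.val_succ]
      ring
    · simp [hN, Fin.succ_castSucc, toepRows, -Fin.castSucc_succ]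
  have e3 : (N.submatrix Fin.castSucc Fin.castSucc).det = toep (fun m => h (m + 1)) (i + 1) := by
    rw [toep]; congr 1; ext a b
    simp [hN, toepRows]
  have e4 : (N.submatrix Fin.succ Fin.castSucc).det =
      (-1) ^ i * (1 * toep (fun m => h (m + 1) + s * h (m + 1 + 1)) i) := by
    rw [← det_border_last (fun m => h (m + 1)) s 1 i]; congr 1; ext a b
    refine Fin.lastCases ?_ (fun a => ?_) a
    · simp only [hN, submatrix_apply, of_apply, Fin.succ_last, Fin.snoc_last, Fin.val_castSucc]
    · simp only [hN, submatrix_apply, of_apply, Fin.succ_castSucc, Fin.snoc_castSucc,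
        toepRows, Fin.val_succ, Fin.val_castSucc]
      congr 1; push_cast; ring
  have e5 : (N.submatrix Fin.castSucc Fin.succ).det = toep h (i + 1) := by
    rw [toep]; congr 1; ext a b
    simp only [hN, submatrix_apply, of_apply, Fin.snoc_castSucc, toepRows, Fin.val_succ]
    congr 1; push_cast; ring
  rw [e0, e1, e2, e3, e4, e5] at e
  have hs : ((-1 : R) ^ i) * (-1) ^ i = 1 := by
    rw [← pow_add, ← two_mul, pow_mul]; simp
  have e' := congrArg (fun r => (-1) ^ i * r) e
  simp only [pow_succ] at e'
  linear_combination (-1 : R) * e' + (toep (fun m => h (m + 1) + s * h (m + 1 + 1)) i *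
    toep h (i + 1) + s * toep (fun m => h (m + 1)) (i + 1) * toep (fun m => h m + s * h (m + 1)) i
    - toep (fun m => h m + s * h (m + 1)) (i + 1) * toep (fun m => h (m + 1)) i) * hs

/-- The same computation with the geometric row on top; it serves to eliminate terms in
`toep_border_isUnit`. -/
theorem toep_border_first (h : ℤ → R) (s : R) (i : ℕ) :
    toep (fun m => h (m + 1) + s * h (m + 1 + 1)) (i + 1) * toep (fun m => h (m + 1)) i =
      toep (fun m => h (m + 1) + s * h (m + 1 + 1)) i * toep (fun m => h (m + 1)) (i + 1) +
        s * toep (fun m => h (m + 1 + 1)) (i + 1) * toep (fun m => h m + s * h (m + 1)) i := by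
  set g : ℤ → R := fun m => h (m + 1) with hg
  set N : Matrix (Fin (i + 2)) (Fin (i + 2)) R :=
    of (Fin.cons (fun b : Fin (i + 2) => 1 * (-s) ^ (b : ℕ)) (toepRows g (i + 1))) with hN
  have e := det_mul_det_interior N
  have e0 : N.det = 1 * toep (fun m => g m + s * g (m + 1)) (i + 1) := by
    rw [hN, det_border_first g s 1 (i + 1)]
  have e1 : (N.submatrix (Fin.succ ∘ Fin.castSucc) (Fin.succ ∘ Fin.castSucc)).det = toep g i := by
    rw [toep]; congr 1; ext a b
    simp only [hN, submatrix_apply, of_apply, Function.comp, Fin.cons_succ, toepRows]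
    congr 1; simp; ring
  have e2 : (N.submatrix Fin.succ Fin.succ).det = toep g (i + 1) := by
    rw [toep]; congr 1; ext a b
    simp only [hN, submatrix_apply, of_apply, Fin.cons_succ, toepRows]
    congr 1; simp; ring
  have e3 : (N.submatrix Fin.castSucc Fin.castSucc).det =
      1 * toep (fun m => g m + s * g (m + 1)) i := by
    rw [← det_border_first]; congr 1; ext a b
    refine Fin.cases ?_ (fun a => ?_) a
    · simp [hN]
    · simp [hN, ← Fin.succ_castSucc, toepRows, -Fin.castSucc_succ]
  have e4 : (N.submatrix Fin.succ Fin.castSucc).det = toep (fun m => g (m + 1)) (i + 1) := by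
    rw [toep]; congr 1
  have e5 : (N.submatrix Fin.castSucc Fin.succ).det =
      (-s) * toep (fun m => h m + s * h (m + 1)) i := by
    rw [← det_border_first]; congr 1; ext a b
    refine Fin.cases ?_ (fun a => ?_) a
    · simp only [hN, submatrix_apply, of_apply, Fin.castSucc_zero, Fin.cons_zero, Fin.val_succ]
      ring
    · simp only [hN, submatrix_apply, of_apply, ← Fin.succ_castSucc, Fin.cons_succ, toepRows, hg,
        Fin.val_succ, Fin.val_castSucc]
      congr 1; push_cast; ring
  rw [e0, e1, e2, e3, e4, e5] at e
  linear_combination e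

/-- The companion of `toep_border_last`, valid where the Toeplitz determinant is invertible. -/
theorem toep_border_isUnit (h : ℤ → R) (s : R) (i : ℕ)
    (hu : IsUnit (toep (fun m => h (m + 1)) i)) :
    toep (fun m => h m + s * h (m + 1)) (i + 1) * toep (fun m => h (m + 1)) (i + 1) =
      toep (fun m => h (m + 1) + s * h (m + 1 + 1)) (i + 1) * toep h (i + 1) +
        s * toep (fun m => h (m + 1)) (i + 2) * toep (fun m => h m + s * h (m + 1)) i := by
  -- Elimination between the two bordered identities and `toep_sq` gives the relation only up to
  -- this common factor.
  apply hu.mul_left_cancel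
  linear_combination toep (fun m => h (m + 1)) (i + 1) * toep_border_last h s i -
    toep h (i + 1) * toep_border_first h s i +
    s * toep (fun m => h m + s * h (m + 1)) i * toep_sq h i

end Toeplitz

/-! ### The generating functions of the relativistic Toda Hamiltonians -/

section Toda

variable {R : Type*} [CommRing R] (z Q : ℕ → R) (t : R)

/-- `∑_m t^m F_m^{(i)}(z, Q)`. -/
def todaF (i : ℕ) : R :=
  ∑ J ∈ (Finset.Icc 1 i).powerset,
    t ^ J.card * ((∏ j ∈ J.filter (fun j => j + 1 ∉ J), (1 - Q j)) * ∏ j ∈ J, z j)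

/-- `∑_m t^m F_m^{(i)}(z, Q)` with `Q_i` replaced by `0`. -/
def todaK (i : ℕ) : R :=
  ∑ J ∈ (Finset.Icc 1 i).powerset,
    t ^ J.card * ((∏ j ∈ J.filter (fun j => j + 1 ∉ insert (i + 1) J), (1 - Q j)) * ∏ j ∈ J, z j)

theorem todaF_zero : todaF z Q t 0 = 1 := by simp [todaF]

theorem todaK_zero : todaK z Q t 0 = 1 := by simp [todaK]

theorem notMem_of_subset_Icc {i : ℕ} {J : Finset ℕ} (hJ : J ∈ (Finset.Icc 1 i).powerset) {j : ℕ}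
    (h : i < j) : j ∉ J := fun hj => by
  have := Finset.mem_Icc.1 (Finset.mem_powerset.1 hJ hj)
  omega

/-- Split by whether i + 1 lies in J. If it does, it has no successor in J and contributes 1 -
Q_{i+1}, while its presence suppresses the factor 1 - Q_i of the rest; that is why `todaK` appears.
-/
theorem todaF_succ (i : ℕ) :
    todaF z Q t (i + 1) = todaF z Q t i + (1 - Q (i + 1)) * t * z (i + 1) * todaK z Q t i := by
  have hI : Finset.Icc 1 (i + 1) = insert (i + 1) (Finset.Icc 1 i) := by
    ext; simp; omega
  rw [todaF, hI, Finset.sum_powerset_insert (by simp), ← todaF, todaK, Finset.mul_sum]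
  congr 1
  refine Finset.sum_congr rfl fun J hJ => ?_
  have h1 : i + 1 ∉ J := notMem_of_subset_Icc hJ (by omega)
  have h2 : i + 1 + 1 ∉ J := notMem_of_subset_Icc hJ (by omega)
  rw [Finset.card_insert_of_notMem h1, Finset.prod_insert h1, Finset.filter_insert,
    if_pos (by simp [h2]), Finset.prod_insert (by simp [h1])]
  ring

/-- The same splitting, with i + 2 counted as present, so that i + 1 contributes no factor in Q. -/
theorem todaK_succ (i : ℕ) :
    todaK z Q t (i + 1) = todaF z Q t i + t * z (i + 1) * todaK z Q t i := by
  have hI : Finset.Icc 1 (i + 1) = insert (i + 1) (Finset.Icc 1 i) := by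
    ext; simp; omega
  rw [todaK, hI, Finset.sum_powerset_insert (by simp), todaF, todaK, Finset.mul_sum]
  congr 1
  · refine Finset.sum_congr rfl fun J hJ => ?_
    congr 3
    refine Finset.filter_congr fun j hj => ?_
    have : j ≤ i := (Finset.mem_Icc.1 (Finset.mem_powerset.1 hJ hj)).2
    rw [Finset.mem_insert, not_or]
    exact ⟨fun h => h.2, fun h => ⟨by omega, h⟩⟩
  · refine Finset.sum_congr rfl fun J hJ => ?_
    have h1 : i + 1 ∉ J := notMem_of_subset_Icc hJ (by omega)
    rw [Finset.card_insert_of_notMem h1, Finset.prod_insert h1, Finset.filter_insert,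
      if_neg (by simp)]
    have : J.filter (fun j => j + 1 ∉ insert (i + 1 + 1) (insert (i + 1) J)) =
        J.filter (fun j => j + 1 ∉ insert (i + 1) J) := by
      refine Finset.filter_congr fun j hj => ?_
      have : j ≤ i := (Finset.mem_Icc.1 (Finset.mem_powerset.1 hJ hj)).2
      rw [Finset.mem_insert (a := j + 1) (b := i + 1 + 1), not_or]
      exact ⟨fun h => h.2, fun h => ⟨by omega, h⟩⟩
    rw [this]
    ring

theorem todaF_eq_todaK (i : ℕ) (h : Q (i + 1) = 0) : todaF z Q t (i + 1) = todaK z Q t (i + 1) := by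
  rw [todaF_succ, todaK_succ, h]
  ring

/-- With `σ_i = toep h i` and `τ_i = (-1)^i toep h⁺ i`, the substitution
`z_i = τ_i σ_{i-1} / (σ_i τ_{i-1})`, `Q_i = τ_{i-1} τ_{i+1} / τ_i²` turns the generating functions
into quotients of Toeplitz determinants. -/
theorem toda_eq_toep (n : ℕ) (h : ℤ → R) (s : R)
    (hu : ∀ i, i ≤ n → IsUnit (toep h i)) (hu' : ∀ i, i ≤ n → IsUnit (toep (fun m => h (m + 1)) i))
    (hz : ∀ i, i < n → z (i + 1) * (toep h (i + 1) * toep (fun m => h (m + 1)) i) =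
      -(toep (fun m => h (m + 1)) (i + 1) * toep h i))
    (hQ : ∀ i, i + 1 < n → Q (i + 1) * toep (fun m => h (m + 1)) (i + 1) ^ 2 =
      toep (fun m => h (m + 1)) i * toep (fun m => h (m + 1)) (i + 2))
    (i : ℕ) (hi : i ≤ n) :
    todaK z Q (-s) i * toep h i = toep (fun m => h m + s * h (m + 1)) i ∧
      (i < n → todaF z Q (-s) i * toep (fun m => h (m + 1)) i =
        toep (fun m => h (m + 1) + s * h (m + 1 + 1)) i) := by
  induction i with
  | zero => simp [todaK_zero, todaF_zero, toep_zero]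
  | succ i ih =>
    obtain ⟨ihK, ihF⟩ := ih (by omega)
    have ihF := ihF (by omega)
    have hz := hz i (by omega)
    -- Only the value of z_{i+1} enters here: `todaK_succ` is matched with `toep_border_last` after
    -- clearing one Toeplitz determinant.
    have hK : todaK z Q (-s) (i + 1) * toep h (i + 1) =
        toep (fun m => h m + s * h (m + 1)) (i + 1) := by
      apply (hu' i (by omega)).mul_right_cancel
      rw [todaK_succ, toep_border_last]
      linear_combination toep h (i + 1) * ihF - s * todaK z Q (-s) i * hz +
        s * toep (fun m => h (m + 1)) (i + 1) * ihK
    refine ⟨hK, fun hi' => ?_⟩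
    have hQ := hQ i hi'
    -- The values of z_{i+1} and Q_{i+1} are given with denominators cleared, hence the
    -- multiplication by the units that occur in them.
    apply (((hu (i + 1) hi).mul (hu' i (by omega))).mul (hu' (i + 1) hi)).mul_right_cancel
    -- F and K differ by a single term in Q_{i+1}, whose image is the last term of
    -- `toep_border_isUnit`.
    have e : todaF z Q (-s) (i + 1) =
        todaK z Q (-s) (i + 1) + Q (i + 1) * s * z (i + 1) * todaK z Q (-s) i := by
      rw [todaF_succ, todaK_succ]; ring
    rw [e]
    have hb := toep_border_isUnit h s i (hu' i (by omega))
    linear_combination (toep (fun m => h (m + 1)) (i + 1) * toep (fun m => h (m + 1)) i *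
        toep (fun m => h (m + 1)) (i + 1)) * hK +
      s * todaK z Q (-s) i * z (i + 1) * toep h (i + 1) * toep (fun m => h (m + 1)) i * hQ +
      s * toep (fun m => h (m + 1)) i * toep (fun m => h (m + 1)) (i + 2) * todaK z Q (-s) i * hz -
      s * toep (fun m => h (m + 1)) i * toep (fun m => h (m + 1)) (i + 1) *
        toep (fun m => h (m + 1)) (i + 2) * ihK +
      toep (fun m => h (m + 1)) i * toep (fun m => h (m + 1)) (i + 1) * hb

end Toda

open Matrix

/-! ### Leading principal minors -/

section LeadingMinor

variable {n : ℕ} {R : Type*} [CommRing R]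

theorem leadingMinor_transpose (M : Matrix (Fin n) (Fin n) R) (i : ℕ) :
    leadingMinor Mᵀ i = leadingMinor M i := by
  rw [leadingMinor, leadingMinor, ← det_transpose]
  rfl

/-- In the first i rows of L only the first i columns are nonzero, so the top left blocks multiply.
-/
theorem leadingMinor_lower_mul {L : Matrix (Fin n) (Fin n) R} (hL : ∀ a b, a < b → L a b = 0)
    (M : Matrix (Fin n) (Fin n) R) (i : ℕ) :
    leadingMinor (L * M) i = leadingMinor L i * leadingMinor M i := by
  rw [leadingMinor, leadingMinor, leadingMinor, ← det_mul]
  congr 1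
  ext a b
  simp only [submatrix_apply, mul_apply]
  rw [← Finset.sum_subset (Finset.subset_univ (Finset.univ.filter fun c : Fin n => c.val < i))]
  · rw [← Finset.sum_subtype_eq_sum_filter]
    exact Finset.sum_congr (by ext; simp) fun c _ => rfl
  · intro c _ hc
    have hc' : ¬ c.val < i := by simpa using hc
    rw [hL _ _ (Fin.lt_def.2 (by have := a.2; omega)), zero_mul]

theorem leadingMinor_mul_upper {U : Matrix (Fin n) (Fin n) R} (hU : ∀ a b, b < a → U a b = 0)
    (M : Matrix (Fin n) (Fin n) R) (i : ℕ) :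
    leadingMinor (M * U) i = leadingMinor M i * leadingMinor U i := by
  rw [← leadingMinor_transpose, transpose_mul, leadingMinor_lower_mul (L := Uᵀ) (fun a b h => hU b a h),
    leadingMinor_transpose, leadingMinor_transpose, mul_comm]

theorem leadingMinor_lower_unitri {L : Matrix (Fin n) (Fin n) R} (hL : ∀ a b, a < b → L a b = 0)
    (hd : ∀ a, L a a = 1) (i : ℕ) : leadingMinor L i = 1 := by
  rw [leadingMinor, det_of_isLowerTriangular]
  · simp [hd]
  · intro a b h
    exact hL _ _ h

theorem leadingMinor_upper_unitri {U : Matrix (Fin n) (Fin n) R} (hU : ∀ a b, b < a → U a b = 0)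
    (hd : ∀ a, U a a = 1) (i : ℕ) : leadingMinor U i = 1 := by
  rw [← leadingMinor_transpose]
  exact leadingMinor_lower_unitri (fun a b h => hU b a h) hd i

theorem leadingMinor_card (M : Matrix (Fin n) (Fin n) R) : leadingMinor M n = M.det := by
  rw [leadingMinor]
  exact det_submatrix_equiv_self (Equiv.subtypeUnivEquiv fun r : Fin n => r.2) M

theorem leadingMinor_eq_det_fin (M : Matrix (Fin n) (Fin n) R) {i : ℕ} (hi : i ≤ n) :
    leadingMinor M i = (M.submatrix (Fin.castLE hi) (Fin.castLE hi)).det := by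
  let e : {r : Fin n // r.val < i} ≃ Fin i :=
    { toFun := fun r => ⟨r.1.1, r.2⟩
      invFun := fun r => ⟨Fin.castLE hi r, r.2⟩
      left_inv := fun r => rfl
      right_inv := fun r => rfl }
  rw [leadingMinor, ← det_submatrix_equiv_self e]
  rfl

theorem leadingMinor_toep (h : ℤ → R) {i : ℕ} (hi : i ≤ n) :
    leadingMinor (of fun a b : Fin n => h ((a : ℤ) - (b : ℤ))) i = toep h i := by
  rw [leadingMinor_eq_det_fin _ hi]
  rfl

end LeadingMinor

/-! ### Elementary symmetric polynomials -/

theorem elemSym_eq_zero {n m k : ℕ} (h : m < k) : elemSym n m k = 0 := by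
  rw [elemSym, Multiset.esymm, Multiset.powersetCard_eq_empty]
  · simp
  · simpa using h

/-- The indices 1, …, n exhaust ℤ/n, and the sum of all a_i is the class of the constant vector 1,
which the weight lattice of SL_n kills. -/
theorem sum_wt_range (n : ℕ) [NeZero n] :
    ∑ t ∈ Finset.range n, wt n ((t + 1 : ℕ) : ZMod n) = 0 := by
  have h1 : ∑ t ∈ Finset.range n, wt n ((t + 1 : ℕ) : ZMod n) = ∑ i : ZMod n, wt n i := by
    refine Finset.sum_bij (fun t _ => ((t + 1 : ℕ) : ZMod n)) (fun _ _ => Finset.mem_univ _) ?_ ?_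
      (fun _ _ => rfl)
    · intro s hs t ht hst
      push_cast at hst
      have hst' := add_right_cancel hst
      rw [ZMod.natCast_eq_natCast_iff'] at hst'
      rwa [Nat.mod_eq_of_lt (Finset.mem_range.1 hs), Nat.mod_eq_of_lt (Finset.mem_range.1 ht)]
        at hst'
    · intro i _
      refine ⟨(i - 1).val, Finset.mem_range.2 (ZMod.val_lt _), ?_⟩
      push_cast
      rw [ZMod.natCast_zmod_val]
      ring
  rw [h1]
  change ∑ i : ZMod n, QuotientAddGroup.mk' (AddSubgroup.zmultiples (1 : ZMod n → ℤ))
    (Pi.single i 1) = 0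
  rw [← map_sum, QuotientAddGroup.mk'_apply, QuotientAddGroup.eq_zero_iff]
  refine ⟨1, ?_⟩
  ext j
  simp [Finset.sum_apply, Pi.single_apply]

theorem elemSym_self (n m : ℕ) :
    elemSym n m m = expW (-∑ t ∈ Finset.range m, wt n ((t + 1 : ℕ) : ZMod n)) := by
  induction m with
  | zero => simp [elemSym_zero, expW_zero]
  | succ m ih =>
    rw [elemSym_succ, elemSym_eq_zero (Nat.lt_succ_self m), zero_add, ih, ← expW_add,
      Finset.sum_range_succ]
    congr 1
    abel

theorem elemSym_top (n : ℕ) [NeZero n] : elemSym n n n = 1 := by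
  rw [elemSym_self, sum_wt_range, neg_zero, expW_zero]

theorem prod_one_add_mul {n : ℕ} {S : Type*} [CommRing S] [Algebra (RT n) S] (t : S) (m : ℕ) :
    ∏ k ∈ Finset.range m, (1 + t * algebraMap (RT n) S (expW (-wt n ((k + 1 : ℕ) : ZMod n)))) =
      ∑ j ∈ Finset.range (m + 1), t ^ j * algebraMap (RT n) S (elemSym n m j) := by
  induction m with
  | zero => simp [elemSym_zero]
  | succ m ih =>
    rw [Finset.prod_range_succ, ih, mul_add, mul_one, Finset.sum_range_succ' _ (m + 1)]
    simp only [elemSym_succ, map_add, map_mul, mul_add, Finset.sum_add_distrib]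
    have h : ∑ j ∈ Finset.range (m + 1), t ^ j * algebraMap (RT n) S (elemSym n m j) =
        ∑ j ∈ Finset.range (m + 1), t ^ (j + 1) * algebraMap (RT n) S (elemSym n m (j + 1)) +
          t ^ 0 * algebraMap (RT n) S (elemSym n (m + 1) 0) := by
      rw [Finset.sum_range_succ', elemSym_zero, elemSym_zero, Finset.sum_range_succ _ m,
        elemSym_eq_zero (Nat.lt_succ_self m)]
      simp
    rw [Finset.sum_mul]
    have h2 : ∑ i ∈ Finset.range (m + 1), t ^ i * algebraMap (RT n) S (elemSym n m i) *
        (t * algebraMap (RT n) S (expW (-wt n ((m + 1 : ℕ) : ZMod n)))) =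
        ∑ x ∈ Finset.range (m + 1), t ^ (x + 1) *
          (algebraMap (RT n) S (expW (-wt n ((m + 1 : ℕ) : ZMod n))) *
            algebraMap (RT n) S (elemSym n m x)) :=
      Finset.sum_congr rfl fun j _ => by ring
    rw [h2, h]
    ring

/-! ### The matrices `A` and `P` -/

section MatAP

variable {n : ℕ} {S : Type*} [CommRing S] [Algebra (RT n) S]

/-- The matrix `A` over an `R(T)`-algebra. -/
def matAS (n : ℕ) (S : Type*) [CommRing S] [Algebra (RT n) S] : Matrix (Fin n) (Fin n) S :=
  (matA n).map (algebraMap (RT n) S)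

/-- The matrix `P` over an `R(T)`-algebra. -/
def matPS (n : ℕ) (S : Type*) [CommRing S] [Algebra (RT n) S] : Matrix (Fin n) (Fin n) S :=
  (matP n).map (algebraMap (RT n) S)

theorem matPS_diag (a : Fin n) : matPS n S a a = 1 := by
  simp [matPS, matP, elemSym_zero]

/-- By the Pascal-type recursion for elementary symmetric polynomials the diagonal term of A cancels
part of the superdiagonal one, so A carries each column of P to minus the preceding one. Only the
last row, which has no superdiagonal entry, is an exception. -/
theorem matAS_mul_matPS (a b : Fin n) (ha : a.val + 1 < n) :
    (matAS n S * matPS n S) a b =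
      if h : 0 < b.val then -matPS n S a ⟨b.val - 1, by omega⟩ else 0 := by
  have h1 := sum_matA_left (S := S) (fun j => matPS n S j b) a
  rw [mul_apply]
  refine h1.trans ?_
  rw [dif_pos ha]
  simp only [matPS, map_apply, matP, of_apply, Fin.le_def]
  rw [ix]
  by_cases hab : b.val ≤ a.val
  · rw [if_pos hab, if_pos (by omega), show a.val + 1 - b.val = a.val - b.val + 1 by omega,
      elemSym_succ, map_add, map_mul]
    by_cases hb : 0 < b.val
    · rw [dif_pos hb, if_pos (by omega), show a.val - (b.val - 1) = a.val - b.val + 1 by omega]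
      ring
    · rw [dif_neg hb, elemSym_eq_zero (m := a.val) (k := a.val - b.val + 1) (by omega)]
      simp
  · rw [if_neg hab, dif_pos (by omega)]
    by_cases hab' : b.val = a.val + 1
    · rw [if_pos (by omega), if_pos (by omega)]
      simp [hab', elemSym_zero]
    · rw [if_neg (by omega), if_neg (by omega)]
      simp

theorem isUnit_neg_matAS : IsUnit (-matAS n S) := by
  rw [IsUnit.neg_iff, isUnit_iff_isUnit_det]
  have := (isUnit_det_matA n).map (algebraMap (RT n) S)
  rwa [RingHom.map_det] at this

theorem det_one_add_smul_matAS (t : S) :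
    (1 + t • matAS n S).det =
      ∑ j ∈ Finset.range (n + 1), t ^ j * algebraMap (RT n) S (elemSym n n j) := by
  rw [det_of_isUpperTriangular, ← prod_one_add_mul, Finset.prod_range]
  · refine Finset.prod_congr rfl fun k _ => ?_
    simp [matAS, matA, ix]
  · intro a b hab
    have := matA_upper n hab
    have hne : a ≠ b := fun h => by subst h; exact lt_irrefl _ hab
    simp [matAS, this, one_apply_ne hne]

variable [NeZero n]

/-- The last index. -/
def lastIdx (n : ℕ) [NeZero n] : Fin n := ⟨n - 1, by have := NeZero.pos n; omega⟩

/-- In the last row the value is e^{-a_n} e_{n-1}(e^{-a_1}, …, e^{-a_{n-1}}) = e_n(e^{-a_1}, …,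
e^{-a_n}) = 1. Thus the first column of P is A⁻¹ applied to the last basis vector. -/
theorem matAS_mul_matPS_zero (a : Fin n) :
    (matAS n S * matPS n S) a 0 = if a = lastIdx n then 1 else 0 := by
  by_cases ha : a.val + 1 < n
  · rw [matAS_mul_matPS a 0 ha, dif_neg (by simp), if_neg]
    rintro rfl
    simp [lastIdx] at ha
    omega
  · have h1 := sum_matA_left (S := S) (fun j => matPS n S j 0) a
    have h2 : a.val + 1 = n := by have := a.2; omega
    have h3 : a = lastIdx n := Fin.ext (by simp [lastIdx]; omega)
    rw [mul_apply, if_pos h3]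
    refine h1.trans ?_
    rw [dif_neg ha, sub_zero, ix]
    simp only [matPS, map_apply, matP, of_apply, Fin.le_def]
    have h4 := elemSym_succ n a.val a.val
    rw [elemSym_eq_zero (Nat.lt_succ_self _), zero_add, h2, elemSym_top] at h4
    rw [if_pos (by simp), ← map_mul, h2]
    simp only [Fin.val_zero, tsub_zero]
    rw [← h4, map_one]

/-- `-A` as a unit of the matrix ring. -/
def negA (n : ℕ) [NeZero n] (S : Type*) [CommRing S] [Algebra (RT n) S] :
    (Matrix (Fin n) (Fin n) S)ˣ := (isUnit_neg_matAS (n := n) (S := S)).unit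

theorem negA_val : (negA n S : Matrix (Fin n) (Fin n) S) = -matAS n S := rfl

/-- The first row of `(-A)^a`. -/
def rowPow (n : ℕ) [NeZero n] (S : Type*) [CommRing S] [Algebra (RT n) S] (a : ℕ) (j : Fin n) : S :=
  ((-matAS n S) ^ a) 0 j

theorem rowPow_succ (a : ℕ) (j : Fin n) :
    rowPow n S (a + 1) j = (if h : 0 < j.val then rowPow n S a ⟨j.val - 1, by omega⟩ else 0) -
      rowPow n S a j * algebraMap (RT n) S (expW (-wt n (ix j))) := by
  have h1 := sum_matA_right (S := S) (rowPow n S a) j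
  rw [rowPow, pow_succ, mul_neg, Matrix.neg_apply, mul_apply]
  refine (congrArg Neg.neg h1).trans ?_
  split_ifs <;> ring

theorem rowPow_eq_zero {a : ℕ} {j : Fin n} (h : a < j.val) : rowPow n S a j = 0 := by
  induction a generalizing j with
  | zero =>
    rw [rowPow, pow_zero, one_apply_ne]
    rintro rfl
    simp at h
  | succ a ih =>
    rw [rowPow_succ, dif_pos (by omega), ih (by simp only; omega), ih (by omega)]
    simp

theorem rowPow_self {a : ℕ} {j : Fin n} (h : a = j.val) : rowPow n S a j = 1 := by
  induction a generalizing j with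
  | zero =>
    have : j = 0 := Fin.ext (by simp [← h])
    rw [this, rowPow, pow_zero, one_apply_eq]
  | succ a ih =>
    rw [rowPow_succ, dif_pos (by omega), ih (by simp only; omega), rowPow_eq_zero (by omega)]
    simp

/-- The matrix whose rows are the first rows of the powers of `-A`; it is the inverse of `P`. -/
def matL (n : ℕ) [NeZero n] (S : Type*) [CommRing S] [Algebra (RT n) S] :
    Matrix (Fin n) (Fin n) S := of fun a j => rowPow n S a.val j

/-- By induction on the row: one more factor -A, moved onto P, replaces each column of P by its
predecessor. -/
theorem matL_mul_matPS : matL n S * matPS n S = 1 := by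
  have key : ∀ a : ℕ, a < n → ∀ b : Fin n, ∑ j, rowPow n S a j * matPS n S j b =
      if a = b.val then 1 else 0 := by
    intro a
    induction a with
    | zero =>
      intro _ b
      rw [Finset.sum_eq_single 0]
      · rw [rowPow_self (by simp), one_mul]
        simp only [matPS, map_apply, matP, of_apply, Fin.le_def]
        by_cases hb : b.val = 0
        · simp [hb, elemSym_zero]
        · rw [if_neg (by simpa using hb), if_neg (fun h => hb h.symm), map_zero]
      · intro j _ hj
        rw [rowPow_eq_zero, zero_mul]
        exact Nat.pos_of_ne_zero fun h => hj (Fin.ext (by simp [h]))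
      · simp
    | succ a ih =>
      intro ha b
      have h1 : ∑ j, rowPow n S (a + 1) j * matPS n S j b =
          -∑ k, rowPow n S a k * (matAS n S * matPS n S) k b := by
        have : ((-matAS n S) ^ (a + 1) * matPS n S) 0 b =
            -((-matAS n S) ^ a * (matAS n S * matPS n S)) 0 b := by
          rw [pow_succ, ← Matrix.neg_apply, ← Matrix.mul_assoc]; simp
        rw [mul_apply, mul_apply] at this
        exact this
      rw [h1]
      -- The first row of (-A)^a is supported on columns ≤ a, and a + 1 < n, so the exceptional last
      -- row of A P is never met.
      have h2 : ∀ k, rowPow n S a k * (matAS n S * matPS n S) k b = rowPow n S a k *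
          (if h : 0 < b.val then -matPS n S k ⟨b.val - 1, by omega⟩ else 0) := by
        intro k
        by_cases hk : k.val ≤ a
        · rw [matAS_mul_matPS _ _ (by omega)]
        · rw [rowPow_eq_zero (by omega), zero_mul, zero_mul]
      rw [Finset.sum_congr rfl fun k _ => h2 k]
      split_ifs with hb hab hab
      · simp only [mul_neg, Finset.sum_neg_distrib, neg_neg]
        rw [ih (by omega), if_pos (by simp only; omega)]
      · simp only [mul_neg, Finset.sum_neg_distrib, neg_neg]
        rw [ih (by omega), if_neg (by simp only; omega)]
      · omega
      · simp
  ext a b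
  rw [mul_apply]
  refine (key a.val a.2 b).trans ?_
  simp [one_apply, Fin.ext_iff]

theorem matL_lower (a b : Fin n) (h : a < b) : matL n S a b = 0 := rowPow_eq_zero h

theorem matPS_mul_matL : matPS n S * matL n S = 1 :=
  mul_eq_one_comm.1 matL_mul_matPS

theorem leadingMinor_matL_mul (M : Matrix (Fin n) (Fin n) S) (i : ℕ) :
    leadingMinor (matL n S * M) i = leadingMinor M i := by
  rw [leadingMinor_lower_mul matL_lower,
    leadingMinor_lower_unitri matL_lower (fun a => rowPow_self rfl), one_mul]

/-- The sequence `((-A)^m A⁻¹ W)_{1n}`, `m ∈ ℤ`. -/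
def cornerSeq (W : Matrix (Fin n) (Fin n) S) (m : ℤ) : S :=
  -(((negA n S ^ (m - 1) : (Matrix (Fin n) (Fin n) S)ˣ) : Matrix (Fin n) (Fin n) S) * W) 0
    (lastIdx n)

theorem cornerSeq_add (W W' : Matrix (Fin n) (Fin n) S) (m : ℤ) :
    cornerSeq (W + W') m = cornerSeq W m + cornerSeq W' m := by
  rw [cornerSeq, Matrix.mul_add, Matrix.add_apply, neg_add]; rfl

theorem cornerSeq_smul (c : S) (W : Matrix (Fin n) (Fin n) S) (m : ℤ) :
    cornerSeq (c • W) m = c * cornerSeq W m := by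
  simp [cornerSeq]

theorem cornerSeq_mul (W : Matrix (Fin n) (Fin n) S) (h : Commute W (matAS n S)) (m : ℤ) :
    cornerSeq (W * matAS n S) m = -cornerSeq W (m + 1) := by
  have e : ((negA n S ^ (m + 1 - 1) : (Matrix (Fin n) (Fin n) S)ˣ) : Matrix (Fin n) (Fin n) S) =
      ((negA n S ^ (m - 1) : (Matrix (Fin n) (Fin n) S)ˣ) : Matrix (Fin n) (Fin n) S) *
        -matAS n S := by
    rw [← negA_val, ← Units.val_mul, ← _root_.zpow_add_one]
    congr 2; ring
  rw [cornerSeq, cornerSeq, e, h.eq, Matrix.mul_assoc]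
  simp

/-- `-(-A)^{-b-1}` applied to the last basis vector, as columns of a matrix. -/
def matB (n : ℕ) [NeZero n] (S : Type*) [CommRing S] [Algebra (RT n) S] :
    Matrix (Fin n) (Fin n) S :=
  of fun j b => -((negA n S ^ (-(b.val : ℤ) - 1) : (Matrix (Fin n) (Fin n) S)ˣ) :
    Matrix (Fin n) (Fin n) S) j (lastIdx n)

/-- W commutes with the powers of -A, so the power from row a and the power from column b merge and
the entry depends only on a - b. -/
theorem matL_mul_mul_matB (W : Matrix (Fin n) (Fin n) S) (h : Commute W (matAS n S)) :
    matL n S * W * matB n S = of fun a b : Fin n => cornerSeq W ((a : ℤ) - (b : ℤ)) := by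
  ext a b
  have hc : Commute W (((negA n S ^ (-(b.val : ℤ) - 1) : (Matrix (Fin n) (Fin n) S)ˣ) :
      Matrix (Fin n) (Fin n) S)) := by
    have : Commute W (negA n S : Matrix (Fin n) (Fin n) S) := h.neg_right
    exact this.units_zpow_right _
  have e : (((negA n S ^ (a.val : ℤ) : (Matrix (Fin n) (Fin n) S)ˣ) :
      Matrix (Fin n) (Fin n) S) * W * -((negA n S ^ (-(b.val : ℤ) - 1) :
      (Matrix (Fin n) (Fin n) S)ˣ) : Matrix (Fin n) (Fin n) S)) 0 (lastIdx n) =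
      cornerSeq W ((a : ℤ) - (b : ℤ)) := by
    rw [cornerSeq, mul_neg, Matrix.mul_assoc, hc.eq, ← Matrix.mul_assoc, ← Units.val_mul,
      ← _root_.zpow_add,
      Matrix.neg_apply, show (a : ℤ) + (-(b : ℤ) - 1) = a - b - 1 by ring]
  rw [of_apply, ← e, mul_apply, mul_apply]
  refine Finset.sum_congr rfl fun k _ => ?_
  congr 1

/-- Since P L = 1, L W B = L (W P) (L B). Here L is lower unitriangular and L B upper unitriangular,
so neither affects leading minors, and L W B is Toeplitz. -/
theorem leadingMinor_mul_matPS (W : Matrix (Fin n) (Fin n) S) (h : Commute W (matAS n S))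
    {i : ℕ} (hi : i ≤ n) : leadingMinor (W * matPS n S) i = toep (cornerSeq W) i := by
  have h1 := matL_mul_mul_matB (1 : Matrix (Fin n) (Fin n) S) (Commute.one_left _)
  rw [Matrix.mul_one] at h1
  -- Below the diagonal the entry is, up to sign, the corner entry of a power of -A with exponent
  -- less than n - 1, which vanishes since A is bidiagonal.
  have hlow : ∀ a b, b < a → (matL n S * matB n S) a b = 0 := by
    intro a b hab
    have hab' : b.val < a.val := hab
    rw [h1, of_apply, cornerSeq, Matrix.mul_one]
    obtain ⟨d, hd⟩ : ∃ d : ℕ, (a : ℤ) - (b : ℤ) - 1 = d := ⟨a.val - b.val - 1, by omega⟩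
    rw [hd, zpow_natCast, Units.val_pow_eq_pow_val, negA_val]
    have := rowPow_eq_zero (n := n) (S := S) (a := d) (j := lastIdx n) (by
      simp only [lastIdx]
      have := a.2
      omega)
    rw [rowPow] at this
    rw [this, neg_zero]
  -- The diagonal entry is the corner entry of A⁻¹, that is, the top entry of the first column of P.
  have hdiag : ∀ a, (matL n S * matB n S) a a = 1 := by
    intro a
    rw [h1, of_apply, cornerSeq, Matrix.mul_one, sub_self, zero_sub, _root_.zpow_neg_one]
    have e : (matAS n S * matPS n S).col 0 = (1 : Matrix (Fin n) (Fin n) S).col (lastIdx n) := by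
      ext a
      rw [col_apply, col_apply, matAS_mul_matPS_zero, one_apply]
    have e2 : -(((negA n S)⁻¹ : (Matrix (Fin n) (Fin n) S)ˣ) : Matrix (Fin n) (Fin n) S) *
        (matAS n S * matPS n S) = matPS n S := by
      rw [← Matrix.mul_assoc, neg_mul_comm, ← negA_val, Units.inv_mul, Matrix.one_mul]
    have e3 := congrFun (congrFun e2 0) 0
    rw [mul_apply, matPS_diag] at e3
    rw [← e3]
    simp only [matAS_mul_matPS_zero, mul_ite, mul_one, mul_zero, Finset.sum_ite_eq',
      Finset.mem_univ, if_true]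
    rfl
  rw [← leadingMinor_matL_mul, ← mul_one (leadingMinor _ i),
    ← leadingMinor_upper_unitri hlow hdiag i, ← leadingMinor_mul_upper hlow, Matrix.mul_assoc,
    Matrix.mul_assoc, ← Matrix.mul_assoc (matPS n S), matPS_mul_matL, Matrix.one_mul,
    ← Matrix.mul_assoc, matL_mul_mul_matB W h, leadingMinor_toep _ hi]

end MatAP

/-! ### The relativistic Toda Hamiltonians on the centralizer family -/

theorem map_one_add_smul {n : ℕ} {S T F : Type*} [CommRing S] [CommRing T] [FunLike F S T] [RingHomClass F S T] 
    (f : F) (t : S) (M : Matrix (Fin n) (Fin n) S) : (1 + t • M).map f = 1 + f t • M.map f := by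
  ext a b
  simp [one_apply, apply_ite]

section TodaMinor

variable {n : ℕ} {S : Type*} [CommRing S] [Algebra (RT n) S]

theorem commute_one_add_smul (W : Matrix (Fin n) (Fin n) S) (h : Commute W (matAS n S)) (t : S) :
    Commute (W * (1 + t • matAS n S)) (matAS n S) :=
  h.mul_left ((Commute.one_left _).add_left ((Commute.refl _).smul_left t))

variable [NeZero n]

theorem cornerSeq_one_add_smul (W : Matrix (Fin n) (Fin n) S) (h : Commute W (matAS n S)) (t : S)
    (m : ℤ) : cornerSeq (W * (1 + t • matAS n S)) m = cornerSeq W m + -t * cornerSeq W (m + 1) := by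
  rw [Matrix.mul_add, Matrix.mul_one, mul_smul_comm, cornerSeq_add, cornerSeq_smul,
    cornerSeq_mul W h]
  ring

theorem leadingMinor_mul_matAS_mul_matPS (W : Matrix (Fin n) (Fin n) S)
    (h : Commute W (matAS n S)) {i : ℕ} (hi : i ≤ n) :
    leadingMinor (W * matAS n S * matPS n S) i =
      (-1) ^ i * toep (fun m => cornerSeq W (m + 1)) i := by
  rw [leadingMinor_mul_matPS _ (h.mul_left (Commute.refl _)) hi, ← toep_smul]
  congr 1
  funext m
  rw [cornerSeq_mul W h]
  ring

/-- `toda_eq_toep` for the corner sequence of Z and s = -t. The signs (-1)^i come from the shift by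
A: they cancel in Q_i and leave one sign in z_i. -/
theorem todaF_minors (Z : Matrix (Fin n) (Fin n) S) (h : Commute Z (matAS n S))
    (hs : ∀ i, i ≤ n → IsUnit (leadingMinor (Z * matPS n S) i))
    (ht : ∀ i, i ≤ n → IsUnit (leadingMinor (Z * matAS n S * matPS n S) i)) (z Q : ℕ → S) (t : S)
    (hz : ∀ i, i < n → z (i + 1) * (leadingMinor (Z * matPS n S) (i + 1) *
      leadingMinor (Z * matAS n S * matPS n S) i) =
      leadingMinor (Z * matAS n S * matPS n S) (i + 1) * leadingMinor (Z * matPS n S) i)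
    (hQ : ∀ i, i + 1 < n → Q (i + 1) * leadingMinor (Z * matAS n S * matPS n S) (i + 1) ^ 2 =
      leadingMinor (Z * matAS n S * matPS n S) i *
        leadingMinor (Z * matAS n S * matPS n S) (i + 2)) (i : ℕ) (hi : i ≤ n) :
    todaK z Q t i * leadingMinor (Z * matPS n S) i =
        leadingMinor (Z * (1 + t • matAS n S) * matPS n S) i ∧
      (i < n → todaF z Q t i * leadingMinor (Z * matAS n S * matPS n S) i =
        leadingMinor (Z * matAS n S * (1 + t • matAS n S) * matPS n S) i) := by
  have hcomm : Z * matAS n S * (1 + t • matAS n S) = Z * (1 + t • matAS n S) * matAS n S := by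
    rw [Matrix.mul_assoc, Matrix.mul_assoc]
    congr 1
    exact ((Commute.one_right _).add_right ((Commute.refl _).smul_right t)).eq
  have hone : ∀ i : ℕ, ((-1 : S) ^ i) * (-1) ^ i = 1 := fun i => by
    rw [← pow_add, ← two_mul, pow_mul]; simp
  have e1 : ∀ i, i ≤ n → leadingMinor (Z * matPS n S) i = toep (cornerSeq Z) i :=
    fun i hi => leadingMinor_mul_matPS Z h hi
  have e2 : ∀ i, i ≤ n → leadingMinor (Z * matAS n S * matPS n S) i =
      (-1) ^ i * toep (fun m => cornerSeq Z (m + 1)) i :=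
    fun i hi => leadingMinor_mul_matAS_mul_matPS Z h hi
  have e3 : ∀ i, i ≤ n → leadingMinor (Z * (1 + t • matAS n S) * matPS n S) i =
      toep (fun m => cornerSeq Z m + -t * cornerSeq Z (m + 1)) i := fun i hi => by
    rw [leadingMinor_mul_matPS _ (commute_one_add_smul Z h t) hi]
    congr 1
    funext m
    exact cornerSeq_one_add_smul Z h t m
  have e4 : ∀ i, i ≤ n → leadingMinor (Z * matAS n S * (1 + t • matAS n S) * matPS n S) i =
      (-1) ^ i * toep (fun m => cornerSeq Z (m + 1) + -t * cornerSeq Z (m + 1 + 1)) i :=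
    fun i hi => by
    rw [hcomm, leadingMinor_mul_matAS_mul_matPS _ (commute_one_add_smul Z h t) hi]
    congr 2
    funext m
    exact cornerSeq_one_add_smul Z h t _
  have key := toda_eq_toep z Q n (cornerSeq Z) (-t) (fun i hi => e1 i hi ▸ hs i hi)
    (fun i hi => by
      have := ht i hi
      rw [e2 i hi] at this
      exact isUnit_of_mul_isUnit_right this)
    (fun i hi => by
      have := hz i hi
      rw [e1 _ (by omega), e1 _ (by omega), e2 _ (by omega), e2 _ (by omega), pow_succ] at this
      linear_combination (-1) ^ i * this - (z (i + 1) * (toep (cornerSeq Z) (i + 1) *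
        toep (fun m => cornerSeq Z (m + 1)) i) +
        toep (fun m => cornerSeq Z (m + 1)) (i + 1) * toep (cornerSeq Z) i) * hone i)
    (fun i hi => by
      have := hQ i hi
      rw [e2 _ (by omega), e2 _ (by omega), e2 _ (by omega), pow_succ, pow_succ] at this
      linear_combination this - (Q (i + 1) * toep (fun m => cornerSeq Z (m + 1)) (i + 1) ^ 2 -
        toep (fun m => cornerSeq Z (m + 1)) i * toep (fun m => cornerSeq Z (m + 1)) (i + 2)) *
          hone i)
    i hi
  rw [neg_neg] at key
  rw [e1 i hi, e2 i hi, e3 i hi, e4 i hi]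
  refine ⟨key.1, fun hi' => ?_⟩
  rw [← key.2 hi']
  ring

/-- `F_m^{(i)}(z, Q)`. -/
def todaCoeff {S : Type*} [CommRing S] (z Q : ℕ → S) (i m : ℕ) : S :=
  ∑ J ∈ (Finset.Icc 1 i).powersetCard m,
    (∏ j ∈ J.filter (fun j => j + 1 ∉ J), (1 - Q j)) * ∏ j ∈ J, z j

theorem todaF_eq_sum {S : Type*} [CommRing S] (z Q : ℕ → S) (t : S) (i : ℕ) :
    todaF z Q t i = ∑ m ∈ Finset.range (i + 1), t ^ m * todaCoeff z Q i m := by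
  rw [todaF, Finset.sum_powerset, Nat.card_Icc, Nat.add_sub_cancel]
  refine Finset.sum_congr rfl fun m _ => ?_
  rw [todaCoeff, Finset.mul_sum]
  refine Finset.sum_congr rfl fun J hJ => ?_
  rw [(Finset.mem_powersetCard.1 hJ).2]

theorem map_todaCoeff {S T F : Type*} [CommRing S] [CommRing T] [FunLike F S T]
    [RingHomClass F S T] (f : F) (z Q : ℕ → S) (i m : ℕ) :
    f (todaCoeff z Q i m) = todaCoeff (fun j => f (z j)) (fun j => f (Q j)) i m := by
  simp [todaCoeff]

/-- Q_n = 0 identifies F with K at the top level, and the n-th minor is a full determinant, so det(1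
+ tA) splits off and σ_n cancels. -/
theorem todaF_top (Z : Matrix (Fin n) (Fin n) S) (h : Commute Z (matAS n S))
    (hs : ∀ i, i ≤ n → IsUnit (leadingMinor (Z * matPS n S) i))
    (ht : ∀ i, i ≤ n → IsUnit (leadingMinor (Z * matAS n S * matPS n S) i)) (z Q : ℕ → S) (t : S)
    (hz : ∀ i, i < n → z (i + 1) * (leadingMinor (Z * matPS n S) (i + 1) *
      leadingMinor (Z * matAS n S * matPS n S) i) =
      leadingMinor (Z * matAS n S * matPS n S) (i + 1) * leadingMinor (Z * matPS n S) i)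
    (hQ : ∀ i, i + 1 < n → Q (i + 1) * leadingMinor (Z * matAS n S * matPS n S) (i + 1) ^ 2 =
      leadingMinor (Z * matAS n S * matPS n S) i *
        leadingMinor (Z * matAS n S * matPS n S) (i + 2)) (hQn : Q n = 0) :
    todaF z Q t n = ∑ j ∈ Finset.range (n + 1), t ^ j * algebraMap (RT n) S (elemSym n n j) := by
  have key := (todaF_minors Z h hs ht z Q t hz hQ n le_rfl).1
  have hFK : todaF z Q t n = todaK z Q t n := by
    obtain ⟨m, hm⟩ : ∃ m, n = m + 1 := ⟨n - 1, by have := NeZero.pos n; omega⟩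
    have := todaF_eq_todaK z Q t m (by rw [← hm, hQn])
    rwa [← hm] at this
  rw [hFK, ← det_one_add_smul_matAS]
  apply (hs n le_rfl).mul_right_cancel
  rw [key, leadingMinor_card, leadingMinor_card, det_mul, det_mul, det_mul]
  ring

end TodaMinor

/-! ### The map `Φ` -/

theorem fracZ_mul {n : ℕ} (x y : OZ n) (hy : y ∈ tauSet n) :
    fracZ x y hy * algebraMap (OZ n) (OZo n) y = algebraMap (OZ n) (OZo n) x := by
  rw [fracZ, Localization.mk_eq_mk']
  exact IsLocalization.mk'_spec (OZo n) x ⟨y, hy⟩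

theorem isUnit_algebraMap_OZo {n : ℕ} {y : OZ n} (hy : y ∈ tauSet n) :
    IsUnit (algebraMap (OZ n) (OZo n) y) :=
  IsLocalization.map_units (M := tauSet n) (OZo n) ⟨y, hy⟩

/-- The image of `z_i`. -/
def zImg (n i : ℕ) : OZo n :=
  fracZ (tau n i * sig n (i - 1)) (sig n i * tau n (i - 1))
    (mul_mem (sig_mem n i) (tau_mem n (i - 1)))

/-- The image of `Q_i`, with `Q_n = 0`. -/
def QImg (n i : ℕ) : OZo n :=
  if 1 ≤ i ∧ i ≤ n - 1 then
    fracZ (tau n (i - 1) * tau n (i + 1)) (tau n i ^ 2) (pow_mem (tau_mem n i) 2)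
  else 0

/-- The substitution defining `Φ`. -/
def evalY (n : ℕ) : PolyY n →ₐ[RT n] OZo n :=
  MvPolynomial.aeval (Sum.elim (fun k => zImg n (k + 1)) (fun k => QImg n (k + 1)))

theorem evalY_polyz (n i : ℕ) (h : 1 ≤ i ∧ i ≤ n) : evalY n (polyz n i) = zImg n i := by
  rw [polyz, dif_pos h, evalY, MvPolynomial.aeval_X]
  simp only [Sum.elim_inl]
  congr 1
  omega

theorem evalY_polyQ (n i : ℕ) : evalY n (polyQ n i) = QImg n i := by
  rw [polyQ]
  split_ifs with h
  · rw [evalY, MvPolynomial.aeval_X]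
    simp only [Sum.elim_inr]
    congr 1
    omega
  · rw [QImg, if_neg h, map_zero]

theorem todaCoeff_congr {S : Type*} [CommRing S] {z z' Q : ℕ → S} {i : ℕ}
    (h : ∀ j, 1 ≤ j → j ≤ i → z j = z' j) (m : ℕ) :
    todaCoeff z Q i m = todaCoeff z' Q i m := by
  refine Finset.sum_congr rfl fun J hJ => ?_
  congr 1
  refine Finset.prod_congr rfl fun j hj => ?_
  have := Finset.mem_Icc.1 ((Finset.mem_powersetCard.1 hJ).1 hj)
  exact h j this.1 this.2

theorem evalY_polyF (n i m : ℕ) (hi : i ≤ n) :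
    evalY n (polyF n i m) = todaCoeff (zImg n) (QImg n) i m := by
  have : polyF n i m = todaCoeff (polyz n) (polyQ n) i m := rfl
  rw [this, map_todaCoeff]
  simp only [evalY_polyQ]
  exact todaCoeff_congr (fun j h1 h2 => evalY_polyz n j ⟨h1, h2.trans hi⟩) m

/-- The matrix `Z` over an algebra over `𝒪(𝒵̃)`. -/
theorem commute_map_matZ {n : ℕ} {S : Type*} [CommRing S] [Algebra (RT n) S]
    (f : OZ n →ₐ[RT n] S) : Commute ((matZ n).map f) (matAS n S) := by
  have h := congrArg (fun M => M.map f) (matZ_comm n)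
  simp only [Matrix.map_mul] at h
  have e : (matAZ n).map f = matAS n S := map_matAZ f
  rw [e] at h
  exact h.symm

theorem map_sig {n : ℕ} {S : Type*} [CommRing S] [Algebra (RT n) S]
    (f : OZ n →ₐ[RT n] S) (i : ℕ) :
    f (sig n i) = leadingMinor ((matZ n).map f * matPS n S) i := by
  have h := map_leadingMinor (f : OZ n →+* S) (matZ n * matPZ n) i
  rw [Matrix.map_mul] at h
  have e : (matPZ n).map f = matPS n S := map_matPZ f
  rw [← e]
  exact h

theorem map_tau {n : ℕ} {S : Type*} [CommRing S] [Algebra (RT n) S]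
    (f : OZ n →ₐ[RT n] S) (i : ℕ) :
    f (tau n i) = leadingMinor ((matZ n).map f * matAS n S * matPS n S) i := by
  have h := map_leadingMinor (f : OZ n →+* S) (matZ n * matAZ n * matPZ n) i
  rw [Matrix.map_mul, Matrix.map_mul] at h
  have e : (matPZ n).map f = matPS n S := map_matPZ f
  have e' : (matAZ n).map f = matAS n S := map_matAZ f
  rw [← e, ← e']
  exact h

/-- The localization map, as an algebra homomorphism. -/
def toOZo (n : ℕ) : OZ n →ₐ[RT n] OZo n := IsScalarTower.toAlgHom (RT n) (OZ n) (OZo n)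

theorem zImg_mul (n i : ℕ) : zImg n (i + 1) * (toOZo n (sig n (i + 1)) * toOZo n (tau n i)) =
    toOZo n (tau n (i + 1)) * toOZo n (sig n i) := by
  rw [← map_mul, ← map_mul]
  exact fracZ_mul _ _ _

theorem QImg_mul (n i : ℕ) (hi : i + 1 < n) : QImg n (i + 1) * toOZo n (tau n (i + 1)) ^ 2 =
    toOZo n (tau n i) * toOZo n (tau n (i + 2)) := by
  rw [← map_mul, ← map_pow, QImg, if_pos ⟨by omega, by omega⟩]
  exact fracZ_mul _ _ _

theorem todaCoeff_img (n : ℕ) [NeZero n] (m : ℕ) (hm : m ≤ n) :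
    todaCoeff (zImg n) (QImg n) n m = algebraMap (RT n) (OZo n) (elemSym n n m) := by
  -- The parameter t is taken to be an indeterminate over the localized ring, so that the
  -- coefficients of its powers can be compared.
  let g : OZo n →ₐ[RT n] Polynomial (OZo n) := Polynomial.CAlgHom
  let f : OZ n →ₐ[RT n] Polynomial (OZo n) := g.comp (toOZo n)
  have hu : ∀ y ∈ tauSet n, IsUnit (f y) := fun y hy => (isUnit_algebraMap_OZo hy).map g
  have key := todaF_top ((matZ n).map f) (commute_map_matZ f)
    (fun i _ => map_sig f i ▸ hu _ (sig_mem n i)) (fun i _ => map_tau f i ▸ hu _ (tau_mem n i))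
    (fun j => g (zImg n j)) (fun j => g (QImg n j)) Polynomial.X
    (fun i _ => by
      simp only [← map_sig, ← map_tau, f, AlgHom.comp_apply]
      simpa only [map_mul] using congrArg g (zImg_mul n i))
    (fun i hi => by
      simp only [← map_tau, f, AlgHom.comp_apply]
      simpa only [map_mul, map_pow] using congrArg g (QImg_mul n i hi))
    (by simp only [QImg]; rw [if_neg (by have := NeZero.pos n; omega), map_zero])
  rw [todaF_eq_sum] at key
  simp only [← map_todaCoeff] at key
  have h2 := congrArg (fun p => Polynomial.coeff p m) key
  have h3 : ∀ c : ℕ → OZo n, (∑ j ∈ Finset.range (n + 1), (Polynomial.X : Polynomial (OZo n)) ^ j *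
      Polynomial.C (c j)).coeff m = c m := by
    intro c
    rw [Polynomial.finsetSum_coeff, Finset.sum_eq_single m]
    · simp
    · intro j _ hj
      rw [mul_comm, Polynomial.coeff_C_mul_X_pow, if_neg hj.symm]
    · intro h
      simp at h
      omega
  have h4 := h3 (fun j => todaCoeff (zImg n) (QImg n) n j)
  have h5 := h3 (fun j => algebraMap (RT n) (OZo n) (elemSym n n j))
  rw [← h4, ← h5]
  exact h2

theorem todaF_img (n : ℕ) [NeZero n] (t : OZ n) (i : ℕ) (hi : i < n) :
    todaF (zImg n) (QImg n) (toOZo n t) i * toOZo n (tau n i) =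
      toOZo n (leadingMinor (matZ n * matAZ n * (1 + t • matAZ n) * matPZ n) i) := by
  have hu : ∀ y ∈ tauSet n, IsUnit (toOZo n y) := fun y hy => isUnit_algebraMap_OZo hy
  have key := (todaF_minors ((matZ n).map (toOZo n)) (commute_map_matZ _)
    (fun i _ => map_sig (toOZo n) i ▸ hu _ (sig_mem n i))
    (fun i _ => map_tau (toOZo n) i ▸ hu _ (tau_mem n i))
    (zImg n) (QImg n) (toOZo n t)
    (fun i _ => by
      simp only [← map_sig, ← map_tau]
      exact zImg_mul n i)
    (fun i hi => by
      simp only [← map_tau]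
      exact QImg_mul n i hi) i hi.le).2 hi
  rw [map_tau, key]
  have h := map_leadingMinor (toOZo n : OZ n →+* OZo n)
    (matZ n * matAZ n * (1 + t • matAZ n) * matPZ n) i
  refine Eq.trans ?_ h.symm
  rw [Matrix.map_mul, Matrix.map_mul, Matrix.map_mul]
  have e : (matAZ n).map (toOZo n) = matAS n (OZo n) := map_matAZ _
  have e' : (matPZ n).map (toOZo n) = matPS n (OZo n) := map_matPZ _
  rw [← e, ← e', ← map_one_add_smul]
  rfl

/-- The composite `R(T)[z, Q] → 𝒪(𝒴) → 𝒪(𝒴°)`. -/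
def clsHom (n : ℕ) : PolyY n →ₐ[RT n] OYo n :=
  (IsScalarTower.toAlgHom (RT n) (OY n) (OYo n)).comp (mkY n)

theorem clsHom_apply {n : ℕ} (f : PolyY n) : clsHom n f = clsY f := rfl

/-- The relations of 𝒪(𝒴) hold by `todaCoeff_img`, and the images of the Q_j are units because the
τ_i are inverted in the target. -/
theorem exists_hom_clsY (n : ℕ) [NeZero n] :
    ∃ Φ : OYo n →ₐ[RT n] OZo n, ∀ f, Φ (clsY f) = evalY n f := by
  have h0 : ∀ f ∈ idealY n, evalY n f = 0 := by
    intro f hf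
    refine Submodule.span_induction (p := fun f _ => evalY n f = 0) ?_ (map_zero _)
      (fun x y _ _ hx hy => by rw [map_add, hx, hy, add_zero])
      (fun a x _ hx => by rw [smul_eq_mul, map_mul, hx, mul_zero]) hf
    rintro g ⟨i, _, hi, rfl⟩
    rw [map_sub, evalY_polyF n n i le_rfl, todaCoeff_img n i hi, sub_eq_zero]
    exact (AlgHom.commutes (evalY n) _).symm
  let φ : OY n →ₐ[RT n] OZo n := Ideal.Quotient.liftₐ (idealY n) (evalY n) h0
  have hφ : ∀ f, φ (mkY n f) = evalY n f := fun f => rfl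
  have hunit : ∀ y : Submonoid.closure {q : OY n | ∃ j, 1 ≤ j ∧ j ≤ n - 1 ∧
      q = mkY n (polyQ n j)}, IsUnit (φ y) := by
    have hle : Submonoid.closure {q : OY n | ∃ j, 1 ≤ j ∧ j ≤ n - 1 ∧ q = mkY n (polyQ n j)} ≤
        (IsUnit.submonoid (OZo n)).comap (φ : OY n →* OZo n) := by
      rw [Submonoid.closure_le]
      rintro _ ⟨j, h1, h2, rfl⟩
      change IsUnit (φ (mkY n (polyQ n j)))
      rw [hφ, evalY_polyQ]
      obtain ⟨i, rfl⟩ : ∃ i, j = i + 1 := ⟨j - 1, by omega⟩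
      have h := QImg_mul n i (by omega)
      refine isUnit_of_mul_isUnit_left (y := toOZo n (tau n (i + 1)) ^ 2) ?_
      rw [h]
      exact (isUnit_algebraMap_OZo (tau_mem n _)).mul (isUnit_algebraMap_OZo (tau_mem n _))
    exact fun y => hle y.2
  refine ⟨IsLocalization.liftAlgHom (M := Submonoid.closure {q : OY n | ∃ j, 1 ≤ j ∧ j ≤ n - 1 ∧
      q = mkY n (polyQ n j)}) (f := φ) hunit, fun f => ?_⟩
  rw [← hφ]
  exact IsLocalization.lift_eq _ _

theorem isPhi_of_eval {n : ℕ} {Φ : OYo n →ₐ[RT n] OZo n} (h : ∀ f, Φ (clsY f) = evalY n f) :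
    IsPhi Φ := by
  constructor
  · intro i h1 h2
    rw [h, evalY_polyz n i ⟨h1, h2⟩]
    rfl
  · intro i h1 h2
    rw [h, evalY_polyQ, QImg, if_pos ⟨h1, h2⟩]

/-- Agreement on the variables gives agreement on the polynomial ring; homomorphisms out of a
quotient and out of a localization are determined by their restrictions. -/
theorem IsPhi.unique {n : ℕ} {Φ Φ' : OYo n →ₐ[RT n] OZo n} (h : IsPhi Φ) (h' : IsPhi Φ') :
    Φ' = Φ := by
  have e : (Φ'.comp (clsHom n)) = Φ.comp (clsHom n) := by
    refine MvPolynomial.algHom_ext fun k => ?_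
    rcases k with k | k
    · have hk : (MvPolynomial.X (Sum.inl k) : PolyY n) = polyz n (k.val + 1) := by
        rw [polyz, dif_pos ⟨by omega, by have := k.2; omega⟩]
        rfl
      rw [hk]
      exact (h'.1 _ (by omega) (by have := k.2; omega)).trans
        (h.1 _ (by omega) (by have := k.2; omega)).symm
    · have hk : (MvPolynomial.X (Sum.inr k) : PolyY n) = polyQ n (k.val + 1) := by
        rw [polyQ, dif_pos ⟨by omega, by have := k.2; omega⟩]
        rfl
      rw [hk]
      exact (h'.2 _ (by omega) (by have := k.2; omega)).trans
        (h.2 _ (by omega) (by have := k.2; omega)).symm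
  refine IsLocalization.algHom_ext (Submonoid.closure {q : OY n | ∃ j, 1 ≤ j ∧ j ≤ n - 1 ∧
      q = mkY n (polyQ n j)}) ?_
  ext x
  obtain ⟨f, rfl⟩ := Ideal.Quotient.mkₐ_surjective (RT n) (idealY n) x
  exact DFunLike.congr_fun e f

/-! ### The image of ψ_i as a leading minor -/

theorem one_sub_eta (n i : ℕ) (hi : i ≤ n) :
    1 - eta n (n - i) = expW (wt n ((i + 1 : ℕ) : ZMod n)) := by
  rw [eta, sub_sub_cancel, show n - (n - i) + 1 = i + 1 by omega]

/-- Because 1 - η_{n-i} = e^{a_{i+1}}, ψ_i is the generating function of the F_j^{(i)} at t =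
-e^{a_{i+1}}. -/
theorem evalY_psi (n i : ℕ) (hi : i ≤ n) : evalY n (psi n i) = todaF (zImg n) (QImg n)
    (toOZo n (algebraMap (RT n) (OZ n) (-expW (wt n ((i + 1 : ℕ) : ZMod n))))) i := by
  rw [psi, map_sum, todaF_eq_sum]
  refine Finset.sum_congr rfl fun j _ => ?_
  set c := expW (wt n ((i + 1 : ℕ) : ZMod n))
  have e : (-1) ^ j * MvPolynomial.C (c ^ j) = algebraMap (RT n) (PolyY n) ((-c) ^ j) := by
    change _ = MvPolynomial.C ((-c) ^ j)
    rw [map_pow, map_pow, map_neg, neg_pow (MvPolynomial.C c)]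
  rw [map_mul, evalY_polyF n i j hi, one_sub_eta n i hi, e, AlgHom.commutes, AlgHom.commutes,
    map_pow]

theorem betaSigmaLoc_toOZo {n : ℕ} (x : OZ n) : betaSigmaLoc n (toOZo n x) = betaSigma n x :=
  IsLocalization.lift_eq _ _

/-- As σ(Z) = Z A⁻¹, applying σ absorbs one factor A; the matrices A and P have scalar entries and
are fixed. -/
theorem betaSigma_leadingMinor (n i : ℕ) (c : RT n) :
    betaSigma n (leadingMinor (matZ n * matAZ n *
      (1 + algebraMap (RT n) (OZ n) c • matAZ n) * matPZ n) i) =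
    leadingMinor (betaZ n * (1 + algebraMap (RT n) (Lam n) c • matAS n (Lam n)) *
      matPS n (Lam n)) i := by
  have h := map_leadingMinor (betaSigma n : OZ n →+* Lam n)
    (matZ n * matAZ n * (1 + algebraMap (RT n) (OZ n) c • matAZ n) * matPZ n) i
  refine h.trans ?_
  rw [Matrix.map_mul, Matrix.map_mul]
  congr 2
  · congr 1
    · have e : (matZ n * matAZ n).map (sigmaHom n) = matZ n := by
        rw [Matrix.map_mul, sigmaHom_matZ, map_matAZ]
        change matZ n * (matAZ n)⁻¹ * matAZ n = _
        rw [Matrix.mul_assoc, nonsing_inv_mul _ (isUnit_det_matAZ n), Matrix.mul_one]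
      rw [← beta_matZ]
      nth_rw 2 [← e]
      rw [Matrix.map_map]
      rfl
    · have e : (matAZ n).map (betaSigma n) = matAS n (Lam n) := map_matAZ _
      rw [← e, ← AlgHom.commutes (betaSigma n) c]
      exact map_one_add_smul _ _ _
  · exact map_matPZ (betaSigma n)

theorem PhiTilde_psi_mul {n : ℕ} [NeZero n] {Φ : OYo n →ₐ[RT n] OZo n}
    (h : ∀ f, Φ (clsY f) = evalY n f) (i : ℕ) (hi : i < n) :
    PhiTilde Φ (clsY (psi n i)) * beta n (sig n i) =
      leadingMinor (betaZ n * (1 + algebraMap (RT n) (Lam n)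
        (-expW (wt n ((i + 1 : ℕ) : ZMod n))) • matAS n (Lam n)) * matPS n (Lam n)) i := by
  rw [← betaSigma_leadingMinor, ← betaSigmaLoc_toOZo, ← todaF_img n _ i hi, map_mul,
    betaSigmaLoc_toOZo, PhiTilde, h, evalY_psi n i hi.le]
  congr 1
  change _ = beta n (sigmaHom n (tau n i))
  rw [sigmaHom_tau]

/-! ### Bialternants -/

section Bialternant

variable {K L : Type*} [Field K] [CommRing L] [Algebra K L]

/-- The matrix with rows `ω_k x_k^j` for `j < r` and `x_k^j` for `j ≥ r`. -/
def altMat {N : ℕ} (r : ℕ) (x : Fin N → K) (ω : Fin N → L) : Matrix (Fin N) (Fin N) L :=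
  of fun j k => x k ^ (j : ℕ) • (if j.val < r then ω k else 1)

/-- The quotient of `det (altMat r x ω)` by the Vandermonde determinant. -/
def bialt {N : ℕ} (r : ℕ) (x : Fin N → K) (ω : Fin N → L) : L :=
  (vandermonde x).det⁻¹ • (altMat r x ω).det

theorem bialt_zero {N : ℕ} {x : Fin N → K} (hx : Function.Injective x) (ω : Fin N → L) :
    bialt 0 x ω = 1 := by
  have h1 : altMat 0 x ω = ((vandermonde x).map (algebraMap K L))ᵀ := by
    ext j k
    simp [altMat, vandermonde_apply, Algebra.smul_def]
  have h2 := det_vandermonde_ne_zero_iff.2 hx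
  rw [bialt, h1, det_transpose, ← RingHom.mapMatrix_apply, ← RingHom.map_det, Algebra.smul_def,
    ← map_mul, inv_mul_cancel₀ h2, map_one]

theorem bialt_perm {N : ℕ} (r : ℕ) (x : Fin N → K) (ω : Fin N → L) (σ : Equiv.Perm (Fin N)) :
    bialt r (x ∘ σ) (ω ∘ σ) = bialt r x ω := by
  have h1 : altMat r (x ∘ σ) (ω ∘ σ) = (altMat r x ω).submatrix id σ := by
    ext j k; simp [altMat]
  have h2 : vandermonde (x ∘ σ) = (vandermonde x).submatrix σ id := by
    ext j k; simp [vandermonde_apply]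
  rw [bialt, bialt, h1, h2, det_permute', det_permute]
  rcases Int.units_eq_one_or (Equiv.Perm.sign σ) with h | h <;> simp [h, inv_neg]

theorem det_vandermonde_succ {N : ℕ} (x : Fin (N + 1) → K) :
    (vandermonde x).det = (∏ l, (x (Fin.succ l) - x 0)) * (vandermonde (x ∘ Fin.succ)).det := by
  rw [det_vandermonde, det_vandermonde, Fin.prod_univ_succ, Fin.prod_Ioi_zero]
  congr 1
  refine Finset.prod_congr rfl fun i _ => ?_
  rw [Fin.prod_Ioi_succ]
  rfl

theorem det_vandermonde_succAbove {N : ℕ} (x : Fin (N + 1) → K) (k : Fin (N + 1)) :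
    (vandermonde x).det = (-1) ^ (k : ℕ) * (∏ l, (x (k.succAbove l) - x k)) *
      (vandermonde (x ∘ k.succAbove)).det := by
  have h := det_vandermonde_succ (x ∘ k.cycleRange.symm)
  have h2 : vandermonde (x ∘ k.cycleRange.symm) = (vandermonde x).submatrix k.cycleRange.symm id := by
    ext j k; simp [vandermonde_apply]
  have h3 : (x ∘ k.cycleRange.symm) ∘ Fin.succ = x ∘ k.succAbove := by
    funext l; simp
  rw [h2, det_permute, Equiv.Perm.sign_symm, Fin.sign_cycleRange, h3] at h
  simp only [Function.comp, Fin.cycleRange_symm_succ, Fin.cycleRange_symm_zero] at h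
  have hs : ((-1 : K) ^ (k : ℕ)) * (-1) ^ (k : ℕ) = 1 := by
    rw [← pow_add, ← two_mul, pow_mul]; simp
  rw [mul_assoc, ← h]
  push_cast
  rw [← mul_assoc, hs, one_mul]

/-- Rows 0, …, r all carry ω, so adding multiples of rows 1, …, r to row 0 produces the row q(x_k)
ω_k for any q of degree ≤ r with q(0) = 1. Laplace expansion along it, after pulling a factor x out
of each remaining column, leaves bialternants with r rows. The freedom in q is used in
`rowOp_bialt`. -/
theorem bialt_succ {N : ℕ} (r : ℕ) (hr : r ≤ N) {x : Fin (N + 1) → K} (hx : Function.Injective x)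
    (ω : Fin (N + 1) → L) (q : Polynomial K) (hq : q.natDegree ≤ r) (hq0 : q.coeff 0 = 1) :
    bialt (r + 1) x ω = ∑ k, (q.eval (x k) *
      ∏ l, (x (k.succAbove l) / (x (k.succAbove l) - x k))) •
        (ω k * bialt r (x ∘ k.succAbove) (ω ∘ k.succAbove)) := by
  set c : Fin (N + 1) → L := fun j => algebraMap K L (q.coeff j)
  have h1 : (altMat (r + 1) x ω).det =
      ((altMat (r + 1) x ω).updateRow 0 (∑ j, c j • (altMat (r + 1) x ω) j)).det := by
    rw [det_updateRow_sum]
    simp [c, hq0]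
  have h2 : ∀ k, (∑ j, c j • (altMat (r + 1) x ω) j) k = q.eval (x k) • ω k := by
    intro k
    rw [Finset.sum_apply, Polynomial.eval_eq_sum_range' (n := N + 1) (by omega), Finset.sum_smul,
      Finset.sum_range]
    refine Finset.sum_congr rfl fun j _ => ?_
    simp only [Pi.smul_apply, c, altMat, of_apply, smul_eq_mul]
    by_cases hj : j.val < r + 1
    · rw [if_pos hj, ← Algebra.smul_def, smul_smul]
    · rw [Polynomial.coeff_eq_zero_of_natDegree_lt (by omega)]
      simp
  have h3 : ∀ k : Fin (N + 1), (((altMat (r + 1) x ω).updateRow 0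
      (∑ j, c j • (altMat (r + 1) x ω) j)).submatrix Fin.succ k.succAbove).det =
      (∏ l, x (k.succAbove l)) • (altMat r (x ∘ k.succAbove) (ω ∘ k.succAbove)).det := by
    intro k
    have : ((altMat (r + 1) x ω).updateRow 0
      (∑ j, c j • (altMat (r + 1) x ω) j)).submatrix Fin.succ k.succAbove =
      of fun j l => algebraMap K L (x (k.succAbove l)) *
        altMat r (x ∘ k.succAbove) (ω ∘ k.succAbove) j l := by
      ext j l
      rw [submatrix_apply, updateRow_ne (Fin.succ_ne_zero j)]
      simp only [altMat, of_apply, Fin.val_succ, add_lt_add_iff_right, Function.comp,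
        ← Algebra.smul_def, smul_smul, pow_succ']
    rw [this, det_mul_row, ← map_prod, ← Algebra.smul_def]
  rw [bialt, h1.trans (det_succ_row_zero _), Finset.smul_sum]
  refine Finset.sum_congr rfl fun k _ => ?_
  have hne : ∏ l, (x (k.succAbove l) - x k) ≠ 0 :=
    Finset.prod_ne_zero_iff.2 fun l _ => sub_ne_zero.2 fun h => Fin.succAbove_ne k l (hx h)
  have hV : (vandermonde (x ∘ k.succAbove)).det ≠ 0 :=
    det_vandermonde_ne_zero_iff.2 (hx.comp Fin.succAbove_right_injective)
  rw [updateRow_self, h2, h3, bialt, det_vandermonde_succAbove x k, Finset.prod_div_distrib]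
  have hs : ((-1 : L) ^ (k : ℕ)) = algebraMap K L ((-1) ^ (k : ℕ)) := by simp
  rw [hs, ← Algebra.smul_def]
  simp only [mul_smul_comm, smul_mul_assoc, smul_smul]
  congr 1
  have hs2 : ((-1 : K) ^ (k : ℕ)) ≠ 0 := by simp
  field_simp

/-- The factor 1 - x_k/x_0 kills the first i entries of column 0; row operations kill those below
row i. Expanding along this column removes the point x_0, and the factors x_l - x_0 pulled out of
the other columns make up the quotient of the two Vandermonde determinants. -/
theorem bialt_insert {N : ℕ} (i : ℕ) (hi : i ≤ N) {x : Fin (N + 1) → K}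
    (hx : Function.Injective x) (hx0 : x 0 ≠ 0) (ω : Fin (N + 1) → L) :
    (altMat i x (fun k => (1 - x k / x 0) • ω k)).det =
      (vandermonde x).det • bialt i (x ∘ Fin.succ) (ω ∘ Fin.succ) := by
  have hV : (vandermonde (x ∘ Fin.succ)).det ≠ 0 :=
    det_vandermonde_ne_zero_iff.2 (hx.comp (Fin.succ_injective N))
  -- Only rows of index greater than i are modified: from each, x_0 times the preceding row is
  -- subtracted.
  let B : Matrix (Fin (N + 1)) (Fin (N + 1)) L := of (Fin.cons (altMat i x
    (fun k => (1 - x k / x 0) • ω k) 0) fun j k => altMat i x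
      (fun k => (1 - x k / x 0) • ω k) j.succ k -
        (if i ≤ j.val then algebraMap K L (x 0) else 0) *
          altMat i x (fun k => (1 - x k / x 0) • ω k) j.castSucc k)
  have h1 : (altMat i x (fun k => (1 - x k / x 0) • ω k)).det = B.det := by
    refine det_eq_of_forall_row_eq_smul_add_pred
      (fun j => if i ≤ j.val then algebraMap K L (x 0) else 0) ?_ ?_
    · intro k; rfl
    · intro j k
      simp [B]
  have hB1 : ∀ (j : Fin (N + 1)) k, j.val < i → B j k = (x k ^ j.val * (1 - x k / x 0)) • ω k := by
    intro j k hj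
    refine Fin.cases (fun hj => ?_) (fun j hj => ?_) j hj
    · simp only [B, of_apply, Fin.cons_zero, altMat]
      rw [if_pos hj, smul_smul]
    · simp only [B, of_apply, Fin.cons_succ, altMat]
      rw [if_pos hj, if_neg (by simp at hj; omega), smul_smul, zero_mul, sub_zero]
  have hB2 : ∀ (j : Fin (N + 1)) k, j.val = i → B j k = algebraMap K L (x k ^ i) := by
    intro j k hj
    refine Fin.cases (fun hj => ?_) (fun j hj => ?_) j hj
    · simp only [B, of_apply, Fin.cons_zero, altMat]
      rw [if_neg (by omega), hj, Algebra.smul_def, mul_one]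
    · simp only [B, of_apply, Fin.cons_succ, altMat]
      rw [if_neg (by omega), if_neg (by simp at hj; omega), zero_mul, sub_zero, hj,
        Algebra.smul_def, mul_one]
  have hB3 : ∀ (j : Fin N) k, i ≤ j.val → B j.succ k = algebraMap K L (x k ^ j.val * (x k - x 0)) := by
    intro j k hj
    simp only [B, of_apply, Fin.cons_succ, altMat]
    rw [if_neg (by simp; omega), if_pos hj, if_neg (by simp; omega), Algebra.smul_def,
      Algebra.smul_def, mul_one, mul_one, ← map_mul, ← map_sub, Fin.val_succ, Fin.val_castSucc]
    congr 1
    ring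
  let p : Fin (N + 1) := ⟨i, by omega⟩
  have h2 : (B.submatrix p.succAbove Fin.succ) = of fun (j l : Fin N) =>
      algebraMap K L (if j.val < i then -(x 0)⁻¹ else 1) *
        (of fun (j l : Fin N) => algebraMap K L (x l.succ - x 0) *
          altMat i (x ∘ Fin.succ) (ω ∘ Fin.succ) j l) j l := by
    ext j l
    simp only [submatrix_apply, of_apply, altMat, Function.comp]
    by_cases hj : j.val < i
    · have : p.succAbove j = j.castSucc := Fin.succAbove_of_castSucc_lt _ _ (by
        rw [Fin.lt_def]; exact hj)
      rw [this, hB1 _ _ hj, if_pos hj, if_pos hj, ← Algebra.smul_def, ← Algebra.smul_def, smul_smul,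
        smul_smul, Fin.val_castSucc]
      congr 1
      field_simp
      ring
    · have : p.succAbove j = j.succ := Fin.succAbove_of_le_castSucc _ _ (by
        rw [Fin.le_def]; exact not_lt.1 hj)
      rw [this, hB3 _ _ (not_lt.1 hj), if_neg hj, if_neg hj, map_one, one_mul, Algebra.smul_def,
        mul_one, ← map_mul, mul_comm]
  have h3 : ∏ j : Fin N, (if j.val < i then -(x 0)⁻¹ else 1) = (-(x 0)⁻¹) ^ i := by
    rw [Finset.prod_ite, Finset.prod_const_one, mul_one, Finset.prod_const]
    congr 1
    rw [Fin.card_filter_val_lt]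
    omega
  rw [h1, det_succ_column_zero, Finset.sum_eq_single p]
  · rw [hB2 p 0 rfl, h2, det_mul_column, det_mul_row, ← map_prod, ← map_prod, h3,
      det_vandermonde_succ, bialt, smul_smul, mul_assoc (∏ l, _), mul_inv_cancel₀ hV, mul_one,
      ← mul_assoc, ← mul_assoc]
    have hs : ((-1 : L) ^ (p : ℕ)) = algebraMap K L ((-1) ^ i) := by simp [p]
    rw [hs, ← map_mul, ← map_mul, ← map_mul, ← Algebra.smul_def, ← mul_pow, ← mul_pow]
    -- The Laplace sign, the pivot x_0^i and the i scalars -1/x_0 taken out of the rows cancel.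
    have : -1 * x 0 * -(x 0)⁻¹ = 1 := by field_simp
    rw [this]
    simp
  · intro j _ hj
    rcases lt_trichotomy j.val i with h | h | h
    · rw [hB1 _ _ h, div_self hx0]
      simp
    · exact absurd (Fin.ext h) hj
    · obtain ⟨j, rfl⟩ := Fin.exists_succ_eq.2 (show j ≠ 0 by rintro rfl; simp at h)
      rw [hB3 j 0 (by simp at h; omega)]
      simp
  · simp

end Bialternant

/-! ### Diagonalization of the centralizer family -/

section Diagonalization

/-- `-e^{-a_i}`. -/
def xi {n : ℕ} (i : ZMod n) : KT n := -expK (-wt n i)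

theorem xi_injective {n : ℕ} : Function.Injective (xi : ZMod n → KT n) := fun _ _ h =>
  expK_neg_wt_injective (neg_injective h)

theorem expK_ne_zero {n : ℕ} (μ : Weight n) : expK μ ≠ 0 := by
  have h : expK μ * expK (-μ) = 1 := by rw [← expK_add, add_neg_cancel, expK_zero]
  exact left_ne_zero_of_mul_eq_one h

theorem xi_ne_zero {n : ℕ} (i : ZMod n) : xi i ≠ 0 := neg_ne_zero.2 (expK_ne_zero _)

theorem ix_injective {n : ℕ} : Function.Injective (ix : Fin n → ZMod n) := by
  intro a b h
  simp only [ix, Nat.cast_add, Nat.cast_one] at h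
  have h' := add_right_cancel h
  rw [ZMod.natCast_eq_natCast_iff', Nat.mod_eq_of_lt a.2, Nat.mod_eq_of_lt b.2] at h'
  exact Fin.ext h'

/-- Completing the first i rows of M by rows of the identity gives a matrix whose determinant is the
leading minor; it is then multiplied by V. -/
theorem leadingMinor_mul_det {n : ℕ} {R : Type*} [CommRing R] (M V : Matrix (Fin n) (Fin n) R)
    (i : ℕ) : leadingMinor M i * V.det =
      (of fun a k : Fin n => if a.val < i then (M * V) a k else V a k).det := by
  let M' : Matrix (Fin n) (Fin n) R := of fun a b => if a.val < i then M a b else (1 : Matrix _ _ R) a b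
  have h1 : M' * V = of fun a k : Fin n => if a.val < i then (M * V) a k else V a k := by
    ext a k
    rw [mul_apply]
    by_cases ha : a.val < i
    · simp [M', ha, mul_apply]
    · simp [M', ha, one_apply]
  have h2 : M'.det = leadingMinor M i := by
    rw [twoBlockTriangular_det M' (fun r => r.val < i)]
    · have e1 : toSquareBlockProp M' (fun r => r.val < i) =
          M.submatrix (Subtype.val : {r : Fin n // r.val < i} → Fin n) Subtype.val := by
        ext a b
        simp [toSquareBlockProp, M', a.2]
      have e2 : toSquareBlockProp M' (fun r => ¬ r.val < i) = 1 := by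
        ext a b
        have ha := a.2
        simp only [toSquareBlockProp, M', toBlock_apply, of_apply, if_neg ha, one_apply,
          Subtype.ext_iff]
      rw [e1, e2, det_one, mul_one, leadingMinor]
    · intro a ha b hb
      have : a ≠ b := fun h => ha (h ▸ hb)
      simp [M', ha, one_apply_ne this]
  rw [← h1, det_mul, h2]

variable {n : ℕ}

/-- The eigenvectors of `A`. -/
def eigG (n : ℕ) : Matrix (Fin n) (Fin n) (Lam n) := of fun j k =>
  algebraMap (KT n) (Lam n) (∏ l ∈ Finset.range j.val, (xi (ix k) - xi ((l + 1 : ℕ) : ZMod n)))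

theorem algebraMap_expW_Lam (i : ZMod n) :
    algebraMap (RT n) (Lam n) (expW (-wt n i)) = -algebraMap (KT n) (Lam n) (xi i) := by
  rw [IsScalarTower.algebraMap_apply (RT n) (KT n) (Lam n), xi, map_neg, neg_neg]
  rfl

theorem matAS_mulVec (v : Fin n → Lam n) (j : Fin n) :
    (matAS n (Lam n)).mulVec v j = -algebraMap (KT n) (Lam n) (xi (ix j)) * v j -
      (if h : j.val + 1 < n then v ⟨j.val + 1, h⟩ else 0) := by
  have h := sum_matA_left (S := Lam n) v j
  rw [algebraMap_expW_Lam] at h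
  exact h

/-- The eigenvalue equation is the recursion that defines the products. In the last row it holds
because the product over all n points contains a zero factor. -/
theorem matAS_mul_eigG : matAS n (Lam n) * eigG n =
    eigG n * diagonal fun k => -algebraMap (KT n) (Lam n) (xi (ix k)) := by
  ext1 j k
  rw [mul_diagonal]
  refine (matAS_mulVec (fun j => eigG n j k) j).trans ?_
  split_ifs with h
  · simp only [eigG, of_apply, Finset.prod_range_succ, map_mul, map_sub, ix]
    ring
  · have hj : j.val + 1 = n := by have := j.2; omega
    have h0 : ∏ l ∈ Finset.range (j.val + 1), (xi (ix k) - xi ((l + 1 : ℕ) : ZMod n)) = 0 :=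
      Finset.prod_eq_zero (Finset.mem_range.2 (by omega)) (sub_self _)
    rw [Finset.prod_range_succ] at h0
    have h1 := congrArg (algebraMap (KT n) (Lam n)) h0
    rw [map_mul, map_sub, map_zero] at h1
    simp only [eigG, of_apply]
    change algebraMap (KT n) (Lam n) _ * (_ - algebraMap (KT n) (Lam n) (xi (ix j))) = 0 at h1
    linear_combination h1

/-- The same recursion determines an eigenvector from its first entry, so no division is needed over
the ring of power series. -/
theorem eigenvector_matAS [NeZero n] (v : Fin n → Lam n) (k : Fin n)
    (hv : (matAS n (Lam n)).mulVec v = -algebraMap (KT n) (Lam n) (xi (ix k)) • v) (j : Fin n) :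
    v j = v 0 * eigG n j k := by
  obtain ⟨j, hj⟩ := j
  induction j with
  | zero =>
    have : (⟨0, hj⟩ : Fin n) = 0 := rfl
    simp [eigG, this]
  | succ j ih =>
    have h := congrFun hv ⟨j, by omega⟩
    rw [matAS_mulVec, dif_pos hj, Pi.smul_apply, smul_eq_mul, ih (by omega)] at h
    simp only [eigG, of_apply, Finset.prod_range_succ, map_mul, map_sub, ix] at h ⊢
    linear_combination -h

/-- The matrix commutes with A, so it preserves the eigenlines. Both factors are upper triangular,
so the multiplier is read off from the k-th entry of the k-th eigenvector, which is a unit. -/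
theorem betaZ_mul_eigG [NeZero n] :
    betaZ n * eigG n = eigG n * diagonal fun k => Om (ix k) := by
  ext1 j k
  rw [mul_diagonal]
  have hev : (matAS n (Lam n)).mulVec (fun j => (betaZ n * eigG n) j k) =
      -algebraMap (KT n) (Lam n) (xi (ix k)) • fun j => (betaZ n * eigG n) j k := by
    have h : matAS n (Lam n) * (betaZ n * eigG n) =
        (betaZ n * eigG n) * diagonal fun k => -algebraMap (KT n) (Lam n) (xi (ix k)) := by
      rw [← Matrix.mul_assoc, matAS, betaZ_comm, Matrix.mul_assoc, ← matAS, matAS_mul_eigG,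
        Matrix.mul_assoc]
    funext j
    have h' := congrFun (congrFun h j) k
    rw [mul_diagonal] at h'
    refine Eq.trans ?_ (h'.trans ?_)
    · rw [mul_apply]; rfl
    · simp [mul_comm]
  have h1 := eigenvector_matAS _ k hev
  have h2 : (betaZ n * eigG n) k k = Om (ix k) * eigG n k k := by
    rw [mul_apply, Finset.sum_eq_single k, betaZ_diag]
    · intro b _ hb
      rcases lt_or_gt_of_ne hb with h | h
      · rw [betaZ_lower h, zero_mul]
      · have : eigG n b k = 0 := by
          rw [eigG, of_apply, Finset.prod_eq_zero (Finset.mem_range.2 h) (sub_self _), map_zero]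
        rw [this, mul_zero]
    · simp
  have h3 : (betaZ n * eigG n) 0 k = Om (ix k) := by
    have h4 := h1 k
    rw [h2] at h4
    have hne : ∏ l ∈ Finset.range k.val, (xi (ix k) - xi ((l + 1 : ℕ) : ZMod n)) ≠ 0 := by
      refine Finset.prod_ne_zero_iff.2 fun l hl => sub_ne_zero.2 fun h => ?_
      have hl' := Finset.mem_range.1 hl
      have := @ix_injective n k ⟨l, by omega⟩ (xi_injective h)
      have := congrArg Fin.val this
      simp at this
      omega
    have hu : IsUnit (eigG n k k) := (isUnit_iff_ne_zero.2 hne).map (algebraMap (KT n) (Lam n))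
    exact (hu.mul_right_cancel h4).symm
  have h5 := h1 j
  rw [h5, h3, mul_comm]

/-- The eigenvectors have first entry 1 and eigenvalue x_k for -A, so L sends their matrix to a
transposed Vandermonde matrix. -/
theorem matL_mul_eigG [NeZero n] : matL n (Lam n) * eigG n =
    of fun a k : Fin n => algebraMap (KT n) (Lam n) (xi (ix k) ^ a.val) := by
  have h : ∀ a : ℕ, (-matAS n (Lam n)) ^ a * eigG n =
      eigG n * diagonal fun k => algebraMap (KT n) (Lam n) (xi (ix k) ^ a) := by
    intro a
    induction a with
    | zero => simp
    | succ a ih =>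
      rw [pow_succ, Matrix.mul_assoc, Matrix.neg_mul, matAS_mul_eigG, ← Matrix.mul_neg,
        ← Matrix.mul_assoc, ih, Matrix.mul_assoc, diagonal_neg, diagonal_mul_diagonal]
      congr 2
      funext k
      simp [pow_succ]
  ext1 a k
  have := congrFun (congrFun (h a.val) 0) k
  rw [mul_diagonal] at this
  refine Eq.trans ?_ (this.trans ?_)
  · rw [mul_apply, mul_apply]; rfl
  · simp [eigG]

/-- Let V be the Vandermonde matrix L G, G the eigenvector matrix. Then P V = G, so L W P acts on V
by scaling its columns with the eigenvalues of W. The leading minor times det V therefore has the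
scaled rows on top and the rows of V below. -/
theorem leadingMinor_eq_bialt [NeZero n] (i : ℕ) (c : RT n) :
    leadingMinor (betaZ n * (1 + algebraMap (RT n) (Lam n) c • matAS n (Lam n)) *
      matPS n (Lam n)) i = bialt i (fun k : Fin n => xi (ix k))
        (fun k => (1 - algebraMap (RT n) (KT n) c * xi (ix k)) • Om (ix k)) := by
  set W := betaZ n * (1 + algebraMap (RT n) (Lam n) c • matAS n (Lam n)) with hW
  set V : Matrix (Fin n) (Fin n) (Lam n) :=
    of fun a k : Fin n => algebraMap (KT n) (Lam n) (xi (ix k) ^ a.val) with hV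
  have h1 : W * eigG n = eigG n * diagonal fun k =>
      algebraMap (KT n) (Lam n) (1 - algebraMap (RT n) (KT n) c * xi (ix k)) * Om (ix k) := by
    rw [hW, Matrix.mul_assoc, Matrix.add_mul, Matrix.one_mul, smul_mul_assoc, matAS_mul_eigG,
      Matrix.mul_add, Matrix.mul_smul, ← Matrix.mul_assoc, betaZ_mul_eigG]
    ext1 j k
    simp only [Matrix.add_apply, Matrix.smul_apply, mul_diagonal, map_sub, map_one, map_mul,
      ← IsScalarTower.algebraMap_apply (RT n) (KT n) (Lam n), smul_eq_mul]
    ring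
  have h2 : matL n (Lam n) * (W * matPS n (Lam n)) * V = V * diagonal fun k =>
      algebraMap (KT n) (Lam n) (1 - algebraMap (RT n) (KT n) c * xi (ix k)) * Om (ix k) := by
    rw [hV, ← matL_mul_eigG, Matrix.mul_assoc, Matrix.mul_assoc,
      ← Matrix.mul_assoc (matPS n (Lam n)), matPS_mul_matL, Matrix.one_mul, h1, Matrix.mul_assoc]
  have h3 := leadingMinor_mul_det (matL n (Lam n) * (W * matPS n (Lam n))) V i
  rw [leadingMinor_matL_mul, h2] at h3
  have h4 : (of fun a k : Fin n => if a.val < i then (V * diagonal (fun k =>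
      algebraMap (KT n) (Lam n) (1 - algebraMap (RT n) (KT n) c * xi (ix k)) * Om (ix k)) :
        Matrix (Fin n) (Fin n) (Lam n)) a k else V a k) = altMat i (fun k : Fin n => xi (ix k))
        (fun k => (1 - algebraMap (RT n) (KT n) c * xi (ix k)) • Om (ix k)) := by
    ext1 a k
    simp only [altMat, of_apply, mul_diagonal, hV, Algebra.smul_def]
    split_ifs <;> simp
  have h5 : V.det = algebraMap (KT n) (Lam n) (vandermonde fun k : Fin n => xi (ix k)).det := by
    rw [RingHom.map_det, ← det_transpose]
    rfl
  rw [h4, h5, mul_comm, ← Algebra.smul_def] at h3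
  rw [bialt, ← h3, smul_smul, inv_mul_cancel₀, one_smul]
  exact det_vandermonde_ne_zero_iff.2 (xi_injective.comp ix_injective)

theorem leadingMinor_eq_bialt_tail {N : ℕ} (i : ℕ) (hi : i ≤ N) :
    leadingMinor (betaZ (N + 1) * (1 + algebraMap (RT (N + 1)) (Lam (N + 1))
      (-expW (wt (N + 1) ((i + 1 : ℕ) : ZMod (N + 1)))) • matAS (N + 1) (Lam (N + 1))) *
        matPS (N + 1) (Lam (N + 1))) i =
      bialt i (fun l : Fin N => xi ((i + 2 + l.val : ℕ) : ZMod (N + 1)))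
        (fun l => Om ((i + 2 + l.val : ℕ) : ZMod (N + 1))) := by
  -- A cyclic rotation of the points that puts index i + 1 first, where `bialt_insert` expects the
  -- point to be removed.
  let σ : Equiv.Perm (Fin (N + 1)) := Equiv.addRight (Fin.ofNat (N + 1) i)
  have hσ : ∀ l, ix (σ l) = ((i + 1 + l.val : ℕ) : ZMod (N + 1)) := by
    intro l
    simp only [σ, Equiv.coe_addRight, ix, Fin.val_add, Fin.val_ofNat, Nat.cast_add,
      ZMod.natCast_mod]
    ring
  set x : Fin (N + 1) → KT (N + 1) := fun l => xi ((i + 1 + l.val : ℕ) : ZMod (N + 1)) with hx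
  have hxinj : Function.Injective x := by
    have : x = xi ∘ ix ∘ σ := funext fun l => by simp only [Function.comp, hσ, hx]
    rw [this]
    exact xi_injective.comp (ix_injective.comp σ.injective)
  have h1 := bialt_insert i hi hxinj (xi_ne_zero _)
    (fun l : Fin (N + 1) => (Om ((i + 1 + l.val : ℕ) : ZMod (N + 1)) : Lam (N + 1)))
  rw [leadingMinor_eq_bialt, ← bialt_perm _ _ _ σ]
  have e1 : (fun k : Fin (N + 1) => xi (ix k)) ∘ σ = x :=
    funext fun l => by simp only [Function.comp, hσ, hx]
  have e2 : (fun k : Fin (N + 1) => (1 - algebraMap (RT (N + 1)) (KT (N + 1))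
      (-expW (wt (N + 1) ((i + 1 : ℕ) : ZMod (N + 1)))) * xi (ix k)) • (Om (ix k) : Lam (N + 1))) ∘ σ =
      fun l => (1 - x l / x 0) • Om ((i + 1 + l.val : ℕ) : ZMod (N + 1)) := by
    funext l
    have h0 : x 0 = -expK (-wt (N + 1) ((i + 1 : ℕ) : ZMod (N + 1))) := rfl
    have h2 : expK (wt (N + 1) ((i + 1 : ℕ) : ZMod (N + 1))) *
        expK (-wt (N + 1) ((i + 1 : ℕ) : ZMod (N + 1))) = 1 := by
      rw [← expK_add, add_neg_cancel, expK_zero]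
    have h3 : x 0 ≠ 0 := xi_ne_zero _
    -- The scalar -e^{a_{i+1}} is the inverse of the first point; this is what makes ω vanish there.
    have h4 : algebraMap (RT (N + 1)) (KT (N + 1))
      (-expW (wt (N + 1) ((i + 1 : ℕ) : ZMod (N + 1)))) = (x 0)⁻¹ := by
      apply eq_inv_of_mul_eq_one_left
      rw [h0, map_neg]
      change -expK _ * _ = 1
      rw [neg_mul_neg, h2]
    simp only [Function.comp, hσ, h4, hx]
    rw [div_eq_inv_mul]
  rw [e1, e2, bialt, h1, smul_smul, inv_mul_cancel₀ (det_vandermonde_ne_zero_iff.2 hxinj), one_smul]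
  congr 1
  · funext l
    simp only [Function.comp, hx, Fin.val_succ]
    congr 2; ring
  · funext l
    simp only [Function.comp, Fin.val_succ]
    congr 2; ring

end Diagonalization

/-! ### Composition of permutation actions -/

theorem permW_mul {n : ℕ} (σ τ : Equiv.Perm (ZMod n)) (μ : Weight n) :
    permW (σ * τ) μ = permW σ (permW τ μ) := by
  induction μ using QuotientAddGroup.induction_on with
  | H v => rfl

theorem permR_mul {n : ℕ} (σ τ : Equiv.Perm (ZMod n)) (f : RT n) :
    permR (σ * τ) f = permR σ (permR τ f) := by
  have h : (permR (σ * τ) : RT n →+* RT n) = (permR σ : RT n →+* RT n).comp (permR τ) := by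
    refine AddMonoidAlgebra.ringHom_ext ?_ ?_
    · intro r
      let F : ℤ →+* RT n := AddMonoidAlgebra.singleZeroRingHom
      exact RingHom.congr_fun (Subsingleton.elim ((permR (σ * τ) : RT n →+* RT n).comp F)
        (((permR σ : RT n →+* RT n).comp (permR τ)).comp F)) r
    · intro μ
      change permR (σ * τ) (expW μ) = permR σ (permR τ (expW μ))
      rw [permR_expW, permR_expW, permR_expW, permW_mul]
  exact RingHom.congr_fun h f

theorem permK_mul {n : ℕ} (σ τ : Equiv.Perm (ZMod n)) (f : KT n) :
    permK (σ * τ) f = permK σ (permK τ f) := by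
  have h : (permK (σ * τ) : KT n →+* KT n) = (permK σ : KT n →+* KT n).comp (permK τ) := by
    refine IsLocalization.ringHom_ext (nonZeroDivisors (RT n)) ?_
    ext r
    simp [permK, permR_mul]
  exact RingHom.congr_fun h f

theorem permL_mul {n : ℕ} (σ τ : Equiv.Perm (ZMod n)) (f : Lam n) :
    permL (σ * τ) f = permL σ (permL τ f) := by
  ext d
  simp [permL, permK_mul]

theorem permK_xi {n : ℕ} (σ : Equiv.Perm (ZMod n)) (i : ZMod n) : permK σ (xi i) = xi (σ i) := by
  rw [xi, map_neg, permK_expK, map_neg, permW_wt, xi]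

theorem permL_bialt {n N : ℕ} (σ : Equiv.Perm (ZMod n)) (r : ℕ) (e : Fin N → ZMod n) :
    permL σ (bialt r (fun l => xi (e l)) (fun l => (Om (e l) : Lam n))) =
      bialt r (fun l => xi (σ (e l))) (fun l => Om (σ (e l))) := by
  rw [bialt, bialt, permL_smul, map_inv₀]
  have h1 : permK σ (vandermonde fun l => xi (e l)).det = (vandermonde fun l => xi (σ (e l))).det := by
    have := RingHom.map_det (permK σ : KT n →+* KT n) (vandermonde fun l => xi (e l))
    refine this.trans ?_
    congr 1
    ext a b
    simp [vandermonde_apply, permK_xi]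
  have h2 : permL σ (altMat r (fun l => xi (e l)) (fun l => (Om (e l) : Lam n))).det =
      (altMat r (fun l => xi (σ (e l))) (fun l => (Om (σ (e l)) : Lam n))).det := by
    rw [RingHom.map_det]
    congr 1
    ext1 a b
    simp only [RingHom.mapMatrix_apply, map_apply, altMat, of_apply, permL_smul, map_pow, permK_xi]
    split_ifs <;> simp [permL_Om]
  rw [h1, h2]

/-! ### Demazure operators -/

/-- The isobaric divided difference operator exchanging the indices `u` and `v`. -/
def dem {n : ℕ} (u v : ZMod n) (f : Lam n) : Lam n :=
  (xi u / (xi u - xi v)) • permL (Equiv.swap u v) f + (xi v / (xi v - xi u)) • f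

theorem dem_add {n : ℕ} (u v : ZMod n) (f g : Lam n) :
    dem u v (f + g) = dem u v f + dem u v g := by
  simp only [dem, map_add, smul_add]
  abel

theorem dem_zero {n : ℕ} (u v : ZMod n) : dem u v (0 : Lam n) = 0 := by
  simp [dem]

theorem dem_sum {n : ℕ} (u v : ZMod n) {ι : Type*} (s : Finset ι) (f : ι → Lam n) :
    dem u v (∑ k ∈ s, f k) = ∑ k ∈ s, dem u v (f k) :=
  map_sum (⟨⟨dem u v, dem_zero u v⟩, dem_add u v⟩ : Lam n →+ Lam n) f s

/-- From x_u e^{a_u - a_v} = x_v: the operator is D_i with its reflection acting as a plain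
exchange, without the twist present in s_0. -/
theorem dem_eq {n : ℕ} {u v : ZMod n} (huv : u ≠ v) (f : Lam n) :
    dem u v f = (1 - expK (wt n u - wt n v))⁻¹ • (permL (Equiv.swap u v) f - f) + f := by
  have h1 : xi u * expK (wt n u - wt n v) = xi v := by
    rw [xi, neg_mul, ← expK_add, xi]
    congr 2
    abel
  have h2 : xi u ≠ xi v := fun h => huv (xi_injective h)
  have h3 := xi_ne_zero u
  have h4 : (1 - expK (wt n u - wt n v))⁻¹ = xi u / (xi u - xi v) := by
    rw [← h1, ← mul_one_sub, div_mul_cancel_left₀ h3]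
  have h5 : xi v / (xi v - xi u) = 1 - xi u / (xi u - xi v) := by
    have := sub_ne_zero.2 h2
    have := sub_ne_zero.2 h2.symm
    field_simp
    ring
  rw [h4, dem, h5, sub_smul, smul_sub, one_smul]
  abel

/-- The composite `dem_{c+N-1} ⋯ dem_{c+1} dem_c`, for a sequence `e` of indices. -/
def rowOp {n : ℕ} (e : ℕ → ZMod n) (c : ℕ) : ℕ → Lam n → Lam n
  | 0, f => f
  | N + 1, f => dem (e (c + N)) (e (c + N + 1)) (rowOp e c N f)

/-- Here u k stands for the input with its distinguished point moved to position c + k. Each new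
operator creates one new position from the last one and, on the older ones, merges two terms with
the same u k. -/
theorem rowOp_eq_sum {n : ℕ} {e : ℕ → ZMod n} {m : ℕ} (he : Set.InjOn e (Set.Iio m)) (c N : ℕ)
    (hN : c + N < m) (u : ℕ → Lam n)
    (hu : ∀ k, k < N → permL (Equiv.swap (e (c + k)) (e (c + k + 1))) (u k) = u (k + 1))
    (hu' : ∀ k t, k < t → t < N → permL (Equiv.swap (e (c + t)) (e (c + t + 1))) (u k) = u k) :
    rowOp e c N (u 0) = ∑ k ∈ Finset.range (N + 1), (∏ l ∈ (Finset.range (N + 1)).erase k,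
      (xi (e (c + l)) / (xi (e (c + l)) - xi (e (c + k))))) • u k := by
  have hne : ∀ a b, a < m → b < m → a ≠ b → e a ≠ e b := fun a b ha hb hab h => hab (he ha hb h)
  induction N with
  | zero => simp [rowOp]
  | succ N ih =>
    have ih := ih (by omega) (fun k hk => hu k (by omega)) (fun k t h1 h2 => hu' k t h1 (by omega))
    set x : ℕ → KT n := fun l => xi (e (c + l)) with hx
    have hxne : ∀ a b, a ≤ N + 1 → b ≤ N + 1 → a ≠ b → x a - x b ≠ 0 := fun a b ha hb hab =>
      sub_ne_zero.2 fun h => hne (c + a) (c + b) (by omega) (by omega) (by omega) (xi_injective h)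
    set s := Equiv.swap (e (c + N)) (e (c + N + 1)) with hs
    have hsx : ∀ l, l < N → permK s (x l) = x l := fun l hl => by
      rw [hx, permK_xi, hs, Equiv.swap_apply_of_ne_of_ne]
      · exact hne _ _ (by omega) (by omega) (by omega)
      · exact hne _ _ (by omega) (by omega) (by omega)
    have hsN : permK s (x N) = x (N + 1) := by rw [hx, permK_xi, hs, Equiv.swap_apply_left]; rfl
    have hd : ∀ (a : KT n) (f : Lam n), dem (e (c + N)) (e (c + N + 1)) (a • f) =
        (x N / (x N - x (N + 1)) * permK s a) • permL s f +
          (x (N + 1) / (x (N + 1) - x N) * a) • f := by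
      intro a f
      rw [dem, permL_smul, smul_smul, smul_smul]
      rfl
    have hsplit : ∀ k ≤ N, ∀ g : ℕ → KT n, ∏ l ∈ (Finset.range (N + 1 + 1)).erase k, g l =
        g (N + 1) * ∏ l ∈ (Finset.range (N + 1)).erase k, g l := by
      intro k hk g
      rw [Finset.range_add_one, Finset.erase_insert_of_ne (by omega), Finset.prod_insert (by simp)]
    have hx' : ∀ l, xi (e (c + l)) = x l := fun _ => rfl
    rw [rowOp, ih, dem_sum, Finset.sum_range_succ, Finset.sum_range_succ, Finset.sum_range_succ,
      hd, add_comm (_ • permL s (u N)), ← add_assoc]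
    simp only [hx']
    have e1 : (Finset.range (N + 1)).erase N = Finset.range N := by
      rw [Finset.range_add_one, Finset.erase_insert (by simp)]
    have e2 : (Finset.range (N + 1 + 1)).erase (N + 1) = Finset.range (N + 1) := by
      rw [Finset.range_add_one, Finset.erase_insert (by simp)]
    refine congrArg₂ (· + ·) (congrArg₂ (· + ·) ?_ ?_) ?_
    · refine Finset.sum_congr rfl fun k hk => ?_
      have hk := Finset.mem_range.1 hk
      have e3 : ∀ g : ℕ → KT n, ∏ l ∈ (Finset.range (N + 1)).erase k, g l =
          g N * ∏ l ∈ (Finset.range N).erase k, g l := by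
        intro g
        rw [Finset.range_add_one, Finset.erase_insert_of_ne (by omega), Finset.prod_insert (by simp)]
      have e4 : permK s (∏ l ∈ (Finset.range N).erase k, x l / (x l - x k)) =
          ∏ l ∈ (Finset.range N).erase k, x l / (x l - x k) := by
        rw [map_prod]
        refine Finset.prod_congr rfl fun l hl => ?_
        have hl := Finset.mem_range.1 (Finset.mem_of_mem_erase hl)
        rw [map_div₀, map_sub, hsx l hl, hsx k hk]
      rw [hd, hu' k N hk (Nat.lt_succ_self N), ← add_smul, hsplit k hk.le, e3, map_mul, e4, map_div₀,
        map_sub, hsN, hsx k hk]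
      congr 1
      -- The merging is the partial fraction identity x_N/(x_N-x_{N+1}) · x_{N+1}/(x_{N+1}-x_k) +
      -- x_{N+1}/(x_{N+1}-x_N) · x_N/(x_N-x_k) = x_N x_{N+1}/((x_N-x_k)(x_{N+1}-x_k)).
      have n1 := hxne N (N + 1) (by omega) (by omega) (by omega)
      have n2 := hxne (N + 1) N (by omega) (by omega) (by omega)
      have n3 := hxne N k (by omega) (by omega) (by omega)
      have n4 := hxne (N + 1) k (by omega) (by omega) (by omega)
      have n5 : x (N + 1) - x N = -(x N - x (N + 1)) := by ring
      rw [n5]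
      field_simp
      ring
    · rw [hsplit N le_rfl, e1]
    · rw [hu N (Nat.lt_succ_self N), e1, e2, Finset.prod_range_succ]
      have e4 : permK s (∏ l ∈ Finset.range N, x l / (x l - x N)) =
          ∏ l ∈ Finset.range N, x l / (x l - x (N + 1)) := by
        rw [map_prod]
        refine Finset.prod_congr rfl fun l hl => ?_
        rw [map_div₀, map_sub, hsx l (Finset.mem_range.1 hl), hsN]
      rw [e4, mul_comm (x N / _)]

/-! ### One row of Demazure operators -/

theorem swap_apply_injOn {α : Type*} [DecidableEq α] {e : ℕ → α} {m : ℕ}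
    (he : Set.InjOn e (Set.Iio m)) {a b l : ℕ} (ha : a < m) (hb : b < m) (hl : l < m) :
    Equiv.swap (e a) (e b) (e l) = e (Equiv.swap a b l) := by
  have h1 : e l = e a ↔ l = a := he.eq_iff hl ha
  have h2 : e l = e b ↔ l = b := he.eq_iff hl hb
  rw [Equiv.swap_apply_def, Equiv.swap_apply_def]
  simp only [h1, h2]
  split_ifs <;> rfl

theorem permL_prod_Om_of_le {n : ℕ} {e : ℕ → ZMod n} {m : ℕ} (he : Set.InjOn e (Set.Iio m))
    {c p : ℕ} (hp : p + 1 < m) (hc : c ≤ p) :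
    permL (Equiv.swap (e p) (e (p + 1))) (∏ l ∈ Finset.range c, Om (e l)) =
      ∏ l ∈ Finset.range c, Om (e l) := by
  rw [map_prod]
  refine Finset.prod_congr rfl fun l hl => ?_
  have hl := Finset.mem_range.1 hl
  rw [permL_Om, swap_apply_injOn he (by omega) hp (by omega),
    Equiv.swap_apply_of_ne_of_ne (by omega) (by omega)]

theorem permL_prod_Om_of_lt {n : ℕ} {e : ℕ → ZMod n} {m : ℕ} (he : Set.InjOn e (Set.Iio m))
    {c p : ℕ} (hp : p + 1 < c) (hc : c ≤ m) :
    permL (Equiv.swap (e p) (e (p + 1))) (∏ l ∈ Finset.range c, Om (e l)) =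
      ∏ l ∈ Finset.range c, Om (e l) := by
  rw [map_prod, ← Equiv.Perm.prod_comp (Equiv.swap p (p + 1)) (Finset.range c)
    (fun l => (Om (e l) : Lam n))]
  · refine Finset.prod_congr rfl fun l hl => ?_
    have hl := Finset.mem_range.1 hl
    rw [permL_Om, swap_apply_injOn he (by omega) (by omega) (by omega)]
  · intro l hl
    rw [Finset.coe_range, Set.mem_Iio]
    by_contra h
    exact hl (Equiv.swap_apply_of_ne_of_ne (by omega) (by omega))

/-- The increasing enumeration of the natural numbers other than `k`. -/
def skip (k l : ℕ) : ℕ := if l < k then l else l + 1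

theorem succAbove_val_eq_skip {N : ℕ} (k : Fin (N + 1)) (l : Fin N) :
    (k.succAbove l).val = skip k l := by
  rw [Fin.succAbove, skip]
  simp only [Fin.lt_def, Fin.val_castSucc]
  split_ifs <;> simp

/-- The last Ω of the product singles out one point and the bialternant lives on the others. The sum
of `rowOp_eq_sum` over the N + 1 positions of that point is the expansion `bialt_succ` for a
suitable q. -/
theorem rowOp_bialt {n : ℕ} {e : ℕ → ZMod n} {m : ℕ} (he : Set.InjOn e (Set.Iio m)) (c N r : ℕ)
    (h : c + N + r < m) :
    rowOp e c N ((∏ l ∈ Finset.range (c + 1), Om (e l)) *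
        bialt r (fun l : Fin (N + r) => xi (e (c + (l + 1)))) (fun l => Om (e (c + (l + 1))))) =
      (∏ l ∈ Finset.range c, Om (e l)) *
        bialt (r + 1) (fun l : Fin (N + r + 1) => xi (e (c + l))) (fun l => Om (e (c + l))) := by
  let u : ℕ → Lam n := fun k => (∏ l ∈ Finset.range c, Om (e l)) * (Om (e (c + k)) *
    bialt r (fun l : Fin (N + r) => xi (e (c + skip k l))) (fun l => Om (e (c + skip k l))))
  have hpu : ∀ k t, t < N → permL (Equiv.swap (e (c + t)) (e (c + t + 1))) (u k) =
      (∏ l ∈ Finset.range c, Om (e l)) *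
        (Om (Equiv.swap (e (c + t)) (e (c + t + 1)) (e (c + k))) *
          bialt r
            (fun l : Fin (N + r) =>
              xi (Equiv.swap (e (c + t)) (e (c + t + 1)) (e (c + skip k l))))
            (fun l => Om (Equiv.swap (e (c + t)) (e (c + t + 1)) (e (c + skip k l))))) := by
    intro k t ht
    rw [map_mul, map_mul, permL_prod_Om_of_le he (by omega) (by omega), permL_Om, permL_bialt]
  have hsk : ∀ k (l : Fin (N + r)), skip k l < N + r + 1 := by
    intro k l
    have := l.2
    rw [skip]
    split_ifs <;> omega
  have hu : ∀ k, k < N → permL (Equiv.swap (e (c + k)) (e (c + k + 1))) (u k) = u (k + 1) := by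
    intro k hk
    have h1 : ∀ l : Fin (N + r), Equiv.swap (e (c + k)) (e (c + k + 1)) (e (c + skip k l)) =
        e (c + skip (k + 1) l) := by
      intro l
      have := hsk k l
      rw [swap_apply_injOn he (by omega) (by omega) (by omega), Equiv.swap_apply_def]
      congr 1
      simp only [skip]
      split_ifs <;> omega
    rw [hpu k k hk, Equiv.swap_apply_left]
    simp only [h1]
    rfl
  have hu' : ∀ k t, k < t → t < N →
      permL (Equiv.swap (e (c + t)) (e (c + t + 1))) (u k) = u k := by
    intro k t hkt ht
    -- Positions t and t + 1 both come after k, so with k omitted they are numbers t - 1 and t;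
    -- exchanging them leaves the bialternant unchanged.
    let τ : Equiv.Perm (Fin (N + r)) := Equiv.swap ⟨t - 1, by omega⟩ ⟨t, by omega⟩
    have hτ : ∀ l : Fin (N + r), (τ l).val =
        if l.val = t - 1 then t else if l.val = t then t - 1 else l := by
      intro l
      simp only [τ, Equiv.swap_apply_def, Fin.ext_iff]
      split_ifs <;> rfl
    have h1 : ∀ l : Fin (N + r), Equiv.swap (e (c + t)) (e (c + t + 1)) (e (c + skip k l)) =
        e (c + skip k (τ l)) := by
      intro l
      have := hsk k l
      rw [swap_apply_injOn he (by omega) (by omega) (by omega), Equiv.swap_apply_def, hτ]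
      congr 1
      simp only [skip]
      split_ifs <;> omega
    rw [hpu k t ht, swap_apply_injOn he (by omega) (by omega) (by omega),
      Equiv.swap_apply_of_ne_of_ne (by omega) (by omega)]
    simp only [h1]
    have := bialt_perm r (fun l : Fin (N + r) => xi (e (c + skip k l)))
      (fun l => (Om (e (c + skip k l)) : Lam n)) τ
    simp only [Function.comp_def] at this
    rw [this]
  have hu0 : u 0 = (∏ l ∈ Finset.range (c + 1), Om (e l)) *
      bialt r (fun l : Fin (N + r) => xi (e (c + (l + 1)))) (fun l => Om (e (c + (l + 1)))) := by
    rw [Finset.prod_range_succ, mul_assoc]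
    rfl
  rw [← hu0, rowOp_eq_sum he c N (by omega) u hu hu']
  set x : ℕ → KT n := fun l => xi (e (c + l)) with hx
  have hx0 : ∀ l, x l ≠ 0 := fun l => xi_ne_zero _
  have hxinj : ∀ a b, a ≤ N + r → b ≤ N + r → a ≠ b → x a - x b ≠ 0 := fun a b ha hb hab =>
    sub_ne_zero.2 fun h' => hab (by
      have := he (Set.mem_Iio.2 (by omega)) (Set.mem_Iio.2 (by omega))
        (xi_injective h')
      omega)
  -- The roots are the r points not reached by the operators. This removes the terms with k > N from
  -- the expansion and, for k ≤ N, cancels the factors x_l/(x_l - x_k) with l > N.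
  let q : Polynomial (KT n) := ∏ t ∈ Finset.range r,
    (1 - Polynomial.C (x (N + 1 + t))⁻¹ * Polynomial.X)
  have hq : q.natDegree ≤ r := by
    refine (Polynomial.natDegree_prod_le _ _).trans ?_
    refine (Finset.sum_le_card_nsmul _ _ 1 fun t _ => ?_).trans (by simp)
    compute_degree
  have hq0 : q.coeff 0 = 1 := by
    rw [Polynomial.coeff_zero_eq_eval_zero, Polynomial.eval_prod]
    simp
  have hqx : ∀ k, q.eval (x k) = ∏ t ∈ Finset.range r, ((x (N + 1 + t) - x k) / x (N + 1 + t)) := by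
    intro k
    rw [Polynomial.eval_prod]
    refine Finset.prod_congr rfl fun t _ => ?_
    have := hx0 (N + 1 + t)
    simp only [Polynomial.eval_sub, Polynomial.eval_one, Polynomial.eval_mul, Polynomial.eval_C,
      Polynomial.eval_X]
    field_simp
  rw [bialt_succ r (by omega) (x := fun l : Fin (N + r + 1) => x l) ?_ _ q hq hq0, Finset.mul_sum]
  · have hterm : ∀ k : Fin (N + r + 1), (∏ l ∈ Finset.range c, Om (e l)) *
        ((q.eval (x k) * ∏ l, (x (k.succAbove l) / (x (k.succAbove l) - x k))) •
          ((Om (e (c + k)) : Lam n) * bialt r ((fun l : Fin (N + r + 1) => x l) ∘ k.succAbove)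
            ((fun l : Fin (N + r + 1) => Om (e (c + l))) ∘ k.succAbove))) =
        (q.eval (x k) * ∏ l ∈ (Finset.range (N + r + 1)).erase k, (x l / (x l - x k))) • u k := by
      intro k
      rw [mul_smul_comm]
      congr 1
      · congr 1
        refine Finset.prod_bij (fun l _ => (k.succAbove l).val) ?_ ?_ ?_ ?_
        · intro l _
          refine Finset.mem_erase.2 ⟨fun h' => k.succAbove_ne l (Fin.ext h'),
            Finset.mem_range.2 (k.succAbove l).2⟩
        · intro a _ b _ hab
          exact Fin.succAbove_right_injective (Fin.ext hab)
        · intro l hl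
          obtain ⟨h1, h2⟩ := Finset.mem_erase.1 hl
          obtain ⟨z, hz⟩ := Fin.exists_succAbove_eq (x := ⟨l, Finset.mem_range.1 h2⟩) (y := k)
            (fun h' => h1 (congrArg Fin.val h'))
          exact ⟨z, Finset.mem_univ _, congrArg Fin.val hz⟩
        · intro l _
          rfl
      · simp only [u, Function.comp_def, succAbove_val_eq_skip, hx]
    refine Eq.trans ?_ (Finset.sum_congr rfl fun k _ => (hterm k).symm)
    rw [← Finset.sum_range (fun k => (q.eval (x k) *
      ∏ l ∈ (Finset.range (N + r + 1)).erase k, (x l / (x l - x k))) • u k),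
      show N + r + 1 = N + 1 + r by omega, Finset.sum_range_add _ (N + 1) r]
    rw [Finset.sum_eq_zero (s := Finset.range r), add_zero]
    · refine Finset.sum_congr rfl fun k hk => ?_
      have hk' := Finset.mem_range.1 hk
      congr 1
      have hdis : (Finset.range (N + 1 + r)).erase k =
          (Finset.range (N + 1)).erase k ∪ (Finset.range r).map (addLeftEmbedding (N + 1)) := by
        ext l
        simp only [Finset.mem_erase, Finset.mem_range, Finset.mem_union, Finset.mem_map,
          addLeftEmbedding_apply]
        constructor
        · rintro ⟨h1, h2⟩
          by_cases h3 : l < N + 1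
          · exact Or.inl ⟨h1, h3⟩
          · exact Or.inr ⟨l - (N + 1), by omega, by omega⟩
        · rintro (⟨h1, h2⟩ | ⟨a, h1, rfl⟩)
          · exact ⟨h1, by omega⟩
          · exact ⟨by omega, by omega⟩
      rw [hdis, Finset.prod_union, Finset.prod_map, mul_comm, mul_assoc, hqx,
        ← Finset.prod_mul_distrib]
      · refine (mul_one _).symm.trans (congrArg₂ (· * ·) rfl (Finset.prod_eq_one ?_).symm)
        intro t ht
        have ht := Finset.mem_range.1 ht
        have h1 := hx0 (N + 1 + t)
        have h2 := hxinj (N + 1 + t) k (by omega) (by omega) (by omega)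
        simp only [addLeftEmbedding_apply]
        field_simp
      · rw [Finset.disjoint_left]
        intro l h1 h2
        have h1 := Finset.mem_range.1 (Finset.mem_of_mem_erase h1)
        obtain ⟨a, _, rfl⟩ := Finset.mem_map.1 h2
        simp only [addLeftEmbedding_apply] at h1
        omega
    · intro t ht
      rw [hqx, Finset.prod_eq_zero ht, zero_mul, zero_smul]
      simp
  · intro a b hab
    by_contra hne
    exact hxinj a b (by omega) (by omega) (fun h' => hne (Fin.ext h')) (sub_eq_zero.2 hab)

/-! ### The word of a rectangle -/

/-- The letter `l` positions after `i + 2`. -/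
def tailIx (n i l : ℕ) : ZMod n := ((i + 2 + l : ℕ) : ZMod n)

theorem tailIx_injOn (n i : ℕ) : Set.InjOn (tailIx n i) (Set.Iio n) := by
  intro a ha b hb h
  simp only [tailIx, Nat.cast_add] at h
  have h' := add_left_cancel h
  rwa [ZMod.natCast_eq_natCast_iff', Nat.mod_eq_of_lt ha, Nat.mod_eq_of_lt hb] at h'

theorem shift_permL_swap {n : ℕ} (m : ℕ) (a b : ZMod n) (f : Lam n) :
    shift m (permL (Equiv.swap a b) f) = permL (Equiv.swap (a + (m : ZMod n)) (b + (m : ZMod n))) (shift m f) := by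
  rw [shift, ← permL_mul, ← permL_mul, Equiv.mul_swap_eq_swap_mul]
  rfl

/-- After the shift by 2i + 1 the residue c - r becomes letter p = i - 1 - r + c of the tail. The
exchange of letters p and p + 1 fixes the product of the first i factors Ω unless p = i - 1, and
there the change in the product is exactly the twist of s_0. -/
theorem mul_shift_opD {n i r c : ℕ} (hi : i ≤ n) (hr : r < i) (hc : i - 1 - r + c + 1 < n) (f : Lam n) :
    (∏ l ∈ Finset.range i, Om (tailIx n i l)) *
        shift (2 * i + 1) (opD ((c : ZMod n) - (r : ZMod n)) f) =
      dem (tailIx n i (i - 1 - r + c)) (tailIx n i (i - 1 - r + c + 1))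
        ((∏ l ∈ Finset.range i, Om (tailIx n i l)) * shift (2 * i + 1) f) := by
  have he := tailIx_injOn n i
  set p := i - 1 - r + c with hp
  set a : ZMod n := (c : ZMod n) - r with ha
  set M : Lam n := ∏ l ∈ Finset.range i, Om (tailIx n i l) with hM
  have h1 : a + ((2 * i + 1 : ℕ) : ZMod n) = tailIx n i p := by
    have : i + 2 + p + r = c + (2 * i + 1) := by omega
    rw [ha, tailIx, sub_add_eq_add_sub, sub_eq_iff_eq_add, ← Nat.cast_add, ← Nat.cast_add, this]
  have h2 : a + 1 + ((2 * i + 1 : ℕ) : ZMod n) = tailIx n i (p + 1) := by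
    rw [add_right_comm, h1, tailIx, tailIx, ← Nat.cast_add_one]
    rfl
  have hne : tailIx n i p ≠ tailIx n i (p + 1) := fun h => by
    have := he (Set.mem_Iio.2 (by omega)) (Set.mem_Iio.2 hc) h
    omega
  have key : M * shift (2 * i + 1) (sAct a f) =
      permL (Equiv.swap (tailIx n i p) (tailIx n i (p + 1))) (M * shift (2 * i + 1) f) := by
    rw [map_mul, sAct]
    -- This is the case of residue 0, a box on the main diagonal: the exchange crosses the end of
    -- the product of Ω's.
    by_cases hpi : p = i - 1
    · have ha0 : a = 0 := by
        rw [ha, show c = r by omega, sub_self]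
      rw [ha0] at h1 h2
      rw [zero_add] at h2
      rw [if_pos ha0, map_mul, map_mul, shift_permL_swap, h1]
      simp only [shift, permL_Om, permL_Om_inv, Equiv.coe_addRight, h1, h2]
      have hM' : M = (∏ l ∈ Finset.range p, Om (tailIx n i l)) * Om (tailIx n i p) := by
        rw [hM, ← Finset.prod_range_succ, show p + 1 = i by omega]
      rw [← mul_assoc, hM', map_mul, permL_prod_Om_of_le he hc le_rfl, permL_Om,
        Equiv.swap_apply_left]
      congr 1
      rw [mul_comm (Om (tailIx n i (p + 1))), mul_assoc, ← mul_assoc (Om (tailIx n i p)),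
        Om_mul_inv, one_mul]
    · have ha0 : a ≠ 0 := by
        intro h0
        have h3 : tailIx n i (i - 1) = tailIx n i p := by
          rw [← h1, h0, zero_add, tailIx]
          congr 1
          omega
        have := he (Set.mem_Iio.2 (by omega)) (Set.mem_Iio.2 (by omega)) h3
        omega
      rw [if_neg ha0, shift_permL_swap, h1, h2]
      congr 1
      rcases Nat.lt_or_ge (p + 1) i with h | h
      · rw [hM, permL_prod_Om_of_lt he h hi]
      · rw [hM, permL_prod_Om_of_le he hc (by omega)]
  have hk : permK (Equiv.addRight ((2 * i + 1 : ℕ) : ZMod n))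
      (1 - expK (wt n a - wt n (a + 1)))⁻¹ =
      (1 - expK (wt n (tailIx n i p) - wt n (tailIx n i (p + 1))))⁻¹ := by
    rw [map_inv₀, map_sub, map_one, permK_expK, map_sub, permW_wt, permW_wt]
    simp only [Equiv.coe_addRight, h1, h2]
  rw [dem_eq hne, ← key, opD, opT, map_add, mul_add, shift, permL_smul, hk, mul_smul_comm, map_sub,
    mul_sub]

theorem mul_shift_foldr_opD {n i r N : ℕ} (hi : i ≤ n) (hr : r < i) (hN : i - 1 - r + N < n) (f : Lam n) :
    (∏ l ∈ Finset.range i, Om (tailIx n i l)) * shift (2 * i + 1)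
        (((List.range N).map fun c : ℕ => (c : ZMod n) - (r : ZMod n)).reverse.foldr opD f) =
      rowOp (tailIx n i) (i - 1 - r) N
        ((∏ l ∈ Finset.range i, Om (tailIx n i l)) * shift (2 * i + 1) f) := by
  induction N with
  | zero => simp [rowOp]
  | succ N ih =>
    rw [List.range_succ, List.map_append, List.reverse_append, List.map_singleton,
      List.reverse_singleton, List.singleton_append, List.foldr_cons, mul_shift_opD hi hr (by omega),
      ih (by omega), rowOp]

theorem residueWord_replicate_succ (n r N : ℕ) : residueWord n (List.replicate (r + 1) N) =
    ((List.range N).map fun c : ℕ => (c : ZMod n) - (r : ZMod n)).reverse ++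
      residueWord n (List.replicate r N) := by
  simp only [residueWord, List.replicate_succ', List.zipIdx_append, List.flatMap_append,
    List.reverse_append, List.length_replicate, List.zipIdx_cons, List.zipIdx_nil,
    List.flatMap_singleton, zero_add]
  simp [← List.map_eq_flatMap, Function.comp_def]

/-- Each row of boxes consumes the last remaining Ω and enlarges the bialternant by one point and by
one row carrying Ω. At r = 0 the bialternant is 1; at r = i no Ω is left outside and all n - 1
points are used. -/
theorem mul_shift_gClosed_replicate {n i N : ℕ} (hn : n = N + i + 1) (r : ℕ) (hr : r ≤ i) :
    (∏ l ∈ Finset.range i, Om (tailIx n i l)) *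
        shift (2 * i + 1) (gClosed n (List.replicate r N)) =
      (∏ l ∈ Finset.range (i - r), Om (tailIx n i l)) *
        bialt r (fun l : Fin (N + r) => xi (tailIx n i (i - r + l)))
          (fun l => Om (tailIx n i (i - r + l))) := by
  induction r with
  | zero =>
    rw [bialt_zero]
    · simp [gClosed, residueWord]
    · intro a b h
      have h' := tailIx_injOn n i (Set.mem_Iio.2 (by omega)) (Set.mem_Iio.2 (by omega))
        (xi_injective h)
      exact Fin.ext (by omega)
  | succ r ih =>
    have h := rowOp_bialt (tailIx_injOn n i) (i - 1 - r) N r (by omega)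
    rw [gClosed, residueWord_replicate_succ, List.foldr_append,
      mul_shift_foldr_opD (by omega) (by omega) (by omega), ← gClosed, ih (by omega)]
    rw [show i - (r + 1) = i - 1 - r by omega]
    refine Eq.trans ?_ h
    rw [show i - r = i - 1 - r + 1 by omega]
    simp only [add_assoc, add_comm 1]

/-! ### The image of the quantum Grothendieck polynomial -/

theorem prod_Icc_Om_eq (n i : ℕ) : (∏ l ∈ Finset.Icc 1 i, (Om ((i + l + 1 : ℕ) : ZMod n) : Lam n)) =
    ∏ l ∈ Finset.range i, Om (tailIx n i l) := by
  refine (Finset.prod_bij (fun l _ => l + 1) ?_ ?_ ?_ ?_).symm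
  · intro l hl
    have := Finset.mem_range.1 hl
    exact Finset.mem_Icc.2 ⟨by omega, by omega⟩
  · intro a _ b _ h
    exact Nat.succ_injective h
  · intro l hl
    have := Finset.mem_Icc.1 hl
    exact ⟨l - 1, Finset.mem_range.2 (by omega), by omega⟩
  · intro l _
    rw [tailIx, show i + 2 + l = i + (l + 1) + 1 by omega]

theorem constantCoeff_beta_sig_ne_zero (n i : ℕ) :
    MvPowerSeries.constantCoeff (beta n (sig n i)) ≠ 0 :=
  ((isUnit_beta_sig n i).map MvPowerSeries.constantCoeff).ne_zero

/-- Both sides, multiplied by σ_i, equal the bialternant with i rows carrying Ω on the points i + 2,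
…, i + n; σ_i is invertible because its constant term is nonzero. -/
theorem PhiTilde_psi {n : ℕ} {Φ : OYo n →ₐ[RT n] OZo n} (h : ∀ f, Φ (clsY f) = evalY n f)
    {i : ℕ} (hi : i < n) :
    PhiTilde Φ (clsY (psi n i)) =
      (beta n (sig n i))⁻¹ * (∏ l ∈ Finset.Icc 1 i, Om ((i + l + 1 : ℕ) : ZMod n)) *
        shift (2 * i + 1) (gClosed n (List.replicate i (n - i - 1))) := by
  obtain ⟨N, rfl⟩ : ∃ N, n = N + i + 1 := ⟨n - i - 1, by omega⟩
  have h1 := PhiTilde_psi_mul h i hi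
  rw [leadingMinor_eq_bialt_tail i (by omega)] at h1
  have h2 := mul_shift_gClosed_replicate (n := N + i + 1) rfl i le_rfl
  simp only [Nat.sub_self, Finset.range_zero, Finset.prod_empty, one_mul, zero_add] at h2
  rw [show N + i + 1 - i - 1 = N by omega, prod_Icc_Om_eq, mul_assoc, h2]
  change _ = bialt i (fun l : Fin (N + i) => xi (tailIx (N + i + 1) i l))
    (fun l => Om (tailIx (N + i + 1) i l)) at h1
  rw [← h1, mul_comm (PhiTilde Φ _), ← mul_assoc,
    MvPowerSeries.inv_mul_cancel _ (constantCoeff_beta_sig_ne_zero _ i), one_mul]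

theorem PhiTilde_grothLongest (n : ℕ) (Φ : OYo n →ₐ[RT n] OZo n) :
    PhiTilde Φ (clsY (grothLongest n)) =
      ∏ i ∈ Finset.Icc 1 (n - 1), PhiTilde Φ (clsY (psi n i)) := by
  rw [grothLongest, ← clsHom_apply, map_prod, PhiTilde, map_prod, map_prod]
  rfl

theorem prod_inv_of_constantCoeff_ne_zero {σ K ι : Type*} [Field K] (s : Finset ι)
    (f : ι → MvPowerSeries σ K) (hf : ∀ i ∈ s, MvPowerSeries.constantCoeff (f i) ≠ 0) :
    ∏ i ∈ s, (f i)⁻¹ = (∏ i ∈ s, f i)⁻¹ := by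
  rw [MvPowerSeries.eq_inv_iff_mul_eq_one, ← Finset.prod_mul_distrib]
  · exact Finset.prod_eq_one fun i hi => MvPowerSeries.inv_mul_cancel _ (hf i hi)
  · rw [map_prod]
    exact Finset.prod_ne_zero_iff.2 hf

theorem gClosed_replicate_zero (n i : ℕ) : gClosed n (List.replicate i 0) = 1 := by
  induction i with
  | zero => simp [gClosed, residueWord]
  | succ i ih => rw [gClosed, residueWord_replicate_succ]; simpa [gClosed] using ih

end KPeterson

end

theorem mainTheorem9 (n : ℕ) (hn : 2 ≤ n) :
    ∃ Φ : OYo n →ₐ[RT n] OZo n,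
      IsPhi Φ ∧ (∀ Φ' : OYo n →ₐ[RT n] OZo n, IsPhi Φ' → Φ' = Φ) ∧
      (∀ i : ℕ, 1 ≤ i → i ≤ n - 1 →
        PhiTilde Φ (clsY (psi n i)) =
          (beta n (sig n i))⁻¹ * (∏ l ∈ Finset.Icc 1 i, Om ((i + l + 1 : ℕ) : ZMod n)) *
            shift (2 * i + 1) (gClosed n (List.replicate i (n - i - 1)))) ∧
      PhiTilde Φ (clsY (grothLongest n)) =
        (∏ i ∈ Finset.Icc 1 (n - 1), beta n (sig n i))⁻¹ *
          (∏ i ∈ Finset.Icc 1 (n - 1), ∏ l ∈ Finset.Icc 1 i, Om ((i + l + 1 : ℕ) : ZMod n)) *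
          ∏ i ∈ Finset.Icc 1 (n - 2),
            shift (2 * i + 1) (gClosed n (List.replicate i (n - i - 1))) := by
  have : NeZero n := ⟨by omega⟩
  obtain ⟨Φ, hΦ⟩ := exists_hom_clsY n
  have hpsi : ∀ i : ℕ, 1 ≤ i → i ≤ n - 1 → PhiTilde Φ (clsY (psi n i)) =
      (beta n (sig n i))⁻¹ * (∏ l ∈ Finset.Icc 1 i, Om ((i + l + 1 : ℕ) : ZMod n)) *
        shift (2 * i + 1) (gClosed n (List.replicate i (n - i - 1))) :=
    fun i h1 h2 => PhiTilde_psi hΦ (by omega)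
  refine ⟨Φ, isPhi_of_eval hΦ, fun Φ' h' => (isPhi_of_eval hΦ).unique h', hpsi, ?_⟩
  rw [PhiTilde_grothLongest, Finset.prod_congr rfl fun i hi =>
    hpsi i (Finset.mem_Icc.1 hi).1 (Finset.mem_Icc.1 hi).2, Finset.prod_mul_distrib,
    Finset.prod_mul_distrib, prod_inv_of_constantCoeff_ne_zero _ _ fun i _ =>
      constantCoeff_beta_sig_ne_zero n i]
  congr 1
  obtain ⟨m, rfl⟩ : ∃ m, n = m + 2 := ⟨n - 2, by omega⟩
  -- For i = n - 1 the rectangle has rows of length 0 and contributes 1, so the last product stops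
  -- at n - 2.
  rw [show m + 2 - 1 = m + 1 by omega, Finset.prod_Icc_succ_top (by omega),
    show m + 2 - (m + 1) - 1 = 0 by omega, gClosed_replicate_zero, map_one, mul_one]
  rfl
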